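/- **Sketches.** An *AU-sketch* $T$ consists of sets of nodes, edges, commutativities, and universals of five kinds (terminal, pullback, initial, pushout, list), with the following operations. Each edge has a domain and a codomain, and each node $X$ an identity edge $s(X)\colon X\to X$. Each commutativity is a triangle of edges $u\colon X\to Y$, $v\colon Y\to Z$, $w\colon X\to Z$, written $uv\diamond w$; we write $u\diamond u'$ for $s(X)u\diamond u'$. A terminal (initial) universal has a subject node. A pullback universal has two commutativities $p^1u_1\diamond p$, $p^2u_2\diamond p$, and a pushout universal two commutativities $u_1q^1\diamond q$, $u_2q^2\diamond q$. A list universal has a terminal universal with subject $T$, a pullback universal with projections $p^1\colon P\to A$, $p^2\colon P\to L$ over edges $A\to T\leftarrow L$, and edges $\varepsilon\colon T\to L$, $\mathrm{cons}\colon P\to L$. Homomorphisms preserve all operations; two homomorphisms are regarded as equal if they agree on nodes and edges. **Extensions and contexts.** A *proto-extension* is a homomorphism that is, on each sort, a coproduct inclusion $U_\Xi\to U_\Xi+\delta\Xi$ with $\delta\Xi$ finite. A *simple extension* is a proto-extension that freely adjoins one of: a node (with its identity); an edge between two given nodes; a commutativity on a given triangle of edges; a terminal universal, an initial universal, a pullback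 universal on a given cospan, a pushout universal on a given span, or a list universal on a given node (with fresh subjects, and their identities and commutativities). An *extension* is a finite composite of simple extensions (up to isomorphism). A *context* is an extension of the empty sketch. **Equivalence extensions.** A *simple equivalence extension* is a proto-extension that freely adjoins one of the following: - for composable edges $u,v$: an edge $w$ with $uv\diamond w$; - for an edge $u\colon X\to Y$: $s(X)u\diamond u$, or $u\,s(Y)\diamond u$; - given $uv\diamond k$ and $vw\diamond l$: $kw\diamond m$ if $ul\diamond m$ is given, or $ul\diamond m$ if $kw\diamond m$ is given; - a universal of any of the five kinds, as above; - an edge from a given node to a terminal node (from an initial node to a given node); or $w\diamond w'$ for parallel edges $w,w'$ into a terminal node (out of an initial node); - for a pullback universal as above: given $v_1u_1\diamond v$ and $v_2u_2\diamond v$, an edge $w$ with $wp^i\diamond v_i$ ($i=1,2$); or $w\diamond w'$, given $wp^i\diamond v_i$ and $w'p^i\diamond v_i$ ($i=1,2$); and dually for a pushout universal; - for a list universal on $A$ and edges $y\colon B\to Y$, $g\colon A\times Y\to Y$, with products (pullback universals over terminal nodes) $L\times B$, $(A\times L)\times B$, $A\times(L\times B)$, $A\times Y$, and edges characterized by commutativities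 as $\langle\varepsilon !,\mathrm{id}\rangle\colon B\to L\times B$, $\mathrm{cons}\times B$ and the associativity $(A\times L)\times B\to A\times(L\times B)$: edges $r\colon L\times B\to Y$, $r'=A\times r$ and three diagonals, with the seven commutativities saying that $r' = A\times r$, $r\circ\langle\varepsilon !,\mathrm{id}\rangle=y$ and $r\circ(\mathrm{cons}\times B)=g\circ r'\circ(\text{assoc})$; or $r_1\diamond r_2$, given two such solutions $r_1,r_2$; - an inverse $u^{-1}$ of an edge $u\colon X\to Y$, with $uu^{-1}\diamond s(X)$ and $u^{-1}u\diamond s(Y)$, where one of the following is given: (balance) universals for the kernel pair and the cokernel pair of $u$, with $p^1\diamond p^2$ and $q^1\diamond q^2$; (stability of initial objects) an initial universal for $Y$; (stability of pushouts) universals and commutativities exhibiting $u$ as the comparison edge from the pushout of the pullback of a span to the pullback of its pushout; (exactness) universals and commutativities exhibiting $u$ as the comparison edge from an equivalence relation to the kernel pair of its coequalizer. An *equivalence extension* is a finite composite of simple equivalence extensions (up to isomorphism). **Object equalities.** In a sketch, the edges that are *object equalities* $\gamma\colon X\Rightarrow Y$ are generated inductively as follows: $X=Y$ and $\gamma\diamond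 s(X)$; $X$ and $Y$ are subjects of terminal universals; or of initial universals; or of pullback universals (projections $p^i$ over $u_i\colon U_i\to U_3$, and $q^i$ over $v_i\colon V_i\to V_3$) for which there are object equalities $\gamma_j\colon U_j\Rightarrow V_j$ ($j=1,2,3$) and, with the necessary composites present, commutativities expressing $u_i\gamma_3=\gamma_iv_i$, $p^1\gamma_1v_1=p^2\gamma_2v_2$ and $\gamma q^i=p^i\gamma_i$ (juxtaposition is composition in diagrammatic order); dually for pushout universals; or $X=L_1$, $Y=L_2$ for list universals on $A_1,A_2$ for which there is an object equality $\gamma_A\colon A_1\Rightarrow A_2$ and $\gamma$ is characterized by commutativities as $\mathrm{List}(\gamma_A)$. An *object equality* from a homomorphism $f_0\colon T_1\to T_0$ to $f_1\colon T_1\to T_0$ consists of object equalities $\gamma_X\colon f_0(X)\Rightarrow f_1(X)$ for all nodes $X$ of $T_1$, and edges $\gamma_u\colon f_0(X)\to f_1(Y)$ for all edges $u\colon X\to Y$ of $T_1$, with $f_0(u)\gamma_Y\diamond\gamma_u$ and $\gamma_Xf_1(u)\diamond\gamma_u$. **Context maps.** A *context map* $T_0\to T_1$ between contexts is an opspan $(e,f)$,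 where $e\colon T_0\to T_0'$ is an equivalence extension and $f\colon T_1\to T_0'$ is a homomorphism. The composite of $(e_0,f_0)\colon T_0\to T_1$ and $(e_1,f_1)\colon T_1\to T_2$ is formed with the pushout of $e_1$ along $f_0$ in the category of sketches and homomorphisms (there compared on all sorts). Two context maps $(e_i,f_i)\colon T_0\to T_1$ ($i=0,1$) are *objectively equal* if there are an equivalence extension $e$ of $T_0$ and homomorphisms $\varepsilon_0,\varepsilon_1$ with $e_0\varepsilon_0=e=e_1\varepsilon_1$ and an object equality from $f_0\varepsilon_0$ to $f_1\varepsilon_1$ (composites in diagrammatic order). **Theorem.** Let $\mathbf{Con}_{\to}$ be the category of contexts and homomorphisms. Objective equality is a congruence, so that contexts, with context maps modulo objective equality, form a category $\mathbf{Con}$, and $f\mapsto(\mathrm{Id},f)$ defines a functor $(\mathrm{Id},-)\colon\mathbf{Con}_{\to}^{\mathrm{op}}\to\mathbf{Con}$. This functor sends any two homomorphisms between which there is an object equality to equal morphisms, and it sends every equivalence extension between contexts to an isomorphism. It is universal with these two properties: for every category $\mathcal C$ and every functor $F\colon\mathbf{Con}_{\to}^{\mathrm{op}}\to\mathcal C$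 with these two properties, there is a unique functor $F'\colon\mathbf{Con}\to\mathcal C$ such that $F'\circ(\mathrm{Id},-)=F$. -/

import Mathlib

open CategoryTheory

namespace AUSketch

/-! ### Sketches -/

/-- An AU-sketch: a reflexive graph of nodes and edges, with commutativities (triangles
`l` followed by `r` equals `c`) and universals for terminal objects, pullbacks, initial objects,
pushouts and list objects. -/
structure Sketch where
  /-- nodes -/
  N : Type
  /-- edges -/
  E : Type
  /-- commutativities -/
  Tri : Type
  /-- terminal universals -/
  Ut : Type
  /-- pullback universals -/
  Upb : Type
  /-- initial universals -/
  Ui : Type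
  /-- pushout universals -/
  Upo : Type
  /-- list universals -/
  Ul : Type
  idn : N → E
  dom : E → N
  cod : E → N
  /-- first edge of the triangle -/
  l : Tri → E
  /-- second edge of the triangle -/
  r : Tri → E
  /-- composite edge of the triangle -/
  c : Tri → E
  tn : Ut → N
  pb1 : Upb → Tri
  pb2 : Upb → Tri
  in0 : Ui → N
  po1 : Upo → Tri
  po2 : Upo → Tri
  lpb : Ul → Upb
  lt : Ul → Ut
  le : Ul → E
  lcons : Ul → E
  dom_idn : ∀ X, dom (idn X) = X
  cod_idn : ∀ X, cod (idn X) = X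
  cod_l : ∀ t, cod (l t) = dom (r t)
  dom_l : ∀ t, dom (l t) = dom (c t)
  cod_r : ∀ t, cod (r t) = cod (c t)
  c_pb : ∀ w, c (pb1 w) = c (pb2 w)
  c_po : ∀ w, c (po1 w) = c (po2 w)
  cod_c_lpb : ∀ w, cod (c (pb1 (lpb w))) = tn (lt w)
  dom_le : ∀ w, dom (le w) = tn (lt w)
  dom_lcons : ∀ w, dom (lcons w) = dom (l (pb1 (lpb w)))
  cod_le : ∀ w, cod (le w) = cod (l (pb2 (lpb w)))
  cod_lcons : ∀ w, cod (lcons w) = cod (l (pb2 (lpb w)))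

/-- A homomorphism of sketches: a function for each sort, preserving the operations. -/
@[ext]
structure Sketch.Hom (U V : Sketch) where
  node : U.N → V.N
  edge : U.E → V.E
  tri : U.Tri → V.Tri
  ut : U.Ut → V.Ut
  upb : U.Upb → V.Upb
  ui : U.Ui → V.Ui
  upo : U.Upo → V.Upo
  ul : U.Ul → V.Ul
  map_idn : ∀ x, edge (U.idn x) = V.idn (node x)
  map_dom : ∀ x, node (U.dom x) = V.dom (edge x)
  map_cod : ∀ x, node (U.cod x) = V.cod (edge x)
  map_l : ∀ x, edge (U.l x) = V.l (tri x)
  map_r : ∀ x, edge (U.r x) = V.r (tri x)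
  map_c : ∀ x, edge (U.c x) = V.c (tri x)
  map_tn : ∀ x, node (U.tn x) = V.tn (ut x)
  map_pb1 : ∀ x, tri (U.pb1 x) = V.pb1 (upb x)
  map_pb2 : ∀ x, tri (U.pb2 x) = V.pb2 (upb x)
  map_in0 : ∀ x, node (U.in0 x) = V.in0 (ui x)
  map_po1 : ∀ x, tri (U.po1 x) = V.po1 (upo x)
  map_po2 : ∀ x, tri (U.po2 x) = V.po2 (upo x)
  map_lpb : ∀ x, upb (U.lpb x) = V.lpb (ul x)
  map_lt : ∀ x, ut (U.lt x) = V.lt (ul x)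
  map_le : ∀ x, edge (U.le x) = V.le (ul x)
  map_lcons : ∀ x, edge (U.lcons x) = V.lcons (ul x)

/-- Sketches and homomorphisms, where morphisms are compared on all sorts. The coarser
comparison, on nodes and edges only, is `Sketch.Hom.Same`. -/
instance : Category Sketch where
  Hom := Sketch.Hom
  id U := { node := id, edge := id, tri := id, ut := id, upb := id, ui := id, upo := id, ul := id,
            map_idn := fun _ => rfl, map_dom := fun _ => rfl, map_cod := fun _ => rfl,
            map_l := fun _ => rfl, map_r := fun _ => rfl, map_c := fun _ => rfl,
            map_tn := fun _ => rfl, map_pb1 := fun _ => rfl, map_pb2 := fun _ => rfl,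
            map_in0 := fun _ => rfl, map_po1 := fun _ => rfl, map_po2 := fun _ => rfl,
            map_lpb := fun _ => rfl, map_lt := fun _ => rfl, map_le := fun _ => rfl,
            map_lcons := fun _ => rfl }
  comp f g :=
    { node := g.node ∘ f.node, edge := g.edge ∘ f.edge, tri := g.tri ∘ f.tri, ut := g.ut ∘ f.ut,
      upb := g.upb ∘ f.upb, ui := g.ui ∘ f.ui, upo := g.upo ∘ f.upo, ul := g.ul ∘ f.ul,
      map_idn := fun _ => by simp only [Function.comp, f.map_idn, g.map_idn]
      map_dom := fun _ => by simp only [Function.comp, f.map_dom, g.map_dom]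
      map_cod := fun _ => by simp only [Function.comp, f.map_cod, g.map_cod]
      map_l := fun _ => by simp only [Function.comp, f.map_l, g.map_l]
      map_r := fun _ => by simp only [Function.comp, f.map_r, g.map_r]
      map_c := fun _ => by simp only [Function.comp, f.map_c, g.map_c]
      map_tn := fun _ => by simp only [Function.comp, f.map_tn, g.map_tn]
      map_pb1 := fun _ => by simp only [Function.comp, f.map_pb1, g.map_pb1]
      map_pb2 := fun _ => by simp only [Function.comp, f.map_pb2, g.map_pb2]
      map_in0 := fun _ => by simp only [Function.comp, f.map_in0, g.map_in0]
      map_po1 := fun _ => by simp only [Function.comp, f.map_po1, g.map_po1]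
      map_po2 := fun _ => by simp only [Function.comp, f.map_po2, g.map_po2]
      map_lpb := fun _ => by simp only [Function.comp, f.map_lpb, g.map_lpb]
      map_lt := fun _ => by simp only [Function.comp, f.map_lt, g.map_lt]
      map_le := fun _ => by simp only [Function.comp, f.map_le, g.map_le]
      map_lcons := fun _ => by simp only [Function.comp, f.map_lcons, g.map_lcons] }

/-- Equality of homomorphisms in the sense used for contexts: agreement on nodes and edges. -/
def Sketch.Hom.Same {U V : Sketch} (f g : U ⟶ V) : Prop :=
  f.node = g.node ∧ f.edge = g.edge

/-! ### Configurations in a sketch -/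

namespace Sketch

variable (U : Sketch)

/-- `t` is a commutativity for the triangle `u v = w` (diagrammatic order). -/
def IsTri (t : U.Tri) (u v w : U.E) : Prop := U.l t = u ∧ U.r t = v ∧ U.c t = w

/-- There is a commutativity `u v = w`. -/
def Comm (u v w : U.E) : Prop := ∃ t, U.IsTri t u v w

/-- Unary commutativity: there is a commutativity `id u = u'`. -/
def UComm (u u' : U.E) : Prop := U.Comm (U.idn (U.dom u)) u u'

/-- `X` is the subject of a terminal universal. -/
def Term (X : U.N) : Prop := ∃ w, U.tn w = X

/-- `X` is the subject of an initial universal. -/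
def Init0 (X : U.N) : Prop := ∃ w, U.in0 w = X

/-- There is a pullback universal for `u₁, u₂` with projections `p₁, p₂`. -/
def Pb (p₁ p₂ u₁ u₂ : U.E) : Prop :=
  ∃ w, U.l (U.pb1 w) = p₁ ∧ U.l (U.pb2 w) = p₂ ∧ U.r (U.pb1 w) = u₁ ∧ U.r (U.pb2 w) = u₂

/-- There is a pushout universal for `u₁, u₂` with injections `q₁, q₂`. -/
def Po (q₁ q₂ u₁ u₂ : U.E) : Prop :=
  ∃ w, U.r (U.po1 w) = q₁ ∧ U.r (U.po2 w) = q₂ ∧ U.l (U.po1 w) = u₁ ∧ U.l (U.po2 w) = u₂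

/-- `p₁, p₂` are the projections of a product (a pullback over a terminal). -/
def Prod0 (p₁ p₂ : U.E) : Prop := ∃ u₁ u₂, U.Pb p₁ p₂ u₁ u₂ ∧ U.Term (U.cod u₁)

/-- `q₁, q₂` are the injections of a coproduct (a pushout under an initial). -/
def Coprod0 (q₁ q₂ : U.E) : Prop := ∃ u₁ u₂, U.Po q₁ q₂ u₁ u₂ ∧ U.Init0 (U.dom u₁)

/-- There is a list universal with structure edges `ε : T → L`, `k : P → L`, where `P` is the
product of `A` and `L` with projections `p₁ : P → A`, `p₂ : P → L`. -/
def Lst (p₁ p₂ ε k : U.E) : Prop :=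
  ∃ w, U.l (U.pb1 (U.lpb w)) = p₁ ∧ U.l (U.pb2 (U.lpb w)) = p₂ ∧ U.le w = ε ∧ U.lcons w = k

/-- The configuration on which list recursion is performed. The list universal is
`ε : T → L`, `k : A × L → L`; the projections of `L × B`, `(A × L) × B`, `A × (L × B)` and `A × Y`
are `q`, `π`, `s` and `z`; `y : B → Y` and `g : A × Y → Y` are the recursion data;
`i = ⟨! ε, B⟩ : B → L × B`, `κ = k × B : (A × L) × B → L × B`, and
`a : (A × L) × B → A × (L × B)` is the associativity. -/
structure RecData (p₁ p₂ ε k q₁ q₂ π₁ π₂ s₁ s₂ z₁ z₂ y g i κ a : U.E) : Prop where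
  lst : U.Lst p₁ p₂ ε k
  prodLB : U.Prod0 q₁ q₂
  cod_q₁ : U.cod q₁ = U.cod p₂
  prodPB : U.Prod0 π₁ π₂
  cod_π₁ : U.cod π₁ = U.dom p₁
  cod_π₂ : U.cod π₂ = U.cod q₂
  prodALB : U.Prod0 s₁ s₂
  cod_s₁ : U.cod s₁ = U.cod p₁
  cod_s₂ : U.cod s₂ = U.dom q₁
  prodAY : U.Prod0 z₁ z₂
  cod_z₁ : U.cod z₁ = U.cod p₁
  dom_y : U.dom y = U.cod q₂
  cod_y : U.cod y = U.cod z₂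
  dom_g : U.dom g = U.dom z₁
  cod_g : U.cod g = U.cod z₂
  spec_i : ∃ t b, U.Comm t ε b ∧ U.Comm i q₁ b ∧ U.Comm i q₂ (U.idn (U.cod q₂))
  spec_κ : ∃ b, U.Comm π₁ k b ∧ U.Comm κ q₁ b ∧ U.Comm κ q₂ π₂
  spec_a : ∃ b₁ b₂ h, U.Comm π₁ p₁ b₁ ∧ U.Comm a s₁ b₁ ∧
    U.Comm π₁ p₂ b₂ ∧ U.Comm h q₁ b₂ ∧ U.Comm h q₂ π₂ ∧ U.Comm a s₂ h

/-- `r : L × B → Y` solves the recursion equations, with `r' = A × r`, and `r''`, `g'`, `g''` the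
auxiliary diagonals. -/
structure RecSol (s₁ s₂ z₁ z₂ y g i κ a r r' r'' g' g'' : U.E) : Prop where
  base : U.Comm i r y
  step₁ : U.Comm κ r g''
  step₂ : U.Comm a g' g''
  step₃ : U.Comm r' g g'
  fst : U.Comm r' z₁ s₁
  snd₁ : U.Comm r' z₂ r''
  snd₂ : U.Comm s₂ r r''

/-- The configuration for stability of pushouts: the pushout `v₁, v₂` of `u₁, u₂` with diagonal
`v`, its pullback along `w`, the pushout `j₁, j₂` of the pulled back span `u₁', u₂'`, and the
comparison edge `e`. -/
structure PoStab (u₁ u₂ v₁ v₂ v w v₁' x₁ v₂' x₂ p z u₁' u₂' j₁ j₂ e : U.E) : Prop where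
  bottom : ∃ o, U.r (U.po1 o) = v₁ ∧ U.r (U.po2 o) = v₂ ∧ U.l (U.po1 o) = u₁ ∧
    U.l (U.po2 o) = u₂ ∧ U.c (U.po1 o) = v
  face₁ : U.Pb v₁' x₁ w v₁
  face₂ : U.Pb v₂' x₂ w v₂
  face : U.Pb p z w v
  fill₁ : U.Comm u₁' v₁' p ∧ ∃ d, U.Comm z u₁ d ∧ U.Comm u₁' x₁ d
  fill₂ : U.Comm u₂' v₂' p ∧ ∃ d, U.Comm z u₂ d ∧ U.Comm u₂' x₂ d
  top : U.Po j₁ j₂ u₁' u₂'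
  cmp₁ : U.Comm j₁ e v₁'
  cmp₂ : U.Comm j₂ e v₂'

/-- The configuration for exactness: `π₁, π₂ : X₁ → X₀` is an equivalence relation (jointly monic
through `π : X₁ → X₀ × X₀`, reflexive by `ρ`, symmetric by `σ`, transitive by `τ`),
`γ` is the coequalizer of `π₁, π₂` (as the pushout of `f₁ = [π₁, id]` and `f₂ = [π₂, id]`),
and `e` is the comparison edge to the kernel pair `k₁, k₂` of `γ`. -/
structure Exactness (π₁ π₂ ρ σ τ e : U.E) : Prop where
  dom_eq : U.dom π₁ = U.dom π₂
  cod_eq : U.cod π₁ = U.cod π₂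
  monic : ∃ x₁ x₂ π d₁ d₂, U.Prod0 x₁ x₂ ∧ U.cod x₁ = U.cod π₁ ∧ U.cod x₂ = U.cod π₁ ∧
    U.Comm π x₁ π₁ ∧ U.Comm π x₂ π₂ ∧ U.Pb d₁ d₂ π π ∧ U.UComm d₁ d₂
  refl₁ : U.Comm ρ π₁ (U.idn (U.cod π₁))
  refl₂ : U.Comm ρ π₂ (U.idn (U.cod π₁))
  symm₁ : U.Comm σ π₁ π₂
  symm₂ : U.Comm σ π₂ π₁
  trans : ∃ t₁ t₂ b₁ b₂, U.Pb t₁ t₂ π₂ π₁ ∧ U.Comm t₁ π₁ b₁ ∧ U.Comm τ π₁ b₁ ∧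
    U.Comm t₂ π₂ b₂ ∧ U.Comm τ π₂ b₂
  quot : ∃ c₁ c₂ f₁ f₂ γ γ' k₁ k₂, U.Coprod0 c₁ c₂ ∧
    U.dom c₁ = U.dom π₁ ∧ U.dom c₂ = U.cod π₁ ∧
    U.Comm c₁ f₁ π₁ ∧ U.Comm c₂ f₁ (U.idn (U.cod π₁)) ∧
    U.Comm c₁ f₂ π₂ ∧ U.Comm c₂ f₂ (U.idn (U.cod π₁)) ∧
    U.Po γ γ' f₁ f₂ ∧ U.Pb k₁ k₂ γ γ ∧ U.Comm e k₁ π₁ ∧ U.Comm e k₂ π₂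

/-- `γ : dom γ ⇒ cod γ` is an object equality. -/
inductive ObjEq : U.E → Prop
  | refl {γ : U.E} : U.dom γ = U.cod γ → U.UComm γ (U.idn (U.dom γ)) → ObjEq γ
  | term {γ : U.E} : U.Term (U.dom γ) → U.Term (U.cod γ) → ObjEq γ
  | init0 {γ : U.E} : U.Init0 (U.dom γ) → U.Init0 (U.cod γ) → ObjEq γ
  | pb {p₁ p₂ u₁ u₂ q₁ q₂ v₁ v₂ γ₁ γ₂ γ₃ γ d₁ d₂ h₁ h₂ d : U.E} :
      U.Pb p₁ p₂ u₁ u₂ → U.Pb q₁ q₂ v₁ v₂ → ObjEq γ₁ → ObjEq γ₂ → ObjEq γ₃ →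
      U.Comm u₁ γ₃ d₁ → U.Comm γ₁ v₁ d₁ → U.Comm u₂ γ₃ d₂ → U.Comm γ₂ v₂ d₂ →
      U.Comm p₁ γ₁ h₁ → U.Comm p₂ γ₂ h₂ → U.Comm h₁ v₁ d → U.Comm h₂ v₂ d →
      U.Comm γ q₁ h₁ → U.Comm γ q₂ h₂ → ObjEq γ
  | po {p₁ p₂ u₁ u₂ q₁ q₂ v₁ v₂ γ₁ γ₂ γ₃ γ d₁ d₂ h₁ h₂ d : U.E} :
      U.Po p₁ p₂ u₁ u₂ → U.Po q₁ q₂ v₁ v₂ → ObjEq γ₁ → ObjEq γ₂ → ObjEq γ₃ →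
      U.Comm u₁ γ₁ d₁ → U.Comm γ₃ v₁ d₁ → U.Comm u₂ γ₂ d₂ → U.Comm γ₃ v₂ d₂ →
      U.Comm γ₁ q₁ h₁ → U.Comm γ₂ q₂ h₂ → U.Comm u₁ h₁ d → U.Comm u₂ h₂ d →
      U.Comm p₁ γ h₁ → U.Comm p₂ γ h₂ → ObjEq γ
  | lst {p₁ p₂ ε k p₁' p₂' ε' k' γA γL γT γP b d₁ d₂ d₃ : U.E} :
      U.Lst p₁ p₂ ε k → U.Lst p₁' p₂' ε' k' → ObjEq γA →
      U.Comm ε γL b → U.Comm γT ε' b →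
      U.Comm p₁ γA d₁ → U.Comm γP p₁' d₁ → U.Comm p₂ γL d₂ → U.Comm γP p₂' d₂ →
      U.Comm k γL d₃ → U.Comm γP k' d₃ → ObjEq γL

end Sketch

/-- A 2-cell between homomorphisms `f, g : S ⟶ U`: an edge `f X → g X` for each node `X`, and for
each edge `u` the diagonal of a square made of two commutativities. -/
structure TwoCell {S U : Sketch} (f g : S ⟶ U) where
  carrier : S.N → U.E
  diag : S.E → U.E
  dom_carrier : ∀ X, U.dom (carrier X) = f.node X
  cod_carrier : ∀ X, U.cod (carrier X) = g.node X
  comm₀ : ∀ u, U.Comm (f.edge u) (carrier (S.cod u)) (diag u)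
  comm₁ : ∀ u, U.Comm (carrier (S.dom u)) (g.edge u) (diag u)

/-- There is an object equality from `f` to `g`: a 2-cell whose carriers are object equalities. -/
def ObjectEquality {S U : Sketch} (f g : S ⟶ U) : Prop :=
  ∃ α : TwoCell f g, ∀ X, U.ObjEq (α.carrier X)

/-! ### Extensions -/

/-- Finite lists of elements of a sketch, sort by sort. -/
structure Fresh (V : Sketch) where
  node : List V.N := []
  edge : List V.E := []
  tri : List V.Tri := []
  ut : List V.Ut := []
  upb : List V.Upb := []
  ui : List V.Ui := []
  upo : List V.Upo := []
  ul : List V.Ul := []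

/-- `β` is the coproduct of `α`, included by `f`, and of the finite set of entries of the list `s`,
which are pairwise distinct. -/
def IsCoprod {α β : Type} (f : α → β) (s : List β) : Prop :=
  Function.Injective f ∧ s.Nodup ∧ ∀ b, b ∈ s ↔ b ∉ Set.range f

/-- `e` is a proto-extension, whose fresh elements are those listed in `δ`. -/
structure ProtoExt {U V : Sketch} (e : U ⟶ V) (δ : Fresh V) : Prop where
  node : IsCoprod e.node δ.node
  edge : IsCoprod e.edge δ.edge
  tri : IsCoprod e.tri δ.tri
  ut : IsCoprod e.ut δ.ut
  upb : IsCoprod e.upb δ.upb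
  ui : IsCoprod e.ui δ.ui
  upo : IsCoprod e.upo δ.upo
  ul : IsCoprod e.ul δ.ul

/-- Adjoining a universal of one of the five kinds. -/
inductive AddsUniversal {U V : Sketch} (e : U ⟶ V) : Prop
  | term (w : V.Ut) :
      ProtoExt e { ut := [w], node := [V.tn w], edge := [V.idn (V.tn w)] } → AddsUniversal e
  | init0 (w : V.Ui) :
      ProtoExt e { ui := [w], node := [V.in0 w], edge := [V.idn (V.in0 w)] } → AddsUniversal e
  | pb (u₁ u₂ : U.E) (w : V.Upb) : U.cod u₁ = U.cod u₂ →
      V.r (V.pb1 w) = e.edge u₁ → V.r (V.pb2 w) = e.edge u₂ →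
      ProtoExt e
        { upb := [w], tri := [V.pb1 w, V.pb2 w],
          edge := [V.l (V.pb1 w), V.c (V.pb1 w), V.l (V.pb2 w), V.idn (V.dom (V.c (V.pb1 w)))],
          node := [V.dom (V.c (V.pb1 w))] } → AddsUniversal e
  | po (u₁ u₂ : U.E) (w : V.Upo) : U.dom u₁ = U.dom u₂ →
      V.l (V.po1 w) = e.edge u₁ → V.l (V.po2 w) = e.edge u₂ →
      ProtoExt e
        { upo := [w], tri := [V.po1 w, V.po2 w],
          edge := [V.r (V.po1 w), V.c (V.po1 w), V.r (V.po2 w), V.idn (V.cod (V.c (V.po1 w)))],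
          node := [V.cod (V.c (V.po1 w))] } → AddsUniversal e
  | lst (A : U.N) (w : V.Ul) : V.cod (V.l (V.pb1 (V.lpb w))) = e.node A →
      ProtoExt e
        { ul := [w], ut := [V.lt w], upb := [V.lpb w],
          tri := [V.pb1 (V.lpb w), V.pb2 (V.lpb w)],
          edge := [V.le w, V.lcons w,
            V.l (V.pb1 (V.lpb w)), V.c (V.pb1 (V.lpb w)), V.l (V.pb2 (V.lpb w)),
            V.r (V.pb1 (V.lpb w)), V.r (V.pb2 (V.lpb w)),
            V.idn (V.dom (V.le w)), V.idn (V.cod (V.le w)), V.idn (V.dom (V.lcons w))],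
          node := [V.dom (V.le w), V.cod (V.le w), V.dom (V.lcons w)] } → AddsUniversal e

/-- Simple extensions. -/
inductive SimpleExt {U V : Sketch} (e : U ⟶ V) : Prop
  | node (X : V.N) : ProtoExt e { node := [X], edge := [V.idn X] } → SimpleExt e
  | edge (X Y : U.N) (u : V.E) : V.dom u = e.node X → V.cod u = e.node Y →
      ProtoExt e { edge := [u] } → SimpleExt e
  | comm (u v w : U.E) (t : V.Tri) :
      U.cod u = U.dom v → U.dom u = U.dom w → U.cod v = U.cod w →
      V.IsTri t (e.edge u) (e.edge v) (e.edge w) →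
      ProtoExt e { tri := [t] } → SimpleExt e
  | universal : AddsUniversal e → SimpleExt e

/-- Extensions: finite composites of simple extensions (isomorphisms being the composites of length
zero, because extensions are determined up to isomorphism only). -/
inductive IsExt : ∀ {U V : Sketch}, (U ⟶ V) → Prop
  | iso {U V : Sketch} (e : U ⟶ V) : IsIso e → IsExt e
  | simple {U V : Sketch} (e : U ⟶ V) : SimpleExt e → IsExt e
  | comp {U V W : Sketch} (e : U ⟶ V) (e' : V ⟶ W) : IsExt e → IsExt e' → IsExt (e ≫ e')

/-- `e` adjoins an inverse of the edge `u`. -/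
def AddsInverse {U V : Sketch} (e : U ⟶ V) (u : U.E) : Prop :=
  ∃ (u' : V.E) (t t' : V.Tri), V.IsTri t (e.edge u) u' (V.idn (e.node (U.dom u))) ∧
    V.IsTri t' u' (e.edge u) (V.idn (e.node (U.cod u))) ∧
    ProtoExt e { edge := [u'], tri := [t, t'] }

/-- `e` adjoins just one commutativity `u v = w` between given edges. -/
def AddsComm {U V : Sketch} (e : U ⟶ V) (u v w : U.E) : Prop :=
  ∃ t : V.Tri, V.IsTri t (e.edge u) (e.edge v) (e.edge w) ∧ ProtoExt e { tri := [t] }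

/-- Simple equivalence extensions. -/
inductive SimpleEquivExt {U V : Sketch} (e : U ⟶ V) : Prop
  -- composition, unit laws, associativity
  | composite (u v : U.E) (w : V.E) (t : V.Tri) : U.cod u = U.dom v →
      V.IsTri t (e.edge u) (e.edge v) w →
      ProtoExt e { edge := [w], tri := [t] } → SimpleEquivExt e
  | unitLeft (u : U.E) : AddsComm e (U.idn (U.dom u)) u u → SimpleEquivExt e
  | unitRight (u : U.E) : AddsComm e u (U.idn (U.cod u)) u → SimpleEquivExt e
  | assocLeft (u v w k l m : U.E) : U.Comm u v k → U.Comm v w l → U.Comm u l m →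
      AddsComm e k w m → SimpleEquivExt e
  | assocRight (u v w k l m : U.E) : U.Comm u v k → U.Comm v w l → U.Comm k w m →
      AddsComm e u l m → SimpleEquivExt e
  -- existence of terminals, initials, pullbacks, pushouts, lists
  | universal : AddsUniversal e → SimpleEquivExt e
  -- fillins and their uniqueness
  | termFill (X T : U.N) (w : V.E) : U.Term T → V.dom w = e.node X → V.cod w = e.node T →
      ProtoExt e { edge := [w] } → SimpleEquivExt e
  | termUniq (w w' : U.E) : U.Term (U.cod w) → U.dom w = U.dom w' → U.cod w = U.cod w' →
      AddsComm e (U.idn (U.dom w)) w w' → SimpleEquivExt e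
  | initFill (X T : U.N) (w : V.E) : U.Init0 T → V.dom w = e.node T → V.cod w = e.node X →
      ProtoExt e { edge := [w] } → SimpleEquivExt e
  | initUniq (w w' : U.E) : U.Init0 (U.dom w) → U.dom w = U.dom w' → U.cod w = U.cod w' →
      AddsComm e (U.idn (U.dom w)) w w' → SimpleEquivExt e
  | pbFill (p₁ p₂ u₁ u₂ v₁ v₂ v : U.E) (w : V.E) (t₁ t₂ : V.Tri) :
      U.Pb p₁ p₂ u₁ u₂ → U.Comm v₁ u₁ v → U.Comm v₂ u₂ v →
      V.IsTri t₁ w (e.edge p₁) (e.edge v₁) → V.IsTri t₂ w (e.edge p₂) (e.edge v₂) →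
      ProtoExt e { edge := [w], tri := [t₁, t₂] } → SimpleEquivExt e
  | pbUniq (p₁ p₂ u₁ u₂ v₁ v₂ w w' : U.E) : U.Pb p₁ p₂ u₁ u₂ →
      U.Comm w p₁ v₁ → U.Comm w p₂ v₂ → U.Comm w' p₁ v₁ → U.Comm w' p₂ v₂ →
      AddsComm e (U.idn (U.dom w)) w w' → SimpleEquivExt e
  | poFill (q₁ q₂ u₁ u₂ v₁ v₂ v : U.E) (w : V.E) (t₁ t₂ : V.Tri) :
      U.Po q₁ q₂ u₁ u₂ → U.Comm u₁ v₁ v → U.Comm u₂ v₂ v →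
      V.IsTri t₁ (e.edge q₁) w (e.edge v₁) → V.IsTri t₂ (e.edge q₂) w (e.edge v₂) →
      ProtoExt e { edge := [w], tri := [t₁, t₂] } → SimpleEquivExt e
  | poUniq (q₁ q₂ u₁ u₂ v₁ v₂ w w' : U.E) : U.Po q₁ q₂ u₁ u₂ →
      U.Comm q₁ w v₁ → U.Comm q₂ w v₂ → U.Comm q₁ w' v₁ → U.Comm q₂ w' v₂ →
      AddsComm e (U.idn (U.dom w)) w w' → SimpleEquivExt e
  | recFill (p₁ p₂ ε k q₁ q₂ π₁ π₂ s₁ s₂ z₁ z₂ y g i κ a : U.E) (r r' r'' g' g'' : V.E)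
      (t₁ t₂ t₃ t₄ t₅ t₆ t₇ : V.Tri) :
      U.RecData p₁ p₂ ε k q₁ q₂ π₁ π₂ s₁ s₂ z₁ z₂ y g i κ a →
      V.IsTri t₁ (e.edge i) r (e.edge y) → V.IsTri t₂ (e.edge κ) r g'' →
      V.IsTri t₃ (e.edge a) g' g'' → V.IsTri t₄ r' (e.edge g) g' →
      V.IsTri t₅ r' (e.edge z₁) (e.edge s₁) → V.IsTri t₆ r' (e.edge z₂) r'' →
      V.IsTri t₇ (e.edge s₂) r r'' →
      ProtoExt e { edge := [r, r', r'', g', g''], tri := [t₁, t₂, t₃, t₄, t₅, t₆, t₇] } →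
      SimpleEquivExt e
  | recUniq (p₁ p₂ ε k q₁ q₂ π₁ π₂ s₁ s₂ z₁ z₂ y g i κ a : U.E)
      (r₁ r₁' r₁'' g₁' g₁'' r₂ r₂' r₂'' g₂' g₂'' : U.E) :
      U.RecData p₁ p₂ ε k q₁ q₂ π₁ π₂ s₁ s₂ z₁ z₂ y g i κ a →
      U.RecSol s₁ s₂ z₁ z₂ y g i κ a r₁ r₁' r₁'' g₁' g₁'' →
      U.RecSol s₁ s₂ z₁ z₂ y g i κ a r₂ r₂' r₂'' g₂' g₂'' →
      AddsComm e (U.idn (U.dom r₁)) r₁ r₂ → SimpleEquivExt e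
  -- balance, stability, exactness
  | balance (u p₁ p₂ q₁ q₂ : U.E) : U.Pb p₁ p₂ u u → U.Po q₁ q₂ u u →
      U.UComm p₁ p₂ → U.UComm q₁ q₂ → AddsInverse e u → SimpleEquivExt e
  | initStab (u : U.E) : U.Init0 (U.cod u) → AddsInverse e u → SimpleEquivExt e
  | poStab (u₁ u₂ v₁ v₂ v w v₁' x₁ v₂' x₂ p z u₁' u₂' j₁ j₂ d : U.E) :
      U.PoStab u₁ u₂ v₁ v₂ v w v₁' x₁ v₂' x₂ p z u₁' u₂' j₁ j₂ d →
      AddsInverse e d → SimpleEquivExt e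
  | exactness (π₁ π₂ ρ σ τ d : U.E) : U.Exactness π₁ π₂ ρ σ τ d →
      AddsInverse e d → SimpleEquivExt e

/-- Equivalence extensions: finite composites of simple equivalence extensions. -/
inductive IsEquivExt : ∀ {U V : Sketch}, (U ⟶ V) → Prop
  | iso {U V : Sketch} (e : U ⟶ V) : IsIso e → IsEquivExt e
  | simple {U V : Sketch} (e : U ⟶ V) : SimpleEquivExt e → IsEquivExt e
  | comp {U V W : Sketch} (e : U ⟶ V) (e' : V ⟶ W) :
      IsEquivExt e → IsEquivExt e' → IsEquivExt (e ≫ e')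

/-! ### Reindexing -/

section Glue

variable {α β γ : Type}

/-- The pushout of sets of `f : α → β` and `g : α → γ`. -/
def Glue (f : α → β) (g : α → γ) : Type :=
  Quot fun x y : β ⊕ γ => ∃ a, x = Sum.inl (f a) ∧ y = Sum.inr (g a)

def Glue.inl (f : α → β) (g : α → γ) (b : β) : Glue f g := Quot.mk _ (Sum.inl b)

def Glue.inr (f : α → β) (g : α → γ) (x : γ) : Glue f g := Quot.mk _ (Sum.inr x)

theorem Glue.cond (f : α → β) (g : α → γ) (a : α) : Glue.inl f g (f a) = Glue.inr f g (g a) :=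
  Quot.sound ⟨a, rfl, rfl⟩

def Glue.desc {f : α → β} {g : α → γ} {δ : Type} (h : β → δ) (k : γ → δ)
    (w : ∀ a, h (f a) = k (g a)) : Glue f g → δ :=
  Quot.lift (Sum.elim h k) (by rintro _ _ ⟨a, rfl, rfl⟩; exact w a)

theorem Glue.ind {f : α → β} {g : α → γ} {P : Glue f g → Prop} (h : ∀ b, P (Glue.inl f g b))
    (k : ∀ x, P (Glue.inr f g x)) (x : Glue f g) : P x := by
  rcases x with ⟨b | x⟩
  · exact h b
  · exact k x

def Glue.map {f : α → β} {g : α → γ} {α' β' γ' : Type} {f' : α' → β'} {g' : α' → γ'}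
    (a : α → α') (b : β → β') (c : γ → γ') (hb : ∀ x, b (f x) = f' (a x))
    (hc : ∀ x, c (g x) = g' (a x)) : Glue f g → Glue f' g' :=
  Glue.desc (fun x => Glue.inl f' g' (b x)) (fun x => Glue.inr f' g' (c x))
    (fun x => by rw [hb, hc, Glue.cond])

theorem IsCoprod.glue {f : α → β} {g : α → γ} {s : List γ} (h : IsCoprod g s) :
    IsCoprod (Glue.inl f g) (s.map (Glue.inr f g)) := by
  classical
  obtain ⟨hinj, hnd, hmem⟩ := h
  let φ : Glue f g → β ⊕ γ := Glue.desc Sum.inl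
    (fun x => if hx : ∃ a, g a = x then Sum.inl (f hx.choose) else Sum.inr x) (fun a => by
      have hx : ∃ a', g a' = g a := ⟨a, rfl⟩
      simp only [hx, dif_pos]
      rw [hinj hx.choose_spec])
  have φl : ∀ b, φ (Glue.inl f g b) = Sum.inl b := fun b => rfl
  have φr : ∀ x, x ∉ Set.range g → φ (Glue.inr f g x) = Sum.inr x := fun x hx => by
    have : ¬ ∃ a, g a = x := hx
    change (if hx : ∃ a, g a = x then Sum.inl (f hx.choose) else Sum.inr x) = _
    rw [dif_neg this]
  refine ⟨fun b b' hb => ?_, ?_, fun b => ?_⟩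
  · have := congrArg φ hb
    rw [φl, φl] at this
    exact Sum.inl_injective this
  · refine List.Nodup.map_on (fun x hx y hy hxy => ?_) hnd
    have := congrArg φ hxy
    rw [φr x ((hmem x).1 hx), φr y ((hmem y).1 hy)] at this
    exact Sum.inr_injective this
  · constructor
    · intro hb
      obtain ⟨x, hx, rfl⟩ := List.mem_map.1 hb
      rintro ⟨b, hb⟩
      have := congrArg φ hb
      rw [φl, φr x ((hmem x).1 hx)] at this
      cases this
    · intro hb
      induction b using Glue.ind with
      | h b => exact absurd ⟨b, rfl⟩ hb
      | k x =>
        refine List.mem_map.2 ⟨x, (hmem x).2 ?_, rfl⟩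
        rintro ⟨a, rfl⟩
        exact hb ⟨f a, Glue.cond f g a⟩

end Glue

/-- The pushout of `e : U ⟶ V` along `f : U ⟶ W`, computed sort by sort. -/
def reindex {U V W : Sketch} (f : U ⟶ W) (e : U ⟶ V) : Sketch where
  N := Glue f.node e.node
  E := Glue f.edge e.edge
  Tri := Glue f.tri e.tri
  Ut := Glue f.ut e.ut
  Upb := Glue f.upb e.upb
  Ui := Glue f.ui e.ui
  Upo := Glue f.upo e.upo
  Ul := Glue f.ul e.ul
  idn := Glue.map U.idn W.idn V.idn (fun x => (f.map_idn x).symm) (fun x => (e.map_idn x).symm)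
  dom := Glue.map U.dom W.dom V.dom (fun x => (f.map_dom x).symm) (fun x => (e.map_dom x).symm)
  cod := Glue.map U.cod W.cod V.cod (fun x => (f.map_cod x).symm) (fun x => (e.map_cod x).symm)
  l := Glue.map U.l W.l V.l (fun x => (f.map_l x).symm) (fun x => (e.map_l x).symm)
  r := Glue.map U.r W.r V.r (fun x => (f.map_r x).symm) (fun x => (e.map_r x).symm)
  c := Glue.map U.c W.c V.c (fun x => (f.map_c x).symm) (fun x => (e.map_c x).symm)
  tn := Glue.map U.tn W.tn V.tn (fun x => (f.map_tn x).symm) (fun x => (e.map_tn x).symm)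
  pb1 := Glue.map U.pb1 W.pb1 V.pb1 (fun x => (f.map_pb1 x).symm) (fun x => (e.map_pb1 x).symm)
  pb2 := Glue.map U.pb2 W.pb2 V.pb2 (fun x => (f.map_pb2 x).symm) (fun x => (e.map_pb2 x).symm)
  in0 := Glue.map U.in0 W.in0 V.in0 (fun x => (f.map_in0 x).symm) (fun x => (e.map_in0 x).symm)
  po1 := Glue.map U.po1 W.po1 V.po1 (fun x => (f.map_po1 x).symm) (fun x => (e.map_po1 x).symm)
  po2 := Glue.map U.po2 W.po2 V.po2 (fun x => (f.map_po2 x).symm) (fun x => (e.map_po2 x).symm)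
  lpb := Glue.map U.lpb W.lpb V.lpb (fun x => (f.map_lpb x).symm) (fun x => (e.map_lpb x).symm)
  lt := Glue.map U.lt W.lt V.lt (fun x => (f.map_lt x).symm) (fun x => (e.map_lt x).symm)
  le := Glue.map U.le W.le V.le (fun x => (f.map_le x).symm) (fun x => (e.map_le x).symm)
  lcons := Glue.map U.lcons W.lcons V.lcons (fun x => (f.map_lcons x).symm)
    (fun x => (e.map_lcons x).symm)
  dom_idn := Glue.ind (fun b => congrArg (Glue.inl _ _) (W.dom_idn b))
    (fun b => congrArg (Glue.inr _ _) (V.dom_idn b))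
  cod_idn := Glue.ind (fun b => congrArg (Glue.inl _ _) (W.cod_idn b))
    (fun b => congrArg (Glue.inr _ _) (V.cod_idn b))
  cod_l := Glue.ind (fun b => congrArg (Glue.inl _ _) (W.cod_l b))
    (fun b => congrArg (Glue.inr _ _) (V.cod_l b))
  dom_l := Glue.ind (fun b => congrArg (Glue.inl _ _) (W.dom_l b))
    (fun b => congrArg (Glue.inr _ _) (V.dom_l b))
  cod_r := Glue.ind (fun b => congrArg (Glue.inl _ _) (W.cod_r b))
    (fun b => congrArg (Glue.inr _ _) (V.cod_r b))
  c_pb := Glue.ind (fun b => congrArg (Glue.inl _ _) (W.c_pb b))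
    (fun b => congrArg (Glue.inr _ _) (V.c_pb b))
  c_po := Glue.ind (fun b => congrArg (Glue.inl _ _) (W.c_po b))
    (fun b => congrArg (Glue.inr _ _) (V.c_po b))
  cod_c_lpb := Glue.ind (fun b => congrArg (Glue.inl _ _) (W.cod_c_lpb b))
    (fun b => congrArg (Glue.inr _ _) (V.cod_c_lpb b))
  dom_le := Glue.ind (fun b => congrArg (Glue.inl _ _) (W.dom_le b))
    (fun b => congrArg (Glue.inr _ _) (V.dom_le b))
  dom_lcons := Glue.ind (fun b => congrArg (Glue.inl _ _) (W.dom_lcons b))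
    (fun b => congrArg (Glue.inr _ _) (V.dom_lcons b))
  cod_le := Glue.ind (fun b => congrArg (Glue.inl _ _) (W.cod_le b))
    (fun b => congrArg (Glue.inr _ _) (V.cod_le b))
  cod_lcons := Glue.ind (fun b => congrArg (Glue.inl _ _) (W.cod_lcons b))
    (fun b => congrArg (Glue.inr _ _) (V.cod_lcons b))

/-- The reindexing of `e` along `f`. -/
def reindexExt {U V W : Sketch} (f : U ⟶ W) (e : U ⟶ V) : W ⟶ reindex f e :=
  Sketch.Hom.mk (Glue.inl _ _) (Glue.inl _ _) (Glue.inl _ _) (Glue.inl _ _) (Glue.inl _ _)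
    (Glue.inl _ _) (Glue.inl _ _) (Glue.inl _ _)
    (fun _ => rfl) (fun _ => rfl) (fun _ => rfl) (fun _ => rfl) (fun _ => rfl) (fun _ => rfl)
    (fun _ => rfl) (fun _ => rfl) (fun _ => rfl) (fun _ => rfl) (fun _ => rfl) (fun _ => rfl)
    (fun _ => rfl) (fun _ => rfl) (fun _ => rfl) (fun _ => rfl)

/-- The homomorphism opposite to `f` in the reindexing square. -/
def reindexHom {U V W : Sketch} (f : U ⟶ W) (e : U ⟶ V) : V ⟶ reindex f e :=
  Sketch.Hom.mk (Glue.inr _ _) (Glue.inr _ _) (Glue.inr _ _) (Glue.inr _ _) (Glue.inr _ _)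
    (Glue.inr _ _) (Glue.inr _ _) (Glue.inr _ _)
    (fun _ => rfl) (fun _ => rfl) (fun _ => rfl) (fun _ => rfl) (fun _ => rfl) (fun _ => rfl)
    (fun _ => rfl) (fun _ => rfl) (fun _ => rfl) (fun _ => rfl) (fun _ => rfl) (fun _ => rfl)
    (fun _ => rfl) (fun _ => rfl) (fun _ => rfl) (fun _ => rfl)

theorem reindex_cond {U V W : Sketch} (f : U ⟶ W) (e : U ⟶ V) :
    f ≫ reindexExt f e = e ≫ reindexHom f e := by
  apply Sketch.Hom.ext <;> funext a <;> exact Glue.cond _ _ a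

/-- The homomorphism out of the reindexing induced by a commutative square. -/
def reindexDesc {U V W Z : Sketch} {f : U ⟶ W} {e : U ⟶ V} (h : W ⟶ Z) (k : V ⟶ Z)
    (w : f ≫ h = e ≫ k) : reindex f e ⟶ Z :=
  Sketch.Hom.mk
    (Glue.desc h.node k.node (congrFun (congrArg Sketch.Hom.node w)))
    (Glue.desc h.edge k.edge (congrFun (congrArg Sketch.Hom.edge w)))
    (Glue.desc h.tri k.tri (congrFun (congrArg Sketch.Hom.tri w)))
    (Glue.desc h.ut k.ut (congrFun (congrArg Sketch.Hom.ut w)))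
    (Glue.desc h.upb k.upb (congrFun (congrArg Sketch.Hom.upb w)))
    (Glue.desc h.ui k.ui (congrFun (congrArg Sketch.Hom.ui w)))
    (Glue.desc h.upo k.upo (congrFun (congrArg Sketch.Hom.upo w)))
    (Glue.desc h.ul k.ul (congrFun (congrArg Sketch.Hom.ul w)))
    (Glue.ind h.map_idn k.map_idn) (Glue.ind h.map_dom k.map_dom) (Glue.ind h.map_cod k.map_cod)
    (Glue.ind h.map_l k.map_l) (Glue.ind h.map_r k.map_r) (Glue.ind h.map_c k.map_c)
    (Glue.ind h.map_tn k.map_tn) (Glue.ind h.map_pb1 k.map_pb1) (Glue.ind h.map_pb2 k.map_pb2)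
    (Glue.ind h.map_in0 k.map_in0) (Glue.ind h.map_po1 k.map_po1) (Glue.ind h.map_po2 k.map_po2)
    (Glue.ind h.map_lpb k.map_lpb) (Glue.ind h.map_lt k.map_lt) (Glue.ind h.map_le k.map_le)
    (Glue.ind h.map_lcons k.map_lcons)

theorem reindex_hom_ext {U V W Z : Sketch} {f : U ⟶ W} {e : U ⟶ V} {h k : reindex f e ⟶ Z}
    (h₁ : reindexExt f e ≫ h = reindexExt f e ≫ k)
    (h₂ : reindexHom f e ≫ h = reindexHom f e ≫ k) : h = k := by
  apply Sketch.Hom.ext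
  · exact funext (Glue.ind (congrFun (congrArg Sketch.Hom.node h₁))
      (congrFun (congrArg Sketch.Hom.node h₂)))
  · exact funext (Glue.ind (congrFun (congrArg Sketch.Hom.edge h₁))
      (congrFun (congrArg Sketch.Hom.edge h₂)))
  · exact funext (Glue.ind (congrFun (congrArg Sketch.Hom.tri h₁))
      (congrFun (congrArg Sketch.Hom.tri h₂)))
  · exact funext (Glue.ind (congrFun (congrArg Sketch.Hom.ut h₁))
      (congrFun (congrArg Sketch.Hom.ut h₂)))
  · exact funext (Glue.ind (congrFun (congrArg Sketch.Hom.upb h₁))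
      (congrFun (congrArg Sketch.Hom.upb h₂)))
  · exact funext (Glue.ind (congrFun (congrArg Sketch.Hom.ui h₁))
      (congrFun (congrArg Sketch.Hom.ui h₂)))
  · exact funext (Glue.ind (congrFun (congrArg Sketch.Hom.upo h₁))
      (congrFun (congrArg Sketch.Hom.upo h₂)))
  · exact funext (Glue.ind (congrFun (congrArg Sketch.Hom.ul h₁))
      (congrFun (congrArg Sketch.Hom.ul h₂)))

/-- The reindexing square is a pushout of sketches. -/
theorem reindex_isPushout {U V W : Sketch} (f : U ⟶ W) (e : U ⟶ V) :
    IsPushout f e (reindexExt f e) (reindexHom f e) where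
  w := reindex_cond f e
  isColimit' := ⟨Limits.PushoutCocone.IsColimit.mk _
    (fun s => reindexDesc s.inl s.inr s.condition) (fun _ => rfl) (fun _ => rfl)
    (fun _ _ h₁ h₂ => reindex_hom_ext h₁ h₂)⟩

/-! Configurations are preserved by homomorphisms, and so equivalence extensions are preserved by
reindexing. -/

section Map

variable {U V W : Sketch} (f : U ⟶ V)

theorem Sketch.IsTri.map {t : U.Tri} {u v w : U.E} (h : U.IsTri t u v w) :
    V.IsTri (f.tri t) (f.edge u) (f.edge v) (f.edge w) := by
  obtain ⟨rfl, rfl, rfl⟩ := h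
  exact ⟨(f.map_l t).symm, (f.map_r t).symm, (f.map_c t).symm⟩

theorem Sketch.Comm.map {u v w : U.E} (h : U.Comm u v w) :
    V.Comm (f.edge u) (f.edge v) (f.edge w) :=
  let ⟨t, ht⟩ := h; ⟨f.tri t, ht.map f⟩

theorem Sketch.UComm.map {u v : U.E} (h : U.UComm u v) : V.UComm (f.edge u) (f.edge v) := by
  have := Sketch.Comm.map f h
  rwa [f.map_idn, f.map_dom] at this

theorem Sketch.Term.map {X : U.N} (h : U.Term X) : V.Term (f.node X) := by
  obtain ⟨w, rfl⟩ := h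
  exact ⟨f.ut w, (f.map_tn w).symm⟩

theorem Sketch.Init0.map {X : U.N} (h : U.Init0 X) : V.Init0 (f.node X) := by
  obtain ⟨w, rfl⟩ := h
  exact ⟨f.ui w, (f.map_in0 w).symm⟩

theorem Sketch.Pb.map {p₁ p₂ u₁ u₂ : U.E} (h : U.Pb p₁ p₂ u₁ u₂) :
    V.Pb (f.edge p₁) (f.edge p₂) (f.edge u₁) (f.edge u₂) := by
  obtain ⟨w, rfl, rfl, rfl, rfl⟩ := h
  exact ⟨f.upb w, by simp only [f.map_l, f.map_r, f.map_pb1, f.map_pb2, and_self]⟩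

theorem Sketch.Po.map {p₁ p₂ u₁ u₂ : U.E} (h : U.Po p₁ p₂ u₁ u₂) :
    V.Po (f.edge p₁) (f.edge p₂) (f.edge u₁) (f.edge u₂) := by
  obtain ⟨w, rfl, rfl, rfl, rfl⟩ := h
  exact ⟨f.upo w, by simp only [f.map_l, f.map_r, f.map_po1, f.map_po2, and_self]⟩

theorem Sketch.Prod0.map {p₁ p₂ : U.E} (h : U.Prod0 p₁ p₂) :
    V.Prod0 (f.edge p₁) (f.edge p₂) := by
  obtain ⟨u₁, u₂, h, ht⟩ := h
  exact ⟨_, _, h.map f, f.map_cod u₁ ▸ ht.map f⟩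

theorem Sketch.Coprod0.map {p₁ p₂ : U.E} (h : U.Coprod0 p₁ p₂) :
    V.Coprod0 (f.edge p₁) (f.edge p₂) := by
  obtain ⟨u₁, u₂, h, ht⟩ := h
  exact ⟨_, _, h.map f, f.map_dom u₁ ▸ ht.map f⟩

theorem Sketch.Lst.map {p₁ p₂ ε k : U.E} (h : U.Lst p₁ p₂ ε k) :
    V.Lst (f.edge p₁) (f.edge p₂) (f.edge ε) (f.edge k) := by
  obtain ⟨w, rfl, rfl, rfl, rfl⟩ := h
  exact ⟨f.ul w, by
    simp only [f.map_l, f.map_pb1, f.map_pb2, f.map_lpb, f.map_le, f.map_lcons, and_self]⟩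

theorem Sketch.RecData.map {p₁ p₂ ε k q₁ q₂ π₁ π₂ s₁ s₂ z₁ z₂ y g i κ a : U.E}
    (h : U.RecData p₁ p₂ ε k q₁ q₂ π₁ π₂ s₁ s₂ z₁ z₂ y g i κ a) :
    V.RecData (f.edge p₁) (f.edge p₂) (f.edge ε) (f.edge k) (f.edge q₁) (f.edge q₂) (f.edge π₁)
      (f.edge π₂) (f.edge s₁) (f.edge s₂) (f.edge z₁) (f.edge z₂) (f.edge y) (f.edge g)
      (f.edge i) (f.edge κ) (f.edge a) where
  lst := h.lst.map f
  prodLB := h.prodLB.map f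
  cod_q₁ := by rw [← f.map_cod, h.cod_q₁, f.map_cod]
  prodPB := h.prodPB.map f
  cod_π₁ := by rw [← f.map_cod, h.cod_π₁, f.map_dom]
  cod_π₂ := by rw [← f.map_cod, h.cod_π₂, f.map_cod]
  prodALB := h.prodALB.map f
  cod_s₁ := by rw [← f.map_cod, h.cod_s₁, f.map_cod]
  cod_s₂ := by rw [← f.map_cod, h.cod_s₂, f.map_dom]
  prodAY := h.prodAY.map f
  cod_z₁ := by rw [← f.map_cod, h.cod_z₁, f.map_cod]
  dom_y := by rw [← f.map_dom, h.dom_y, f.map_cod]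
  cod_y := by rw [← f.map_cod, h.cod_y, f.map_cod]
  dom_g := by rw [← f.map_dom, h.dom_g, f.map_dom]
  cod_g := by rw [← f.map_cod, h.cod_g, f.map_cod]
  spec_i := by
    obtain ⟨t, b, h₁, h₂, h₃⟩ := h.spec_i
    refine ⟨_, _, h₁.map f, h₂.map f, ?_⟩
    rw [← f.map_cod, ← f.map_idn]
    exact h₃.map f
  spec_κ := by
    obtain ⟨b, h₁, h₂, h₃⟩ := h.spec_κ
    exact ⟨_, h₁.map f, h₂.map f, h₃.map f⟩
  spec_a := by
    obtain ⟨b₁, b₂, c, h₁, h₂, h₃, h₄, h₅, h₆⟩ := h.spec_a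
    exact ⟨_, _, _, h₁.map f, h₂.map f, h₃.map f, h₄.map f, h₅.map f, h₆.map f⟩

theorem Sketch.RecSol.map {s₁ s₂ z₁ z₂ y g i κ a r r' r'' g' g'' : U.E}
    (h : U.RecSol s₁ s₂ z₁ z₂ y g i κ a r r' r'' g' g'') :
    V.RecSol (f.edge s₁) (f.edge s₂) (f.edge z₁) (f.edge z₂) (f.edge y) (f.edge g) (f.edge i)
      (f.edge κ) (f.edge a) (f.edge r) (f.edge r') (f.edge r'') (f.edge g') (f.edge g'') :=
  ⟨h.base.map f, h.step₁.map f, h.step₂.map f, h.step₃.map f, h.fst.map f, h.snd₁.map f,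
    h.snd₂.map f⟩

theorem Sketch.PoStab.map {u₁ u₂ v₁ v₂ v w v₁' x₁ v₂' x₂ p z u₁' u₂' j₁ j₂ e : U.E}
    (h : U.PoStab u₁ u₂ v₁ v₂ v w v₁' x₁ v₂' x₂ p z u₁' u₂' j₁ j₂ e) :
    V.PoStab (f.edge u₁) (f.edge u₂) (f.edge v₁) (f.edge v₂) (f.edge v) (f.edge w) (f.edge v₁')
      (f.edge x₁) (f.edge v₂') (f.edge x₂) (f.edge p) (f.edge z) (f.edge u₁') (f.edge u₂')
      (f.edge j₁) (f.edge j₂) (f.edge e) where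
  bottom := by
    obtain ⟨o, rfl, rfl, rfl, rfl, rfl⟩ := h.bottom
    exact ⟨f.upo o, by simp only [f.map_l, f.map_r, f.map_c, f.map_po1, f.map_po2, and_self]⟩
  face₁ := h.face₁.map f
  face₂ := h.face₂.map f
  face := h.face.map f
  fill₁ := by
    obtain ⟨h₁, d, h₂, h₃⟩ := h.fill₁
    exact ⟨h₁.map f, _, h₂.map f, h₃.map f⟩
  fill₂ := by
    obtain ⟨h₁, d, h₂, h₃⟩ := h.fill₂
    exact ⟨h₁.map f, _, h₂.map f, h₃.map f⟩
  top := h.top.map f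
  cmp₁ := h.cmp₁.map f
  cmp₂ := h.cmp₂.map f

theorem Sketch.Exactness.map {π₁ π₂ ρ σ τ e : U.E} (h : U.Exactness π₁ π₂ ρ σ τ e) :
    V.Exactness (f.edge π₁) (f.edge π₂) (f.edge ρ) (f.edge σ) (f.edge τ) (f.edge e) where
  dom_eq := by rw [← f.map_dom, h.dom_eq, f.map_dom]
  cod_eq := by rw [← f.map_cod, h.cod_eq, f.map_cod]
  monic := by
    obtain ⟨x₁, x₂, π, d₁, d₂, h₁, h₂, h₃, h₄, h₅, h₆, h₇⟩ := h.monic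
    exact ⟨_, _, _, _, _, h₁.map f, by rw [← f.map_cod, h₂, f.map_cod],
      by rw [← f.map_cod, h₃, f.map_cod], h₄.map f, h₅.map f, h₆.map f, h₇.map f⟩
  refl₁ := by rw [← f.map_cod, ← f.map_idn]; exact h.refl₁.map f
  refl₂ := by rw [← f.map_cod, ← f.map_idn]; exact h.refl₂.map f
  symm₁ := h.symm₁.map f
  symm₂ := h.symm₂.map f
  trans := by
    obtain ⟨t₁, t₂, b₁, b₂, h₁, h₂, h₃, h₄, h₅⟩ := h.trans
    exact ⟨_, _, _, _, h₁.map f, h₂.map f, h₃.map f, h₄.map f, h₅.map f⟩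
  quot := by
    obtain ⟨c₁, c₂, f₁, f₂, γ, γ', k₁, k₂, h₁, h₂, h₃, h₄, h₅, h₆, h₇, h₈, h₉, h₁₀, h₁₁⟩ := h.quot
    refine ⟨_, _, _, _, _, _, _, _, h₁.map f, by rw [← f.map_dom, h₂, f.map_dom],
      by rw [← f.map_dom, h₃, f.map_cod], h₄.map f, ?_, h₆.map f, ?_, h₈.map f, h₉.map f,
      h₁₀.map f, h₁₁.map f⟩
    · rw [← f.map_cod, ← f.map_idn]; exact h₅.map f
    · rw [← f.map_cod, ← f.map_idn]; exact h₇.map f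

end Map

section Stability

variable {U V W : Sketch} (f : U ⟶ W) {e : U ⟶ V}

theorem reindex_edge (u : U.E) :
    (reindexHom f e).edge (e.edge u) = (reindexExt f e).edge (f.edge u) :=
  (Glue.cond _ _ u).symm

theorem reindex_node (u : U.N) :
    (reindexHom f e).node (e.node u) = (reindexExt f e).node (f.node u) :=
  (Glue.cond _ _ u).symm

theorem ProtoExt.reindex {δ : Fresh V} (h : ProtoExt e δ) :
    ProtoExt (reindexExt f e)
      { node := δ.node.map (reindexHom f e).node, edge := δ.edge.map (reindexHom f e).edge,
        tri := δ.tri.map (reindexHom f e).tri, ut := δ.ut.map (reindexHom f e).ut,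
        upb := δ.upb.map (reindexHom f e).upb, ui := δ.ui.map (reindexHom f e).ui,
        upo := δ.upo.map (reindexHom f e).upo, ul := δ.ul.map (reindexHom f e).ul } :=
  ⟨h.node.glue, h.edge.glue, h.tri.glue, h.ut.glue, h.upb.glue, h.ui.glue, h.upo.glue, h.ul.glue⟩

theorem AddsUniversal.reindex (h : AddsUniversal e) : AddsUniversal (reindexExt f e) := by
  cases h with
  | term w h => exact .term ((reindexHom f e).ut w) (h.reindex f)
  | init0 w h => exact .init0 ((reindexHom f e).ui w) (h.reindex f)
  | pb u₁ u₂ w h₁ h₂ h₃ h =>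
    refine .pb (f.edge u₁) (f.edge u₂) ((reindexHom f e).upb w) ?_ ?_ ?_ (h.reindex f)
    · rw [← f.map_cod, h₁, f.map_cod]
    · rw [← reindex_edge, ← h₂]; rfl
    · rw [← reindex_edge, ← h₃]; rfl
  | po u₁ u₂ w h₁ h₂ h₃ h =>
    refine .po (f.edge u₁) (f.edge u₂) ((reindexHom f e).upo w) ?_ ?_ ?_ (h.reindex f)
    · rw [← f.map_dom, h₁, f.map_dom]
    · rw [← reindex_edge, ← h₂]; rfl
    · rw [← reindex_edge, ← h₃]; rfl
  | lst A w h₁ h =>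
    refine .lst (f.node A) ((reindexHom f e).ul w) ?_ (h.reindex f)
    rw [← reindex_node, ← h₁]; rfl

theorem AddsComm.reindex {u v w : U.E} (h : AddsComm e u v w) :
    AddsComm (reindexExt f e) (f.edge u) (f.edge v) (f.edge w) := by
  obtain ⟨t, ht, h⟩ := h
  refine ⟨(reindexHom f e).tri t, ?_, h.reindex f⟩
  simpa only [reindex_edge] using ht.map (reindexHom f e)

theorem AddsComm.reindex_idn {u v w : U.E} (h : AddsComm e (U.idn (U.dom u)) v w) :
    AddsComm (reindexExt f e) (W.idn (W.dom (f.edge u))) (f.edge v) (f.edge w) := by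
  rw [← f.map_dom, ← f.map_idn]
  exact h.reindex f

theorem AddsInverse.reindex {u : U.E} (h : AddsInverse e u) :
    AddsInverse (reindexExt f e) (f.edge u) := by
  obtain ⟨u', t, t', ht, ht', h⟩ := h
  refine ⟨(reindexHom f e).edge u', (reindexHom f e).tri t, (reindexHom f e).tri t', ?_, ?_,
    h.reindex f⟩
  · have := ht.map (reindexHom f e)
    rwa [reindex_edge, Sketch.Hom.map_idn, reindex_node, f.map_dom] at this
  · have := ht'.map (reindexHom f e)
    rwa [reindex_edge, Sketch.Hom.map_idn, reindex_node, f.map_cod] at this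

theorem SimpleEquivExt.reindex (h : SimpleEquivExt e) : SimpleEquivExt (reindexExt f e) := by
  have mp : ∀ {t u v w}, V.IsTri t u v w → _ := fun h => Sketch.IsTri.map (reindexHom f e) h
  cases h with
  | composite u v w t h₁ h₂ h =>
    refine .composite (f.edge u) (f.edge v) _ _ ?_ ?_ (h.reindex f)
    · rw [← f.map_cod, h₁, f.map_dom]
    · simpa only [reindex_edge] using mp h₂
  | unitLeft u h => exact .unitLeft (f.edge u) (h.reindex_idn f)
  | unitRight u h =>
    refine .unitRight (f.edge u) ?_
    rw [← f.map_cod, ← f.map_idn]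
    exact h.reindex f
  | assocLeft u v w k l m h₁ h₂ h₃ h =>
    exact .assocLeft _ _ _ _ _ _ (h₁.map f) (h₂.map f) (h₃.map f) (h.reindex f)
  | assocRight u v w k l m h₁ h₂ h₃ h =>
    exact .assocRight _ _ _ _ _ _ (h₁.map f) (h₂.map f) (h₃.map f) (h.reindex f)
  | universal h => exact .universal (h.reindex f)
  | termFill X T w h₁ h₂ h₃ h =>
    refine .termFill (f.node X) (f.node T) _ (h₁.map f) ?_ ?_ (h.reindex f)
    · rw [← reindex_node, ← h₂]; rfl
    · rw [← reindex_node, ← h₃]; rfl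
  | termUniq w w' h₁ h₂ h₃ h =>
    refine .termUniq (f.edge w) (f.edge w') ?_ ?_ ?_ (h.reindex_idn f)
    · rw [← f.map_cod]; exact h₁.map f
    · rw [← f.map_dom, h₂, f.map_dom]
    · rw [← f.map_cod, h₃, f.map_cod]
  | initFill X T w h₁ h₂ h₃ h =>
    refine .initFill (f.node X) (f.node T) _ (h₁.map f) ?_ ?_ (h.reindex f)
    · rw [← reindex_node, ← h₂]; rfl
    · rw [← reindex_node, ← h₃]; rfl
  | initUniq w w' h₁ h₂ h₃ h =>
    refine .initUniq (f.edge w) (f.edge w') ?_ ?_ ?_ (h.reindex_idn f)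
    · rw [← f.map_dom]; exact h₁.map f
    · rw [← f.map_dom, h₂, f.map_dom]
    · rw [← f.map_cod, h₃, f.map_cod]
  | pbFill p₁ p₂ u₁ u₂ v₁ v₂ v w t₁ t₂ h₁ h₂ h₃ h₄ h₅ h =>
    refine .pbFill _ _ _ _ _ _ _ _ _ _ (h₁.map f) (h₂.map f) (h₃.map f) ?_ ?_ (h.reindex f)
    · simpa only [reindex_edge] using mp h₄
    · simpa only [reindex_edge] using mp h₅
  | pbUniq p₁ p₂ u₁ u₂ v₁ v₂ w w' h₁ h₂ h₃ h₄ h₅ h =>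
    exact .pbUniq _ _ _ _ _ _ _ _ (h₁.map f) (h₂.map f) (h₃.map f) (h₄.map f) (h₅.map f)
      (h.reindex_idn f)
  | poFill p₁ p₂ u₁ u₂ v₁ v₂ v w t₁ t₂ h₁ h₂ h₃ h₄ h₅ h =>
    refine .poFill _ _ _ _ _ _ _ _ _ _ (h₁.map f) (h₂.map f) (h₃.map f) ?_ ?_ (h.reindex f)
    · simpa only [reindex_edge] using mp h₄
    · simpa only [reindex_edge] using mp h₅
  | poUniq p₁ p₂ u₁ u₂ v₁ v₂ w w' h₁ h₂ h₃ h₄ h₅ h =>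
    exact .poUniq _ _ _ _ _ _ _ _ (h₁.map f) (h₂.map f) (h₃.map f) (h₄.map f) (h₅.map f)
      (h.reindex_idn f)
  | recFill p₁ p₂ ε k q₁ q₂ π₁ π₂ s₁ s₂ z₁ z₂ y g i κ a r r' r'' g' g'' t₁ t₂ t₃ t₄ t₅ t₆ t₇
      h₀ h₁ h₂ h₃ h₄ h₅ h₆ h₇ h =>
    refine .recFill _ _ _ _ _ _ _ _ _ _ _ _ _ _ _ _ _ _ _ _ _ _ _ _ _ _ _ _ _ (h₀.map f)
      ?_ ?_ ?_ ?_ ?_ ?_ ?_ (h.reindex f)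
    · simpa only [reindex_edge] using mp h₁
    · simpa only [reindex_edge] using mp h₂
    · simpa only [reindex_edge] using mp h₃
    · simpa only [reindex_edge] using mp h₄
    · simpa only [reindex_edge] using mp h₅
    · simpa only [reindex_edge] using mp h₆
    · simpa only [reindex_edge] using mp h₇
  | recUniq p₁ p₂ ε k q₁ q₂ π₁ π₂ s₁ s₂ z₁ z₂ y g i κ a r₁ r₁' r₁'' g₁' g₁'' r₂ r₂' r₂'' g₂' g₂''
      h₀ h₁ h₂ h =>
    exact .recUniq _ _ _ _ _ _ _ _ _ _ _ _ _ _ _ _ _ _ _ _ _ _ _ _ _ _ _ (h₀.map f)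
      (h₁.map f) (h₂.map f) (h.reindex_idn f)
  | balance u p₁ p₂ q₁ q₂ h₁ h₂ h₃ h₄ h =>
    exact .balance _ _ _ _ _ (h₁.map f) (h₂.map f) (h₃.map f) (h₄.map f) (h.reindex f)
  | initStab u h₁ h =>
    refine .initStab (f.edge u) ?_ (h.reindex f)
    rw [← f.map_cod]; exact h₁.map f
  | poStab u₁ u₂ v₁ v₂ v w v₁' x₁ v₂' x₂ p z u₁' u₂' j₁ j₂ d h₁ h =>
    exact .poStab _ _ _ _ _ _ _ _ _ _ _ _ _ _ _ _ _ (h₁.map f) (h.reindex f)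
  | exactness π₁ π₂ ρ σ τ d h₁ h => exact .exactness _ _ _ _ _ _ (h₁.map f) (h.reindex f)

end Stability

theorem IsEquivExt.reindex {U V : Sketch} {e : U ⟶ V} (h : IsEquivExt e) :
    ∀ {W : Sketch} (f : U ⟶ W), IsEquivExt (reindexExt f e) := by
  induction h with
  | iso e he =>
    intro W f
    exact .iso _ (reindex_isPushout f e).isIso_inl_of_isIso
  | simple e he => exact fun f => .simple _ (he.reindex f)
  | comp e e' _ _ ih ih' =>
    intro W f
    have h := (reindex_isPushout f e).paste_vert (reindex_isPushout (reindexHom f e) e')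
    have := h.inl_isoIsPushout_hom _ _ (reindex_isPushout f (e ≫ e'))
    rw [← this]
    exact .comp _ _ (.comp _ _ (ih f) (ih' _)) (.iso _ inferInstance)

/-! ### Contexts -/

/-- The empty sketch. -/
def emptySketch : Sketch where
  N := Empty
  E := Empty
  Tri := Empty
  Ut := Empty
  Upb := Empty
  Ui := Empty
  Upo := Empty
  Ul := Empty
  idn := Empty.elim
  dom := Empty.elim
  cod := Empty.elim
  l := Empty.elim
  r := Empty.elim
  c := Empty.elim
  tn := Empty.elim
  pb1 := Empty.elim
  pb2 := Empty.elim
  in0 := Empty.elim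
  po1 := Empty.elim
  po2 := Empty.elim
  lpb := Empty.elim
  lt := Empty.elim
  le := Empty.elim
  lcons := Empty.elim
  dom_idn := fun x => x.elim
  cod_idn := fun x => x.elim
  cod_l := fun x => x.elim
  dom_l := fun x => x.elim
  cod_r := fun x => x.elim
  c_pb := fun x => x.elim
  c_po := fun x => x.elim
  cod_c_lpb := fun x => x.elim
  dom_le := fun x => x.elim
  dom_lcons := fun x => x.elim
  cod_le := fun x => x.elim
  cod_lcons := fun x => x.elim

/-- A context: a sketch that is an extension of the empty sketch. -/
structure Context where
  sk : Sketch
  isContext : ∃ e : emptySketch ⟶ sk, IsExt e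

theorem same_equivalence (U V : Sketch) :
    Equivalence (Sketch.Hom.Same : (U ⟶ V) → (U ⟶ V) → Prop) :=
  ⟨fun _ => ⟨rfl, rfl⟩, fun h => ⟨h.1.symm, h.2.symm⟩,
    fun h k => ⟨h.1.trans k.1, h.2.trans k.2⟩⟩

theorem Sketch.Hom.Same.comp {U V W : Sketch} {f f' : U ⟶ V} {g g' : V ⟶ W}
    (h : Sketch.Hom.Same f f') (k : Sketch.Hom.Same g g') :
    Sketch.Hom.Same (f ≫ g) (f' ≫ g') :=
  ⟨show g.node ∘ f.node = g'.node ∘ f'.node by rw [h.1, k.1],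
    show g.edge ∘ f.edge = g'.edge ∘ f'.edge by rw [h.2, k.2]⟩

/-- Homomorphisms of contexts, two of them being equal if they agree on nodes and edges. -/
def Context.Hom (S T : Context) : Type :=
  Quotient (⟨_, same_equivalence S.sk T.sk⟩ : Setoid (S.sk ⟶ T.sk))

/-- The category of contexts and homomorphisms. -/
instance : Category Context where
  Hom := Context.Hom
  id S := Quotient.mk _ (𝟙 S.sk)
  comp {R S T} f g := Quotient.map₂ (fun (f : R.sk ⟶ S.sk) (g : S.sk ⟶ T.sk) => f ≫ g)
    (fun _ _ h _ _ k => Sketch.Hom.Same.comp h k) f g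
  id_comp f := by
    induction f using Quotient.ind
    exact congrArg (Quotient.mk _) (Category.id_comp _)
  comp_id f := by
    induction f using Quotient.ind
    exact congrArg (Quotient.mk _) (Category.comp_id _)
  assoc f g h := by
    induction f using Quotient.ind
    induction g using Quotient.ind
    induction h using Quotient.ind
    exact congrArg (Quotient.mk _) (Category.assoc _ _ _)

/-- The morphism of contexts given by a homomorphism of sketches. -/
def Context.ofHom {S T : Context} (f : S.sk ⟶ T.sk) : S ⟶ T := Quotient.mk _ f

/-! ### Context maps -/

/-- A context map from `S` to `T`: an opspan, whose leg at `S` is an equivalence extension.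
(The apex is then a context too.) -/
structure ContextMap (S T : Context) where
  apex : Sketch
  ext : S.sk ⟶ apex
  hom : T.sk ⟶ apex
  isEquivExt : IsEquivExt ext

namespace ContextMap

/-- The context map `(Id, f)`. -/
def ofHom {S T : Context} (f : T.sk ⟶ S.sk) : ContextMap S T :=
  ⟨S.sk, 𝟙 _, f, .iso _ inferInstance⟩

/-- Composition of context maps, by reindexing. -/
def comp {R S T : Context} (m : ContextMap R S) (n : ContextMap S T) : ContextMap R T :=
  ⟨reindex m.hom n.ext, m.ext ≫ reindexExt m.hom n.ext, n.hom ≫ reindexHom m.hom n.ext,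
    .comp _ _ m.isEquivExt (n.isEquivExt.reindex _)⟩

/-- Two context maps are the same opspan: this is up to an isomorphism of the apex, because
reindexing is determined up to isomorphism only. -/
def SameOpspan {S T : Context} (m n : ContextMap S T) : Prop :=
  ∃ φ : m.apex ≅ n.apex, Sketch.Hom.Same (m.ext ≫ φ.hom) n.ext ∧
    Sketch.Hom.Same (m.hom ≫ φ.hom) n.hom

/-- Objective equality of context maps: there are a common refinement `e` of the two equivalence
extensions, by `ε₀` and `ε₁`, and an object equality between the two homomorphisms into it. -/
def ObjectivelyEqual {S T : Context} (m n : ContextMap S T) : Prop :=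
  ∃ (W : Sketch) (e : S.sk ⟶ W) (ε₀ : m.apex ⟶ W) (ε₁ : n.apex ⟶ W), IsEquivExt e ∧
    Sketch.Hom.Same (m.ext ≫ ε₀) e ∧ Sketch.Hom.Same (n.ext ≫ ε₁) e ∧
    ObjectEquality (m.hom ≫ ε₀) (n.hom ≫ ε₁)

/-- The congruence generated by objective equality. -/
inductive Congr : ∀ {S T : Context}, ContextMap S T → ContextMap S T → Prop
  | same {S T : Context} {m n : ContextMap S T} : SameOpspan m n → Congr m n
  | objEq {S T : Context} {m n : ContextMap S T} : ObjectivelyEqual m n → Congr m n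
  | symm {S T : Context} {m n : ContextMap S T} : Congr m n → Congr n m
  | trans {S T : Context} {m n p : ContextMap S T} : Congr m n → Congr n p → Congr m p
  | comp {R S T : Context} {m m' : ContextMap R S} {n n' : ContextMap S T} :
      Congr m m' → Congr n n' → Congr (m.comp n) (m'.comp n')

theorem sameOpspan_of_eq {S T : Context} {m n : ContextMap S T} (φ : m.apex ≅ n.apex)
    (h : m.ext ≫ φ.hom = n.ext) (k : m.hom ≫ φ.hom = n.hom) : SameOpspan m n :=
  ⟨φ, h ▸ ⟨rfl, rfl⟩, k ▸ ⟨rfl, rfl⟩⟩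

theorem congr_equivalence (S T : Context) :
    Equivalence (Congr : ContextMap S T → ContextMap S T → Prop) :=
  ⟨fun _ => .same (sameOpspan_of_eq (Iso.refl _) (Category.comp_id _) (Category.comp_id _)),
    .symm, .trans⟩

/-- A composite of context maps may be computed from any pushout. -/
theorem comp_sameOpspan {R S T : Context} (m : ContextMap R S) (n : ContextMap S T)
    (p : ContextMap R T) (a : m.apex ⟶ p.apex) (b : n.apex ⟶ p.apex)
    (h : IsPushout m.hom n.ext a b) (h₁ : m.ext ≫ a = p.ext) (h₂ : n.hom ≫ b = p.hom) :
    SameOpspan (m.comp n) p := by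
  have hp := reindex_isPushout m.hom n.ext
  refine sameOpspan_of_eq (hp.isoIsPushout _ _ h) ?_ ?_
  · change (m.ext ≫ reindexExt m.hom n.ext) ≫ _ = _
    rw [Category.assoc, hp.inl_isoIsPushout_hom, h₁]
  · change (n.hom ≫ reindexHom m.hom n.ext) ≫ _ = _
    rw [Category.assoc, hp.inr_isoIsPushout_hom, h₂]

end ContextMap

/-- The objects of the category of contexts and context maps. -/
structure Con where
  of ::
  ctx : Context

namespace Con

/-- Context maps modulo the congruence generated by objective equality. -/
def Hom (S T : Con) : Type 1 :=
  Quotient (⟨_, ContextMap.congr_equivalence S.ctx T.ctx⟩ : Setoid (ContextMap S.ctx T.ctx))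

/-- The category of contexts and context maps modulo objective equality. -/
instance : Category Con where
  Hom := Hom
  id S := Quotient.mk _ (ContextMap.ofHom (𝟙 S.ctx.sk))
  comp m n := Quotient.map₂ ContextMap.comp (fun _ _ h _ _ k => .comp h k) m n
  id_comp m := by
    induction m using Quotient.ind with | _ m
    refine Quotient.sound (.same (ContextMap.comp_sameOpspan _ _ _ m.ext (𝟙 m.apex) ?_ ?_ ?_))
    · change IsPushout (𝟙 _) m.ext m.ext (𝟙 _)
      exact IsPushout.of_horiz_isIso ⟨by simp⟩
    · exact Category.id_comp _
    · exact Category.comp_id _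
  comp_id m := by
    induction m using Quotient.ind with | _ m
    refine Quotient.sound (.same (ContextMap.comp_sameOpspan _ _ _ (𝟙 m.apex) m.hom ?_ ?_ ?_))
    · change IsPushout m.hom (𝟙 _) (𝟙 _) m.hom
      exact IsPushout.of_vert_isIso ⟨by simp⟩
    · exact Category.comp_id _
    · exact Category.id_comp _
  assoc m n k := by
    induction m using Quotient.ind with | _ m
    induction n using Quotient.ind with | _ n
    induction k using Quotient.ind with | _ k
    have hp := reindex_isPushout m.hom n.ext
    have hq := reindex_isPushout n.hom k.ext
    have hr := reindex_isPushout (reindexHom m.hom n.ext) (reindexExt n.hom k.ext)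
    have h₁ := hq.paste_horiz hr
    have h₂ := hp.paste_vert hr
    let p : ContextMap _ _ :=
      { apex := _
        ext := m.ext ≫ reindexExt m.hom n.ext ≫
          reindexExt (reindexHom m.hom n.ext) (reindexExt n.hom k.ext)
        hom := k.hom ≫ reindexHom n.hom k.ext ≫
          reindexHom (reindexHom m.hom n.ext) (reindexExt n.hom k.ext)
        isEquivExt := .comp _ _ m.isEquivExt (.comp _ _ (n.isEquivExt.reindex _)
          ((k.isEquivExt.reindex _).reindex _)) }
    refine Quotient.sound (.trans (.same (ContextMap.comp_sameOpspan (m.comp n) k p _ _ h₁ ?_ rfl))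
      (.symm (.same (ContextMap.comp_sameOpspan m (n.comp k) p _ _ h₂ rfl ?_))))
    · exact Category.assoc _ _ _
    · exact Category.assoc _ _ _

/-- The class of a context map. -/
def cls {S T : Context} (m : ContextMap S T) : Con.of S ⟶ Con.of T := Quotient.mk _ m

/-- The functor `(Id, -)` from the opposite of the category of contexts and homomorphisms. -/
def incl : Contextᵒᵖ ⥤ Con where
  obj S := Con.of S.unop
  map {S T} f := Quotient.lift
    (fun g : T.unop.sk ⟶ S.unop.sk => (cls (ContextMap.ofHom g) : Con.of S.unop ⟶ Con.of T.unop))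
    (fun _ _ h => Quotient.sound (ContextMap.Congr.same
      ⟨Iso.refl _, ⟨rfl, rfl⟩, Sketch.Hom.Same.comp h ⟨rfl, rfl⟩⟩)) f.unop
  map_id _ := rfl
  map_comp := by
    rintro ⟨R⟩ ⟨S⟩ ⟨T⟩ ⟨f⟩ ⟨g⟩
    induction f using Quotient.ind with | _ f
    induction g using Quotient.ind with | _ g
    refine Quotient.sound (ContextMap.Congr.symm (ContextMap.Congr.same
      (ContextMap.comp_sameOpspan _ _ _ (𝟙 R.sk) f ?_ ?_ ?_)))
    · change IsPushout f (𝟙 _) (𝟙 _) f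
      exact IsPushout.of_vert_isIso ⟨by simp⟩
    · exact Category.comp_id _
    · rfl

end Con

/-- A functor on contexts and homomorphisms (with the direction reversed) turns object equalities
into equalities. -/
def RespectsObjectEquality {C : Type*} [Category C] (F : Contextᵒᵖ ⥤ C) : Prop :=
  ∀ (S T : Context) (f g : S.sk ⟶ T.sk), ObjectEquality f g →
    F.map (Context.ofHom f).op = F.map (Context.ofHom g).op

/-- A functor on contexts and homomorphisms makes equivalence extensions invertible. -/
def InvertsEquivExt {C : Type*} [Category C] (F : Contextᵒᵖ ⥤ C) : Prop :=
  ∀ (S T : Context) (e : S.sk ⟶ T.sk), IsEquivExt e → IsIso (F.map (Context.ofHom e).op)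

end AUSketch

/-! The difficulty is that objective equality is not visibly transitive or compatible with
composition: inside a given sketch object equalities need not compose, and two refinements of one
context map need not agree. Both problems are solved by testing objective equality in sketches where
the rules already hold.

A sketch `M` is called saturated if every instance of composition, the unit and associativity laws,
pullback formation, and existence and uniqueness of fillins is realized in it. Edges of `M` modulo
unary commutativity then form a category, where the universals of `M` are genuine terminal and
initial objects, pullbacks, pushouts and list objects. Object equalities become a class `IsObjEq` of
morphisms of this category, all of them invertible with inverse in the class (`IsObjEq.exists_inv`).
If moreover distinct universals have distinct subjects, the class is closed under composition
(`IsObjEq.comp`), because the node at which two object equalities meet determines the universal they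
both refer to. An object equality between homomorphisms into `M` is a natural family in this class
(`objectEquality_iff`), so that it is an equivalence relation on such homomorphisms.

The key lemma is `IsEquivExt.objectEquality`: if `e` is an equivalence extension, and `e ≫ f`, `e ≫
g` are object-equal into a saturated sketch, then so are `f` and `g`. At a fresh subject of a
universal the missing component comes from the universal property; a fresh edge is determined, up to
unary commutativity, by the commutativities adjoined with it or by the uniqueness rule for its
fillin, which forces naturality.

To return to contexts, observe that a context is finite, so that one equivalence extension realizes
all instances of the rules in it (`exists_saturates`). Iterating gives a chain with saturated union.
An object equality between homomorphisms from a context into the union involves finitely many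
elements, so it exists at a finite stage, which is an equivalence extension
(`Context.exists_saturation`). Subjects are distinct throughout, since a universal is always
adjoined with fresh subjects (`IsExt.subject_injective`). Hence `objectivelyEqual_of_saturated`,
from which transitivity and compatibility with composition follow by forming pushouts of
refinements. As homomorphisms are compared on nodes and edges only, `IsEquivExt.exists_comp_eq`
corrects them on the other sorts, so that the triangles needed for pushouts commute strictly.

The inverse of `(Id, e)` is `(e, Id)`: one composite compares the two legs of the pushout of `e`
along itself, to which the key lemma applies. A context map `m = (e, f)` satisfies `(Id, e) ≫ m =
(Id, f)`, so a functor on `Con` is determined by its restriction along `incl`, and the inverse of `F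
e` followed by `F f` defines the required extension of `F`. -/

namespace AUSketch

/-! ### Adjoining edges and commutativities -/

/-- Data for adjoining edges, indexed by `I`, and commutativities, indexed by `J`. -/
structure EdgeData (U : Sketch) (I J : Type) where
  d : I → U.N
  k : I → U.N
  tl : J → U.E ⊕ I
  tr : J → U.E ⊕ I
  tc : J → U.E ⊕ I
  cod_l : ∀ j, Sum.elim U.cod k (tl j) = Sum.elim U.dom d (tr j)
  dom_l : ∀ j, Sum.elim U.dom d (tl j) = Sum.elim U.dom d (tc j)
  cod_r : ∀ j, Sum.elim U.cod k (tr j) = Sum.elim U.cod k (tc j)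

variable {U V W : Sketch}

namespace EdgeData

variable {I J : Type} (D : EdgeData U I J)

/-- The sketch with the edges and commutativities adjoined. -/
def adjoin : Sketch where
  N := U.N
  E := U.E ⊕ I
  Tri := U.Tri ⊕ J
  Ut := U.Ut
  Upb := U.Upb
  Ui := U.Ui
  Upo := U.Upo
  Ul := U.Ul
  idn X := .inl (U.idn X)
  dom := Sum.elim U.dom D.d
  cod := Sum.elim U.cod D.k
  l := Sum.elim (fun t => .inl (U.l t)) D.tl
  r := Sum.elim (fun t => .inl (U.r t)) D.tr
  c := Sum.elim (fun t => .inl (U.c t)) D.tc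
  tn := U.tn
  pb1 w := .inl (U.pb1 w)
  pb2 w := .inl (U.pb2 w)
  in0 := U.in0
  po1 w := .inl (U.po1 w)
  po2 w := .inl (U.po2 w)
  lpb := U.lpb
  lt := U.lt
  le w := .inl (U.le w)
  lcons w := .inl (U.lcons w)
  dom_idn := U.dom_idn
  cod_idn := U.cod_idn
  cod_l t := by rcases t with t | t; exacts [U.cod_l t, D.cod_l t]
  dom_l t := by rcases t with t | t; exacts [U.dom_l t, D.dom_l t]
  cod_r t := by rcases t with t | t; exacts [U.cod_r t, D.cod_r t]
  c_pb w := congrArg Sum.inl (U.c_pb w)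
  c_po w := congrArg Sum.inl (U.c_po w)
  cod_c_lpb := U.cod_c_lpb
  dom_le := U.dom_le
  dom_lcons := U.dom_lcons
  cod_le := U.cod_le
  cod_lcons := U.cod_lcons

/-- The inclusion of a sketch in the result of adjoining edges and commutativities. -/
def incl : U ⟶ D.adjoin :=
  Sketch.Hom.mk id .inl .inl id id id id id
    (fun _ => rfl) (fun _ => rfl) (fun _ => rfl) (fun _ => rfl) (fun _ => rfl) (fun _ => rfl)
    (fun _ => rfl) (fun _ => rfl) (fun _ => rfl) (fun _ => rfl) (fun _ => rfl) (fun _ => rfl)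
    (fun _ => rfl) (fun _ => rfl) (fun _ => rfl) (fun _ => rfl)

/-- The homomorphism out of the adjunction given by images of the new elements. -/
def desc (h : U ⟶ V) (i : I → V.E) (j : J → V.Tri)
    (hd : ∀ x, V.dom (i x) = h.node (D.d x)) (hk : ∀ x, V.cod (i x) = h.node (D.k x))
    (hl : ∀ x, V.l (j x) = Sum.elim h.edge i (D.tl x))
    (hr : ∀ x, V.r (j x) = Sum.elim h.edge i (D.tr x))
    (hc : ∀ x, V.c (j x) = Sum.elim h.edge i (D.tc x)) : D.adjoin ⟶ V :=
  Sketch.Hom.mk h.node (Sum.elim h.edge i) (Sum.elim h.tri j) h.ut h.upb h.ui h.upo h.ul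
    h.map_idn
    (by rintro (x | x); exacts [h.map_dom x, (hd x).symm])
    (by rintro (x | x); exacts [h.map_cod x, (hk x).symm])
    (by rintro (x | x); exacts [h.map_l x, (hl x).symm])
    (by rintro (x | x); exacts [h.map_r x, (hr x).symm])
    (by rintro (x | x); exacts [h.map_c x, (hc x).symm])
    h.map_tn h.map_pb1 h.map_pb2 h.map_in0 h.map_po1 h.map_po2 h.map_lpb h.map_lt h.map_le
    h.map_lcons

end EdgeData

/-! ### Coproduct inclusions, and equivalence extensions as extensions. -/

theorem isCoprod_nil_iff {α β : Type} {f : α → β} : IsCoprod f [] ↔ Function.Bijective f := by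
  constructor
  · rintro ⟨hi, -, h⟩
    refine ⟨hi, fun b => ?_⟩
    by_contra hb
    exact absurd ((h b).2 hb) (by simp)
  · rintro ⟨hi, hs⟩
    exact ⟨hi, List.nodup_nil, fun b => by simp [hs b]⟩

theorem isCoprod_inl {α I : Type} {s : List I} (hs : s.Nodup) (h : ∀ i, i ∈ s) :
    IsCoprod (Sum.inl : α → α ⊕ I) (s.map Sum.inr) := by
  refine ⟨Sum.inl_injective, hs.map Sum.inr_injective, ?_⟩
  rintro (a | i)
  · simp
  · simp [h i]

theorem isCoprod_id {α : Type} : IsCoprod (id : α → α) [] :=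
  isCoprod_nil_iff.2 Function.bijective_id

theorem EdgeData.protoExt {I J : Type} (D : EdgeData U I J) {s : List I} {s' : List J}
    (hs : s.Nodup) (h : ∀ i, i ∈ s) (hs' : s'.Nodup) (h' : ∀ i, i ∈ s') :
    ProtoExt D.incl { edge := s.map Sum.inr, tri := s'.map Sum.inr } :=
  ⟨isCoprod_id, isCoprod_inl hs h, isCoprod_inl hs' h', isCoprod_id, isCoprod_id, isCoprod_id,
    isCoprod_id, isCoprod_id⟩

/-- Splits off one fresh element, for the inductions that factor a proto-extension into simple
extensions. -/
theorem IsCoprod.elim_cons {α β : Type} {f : α → β} {b : β} {s : List β}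
    (h : IsCoprod f (b :: s)) : IsCoprod (Sum.elim f fun _ : Unit => b) s := by
  obtain ⟨hi, hs, h⟩ := h
  have hb : b ∉ Set.range f := (h b).1 (by simp)
  refine ⟨hi.sumElim (fun _ _ _ => rfl) (fun a _ e => hb ⟨a, e⟩), hs.of_cons, fun x => ?_⟩
  have hx := h x
  rw [List.mem_cons] at hx
  rw [Set.Sum.elim_range, Set.mem_union, not_or, ← hx]
  have hbs : b ∉ s := (List.nodup_cons.1 hs).1
  constructor
  · intro hxs
    exact ⟨Or.inr hxs, by rintro ⟨⟨⟩, hx' : b = x⟩; exact hbs (hx' ▸ hxs)⟩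
  · rintro ⟨rfl | h₁, h₂⟩
    · exact absurd ⟨(), rfl⟩ h₂
    · exact h₁

theorem IsCoprod.elim_empty {α β : Type} {f : α → β} {s : List β} (g : Empty → β)
    (h : IsCoprod f s) : IsCoprod (Sum.elim f g) s := by
  obtain ⟨hi, hs, h⟩ := h
  refine ⟨hi.sumElim (fun a => a.elim) (fun _ b => b.elim), hs, fun x => ?_⟩
  rw [h x, Set.Sum.elim_range, Set.range_eq_empty g, Set.union_empty]

/-- A bijective proto-extension is an isomorphism. -/
theorem ProtoExt.isIso {e : U ⟶ V} (h : ProtoExt e {}) : IsIso e := by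
  obtain ⟨n, e', t, a, b, c, d, l⟩ := h
  rw [isCoprod_nil_iff] at n e' t a b c d l
  obtain ⟨n', n₁, n₂⟩ := Function.bijective_iff_has_inverse.1 n
  obtain ⟨e'', e₁, e₂⟩ := Function.bijective_iff_has_inverse.1 e'
  obtain ⟨t', t₁, t₂⟩ := Function.bijective_iff_has_inverse.1 t
  obtain ⟨a', a₁, a₂⟩ := Function.bijective_iff_has_inverse.1 a
  obtain ⟨b', b₁, b₂⟩ := Function.bijective_iff_has_inverse.1 b
  obtain ⟨c', c₁, c₂⟩ := Function.bijective_iff_has_inverse.1 c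
  obtain ⟨d', d₁, d₂⟩ := Function.bijective_iff_has_inverse.1 d
  obtain ⟨l', l₁, l₂⟩ := Function.bijective_iff_has_inverse.1 l
  refine ⟨Sketch.Hom.mk n' e'' t' a' b' c' d' l' ?_ ?_ ?_ ?_ ?_ ?_ ?_ ?_ ?_ ?_ ?_ ?_ ?_ ?_ ?_ ?_,
    ?_, ?_⟩
  -- The sortwise inverses preserve each operation because `e` does and is injective.
  · exact fun x => e'.1 (by rw [e₂, e.map_idn, n₂])
  · exact fun x => n.1 (by rw [n₂, e.map_dom, e₂])
  · exact fun x => n.1 (by rw [n₂, e.map_cod, e₂])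
  · exact fun x => e'.1 (by rw [e₂, e.map_l, t₂])
  · exact fun x => e'.1 (by rw [e₂, e.map_r, t₂])
  · exact fun x => e'.1 (by rw [e₂, e.map_c, t₂])
  · exact fun x => n.1 (by rw [n₂, e.map_tn, a₂])
  · exact fun x => t.1 (by rw [t₂, e.map_pb1, b₂])
  · exact fun x => t.1 (by rw [t₂, e.map_pb2, b₂])
  · exact fun x => n.1 (by rw [n₂, e.map_in0, c₂])
  · exact fun x => t.1 (by rw [t₂, e.map_po1, d₂])
  · exact fun x => t.1 (by rw [t₂, e.map_po2, d₂])
  · exact fun x => b.1 (by rw [b₂, e.map_lpb, l₂])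
  · exact fun x => a.1 (by rw [a₂, e.map_lt, l₂])
  · exact fun x => e'.1 (by rw [e₂, e.map_le, l₂])
  · exact fun x => e'.1 (by rw [e₂, e.map_lcons, l₂])
  · exact Sketch.Hom.ext (funext n₁) (funext e₁) (funext t₁) (funext a₁) (funext b₁) (funext c₁)
      (funext d₁) (funext l₁)
  · exact Sketch.Hom.ext (funext n₂) (funext e₂) (funext t₂) (funext a₂) (funext b₂) (funext c₂)
      (funext d₂) (funext l₂)

/-- A proto-extension whose fresh elements are commutativities is an extension. -/
theorem isExt_of_protoExt_tri {ts : List V.Tri} :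
    ∀ {U : Sketch} {e : U ⟶ V}, ProtoExt e { tri := ts } → IsExt e := by
  induction ts with
  | nil => exact fun h => .iso _ h.isIso
  | cons t ts ih =>
    intro U e h
    have hE := isCoprod_nil_iff.1 h.edge
    have hN := isCoprod_nil_iff.1 h.node
    -- No node or edge is fresh, so the triangle under `t` already lies in `U`. Once a commutativity
    -- is adjoined there, the map to `V` has one fresh element fewer.
    obtain ⟨u, hu⟩ := hE.2 (V.l t)
    obtain ⟨v, hv⟩ := hE.2 (V.r t)
    obtain ⟨w, hw⟩ := hE.2 (V.c t)
    have h₁ : U.cod u = U.dom v := hN.1 (by rw [e.map_cod, e.map_dom, hu, hv, V.cod_l])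
    have h₂ : U.dom u = U.dom w := hN.1 (by rw [e.map_dom, e.map_dom, hu, hw, V.dom_l])
    have h₃ : U.cod v = U.cod w := hN.1 (by rw [e.map_cod, e.map_cod, hv, hw, V.cod_r])
    let D : EdgeData U Empty Unit :=
      { d := Empty.elim, k := Empty.elim, tl := fun _ => .inl u, tr := fun _ => .inl v
        tc := fun _ => .inl w, cod_l := fun _ => h₁, dom_l := fun _ => h₂, cod_r := fun _ => h₃ }
    have hD : SimpleExt D.incl := .comm u v w (.inr ()) h₁ h₂ h₃ ⟨rfl, rfl, rfl⟩
      (D.protoExt (s := []) (s' := [()]) (by simp) (fun i => i.elim) (by simp) (by simp))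
    let k : D.adjoin ⟶ V := D.desc e Empty.elim (fun _ => t) (fun i => i.elim) (fun i => i.elim)
      (fun _ => hu.symm) (fun _ => hv.symm) (fun _ => hw.symm)
    have hk : IsExt k := ih (e := k) ⟨h.node, h.edge.elim_empty _, h.tri.elim_cons, h.ut, h.upb,
      h.ui, h.upo, h.ul⟩
    exact .comp D.incl k (.simple _ hD) hk

/-- A proto-extension whose fresh elements are edges and commutativities is an extension. -/
theorem isExt_of_protoExt_edge_tri {es : List V.E} {ts : List V.Tri} :
    ∀ {U : Sketch} {e : U ⟶ V}, ProtoExt e { edge := es, tri := ts } → IsExt e := by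
  induction es with
  -- Edges are adjoined before commutativities, because a fresh commutativity may involve fresh
  -- edges.
  | nil => exact isExt_of_protoExt_tri
  | cons u es ih =>
    intro U e h
    have hN := isCoprod_nil_iff.1 h.node
    obtain ⟨X, hX⟩ := hN.2 (V.dom u)
    obtain ⟨Y, hY⟩ := hN.2 (V.cod u)
    let D : EdgeData U Unit Empty :=
      { d := fun _ => X, k := fun _ => Y, tl := Empty.elim, tr := Empty.elim
        tc := Empty.elim, cod_l := fun i => i.elim, dom_l := fun i => i.elim
        cod_r := fun i => i.elim }
    have hD : SimpleExt D.incl := .edge X Y (.inr ()) rfl rfl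
      (D.protoExt (s := [()]) (s' := []) (by simp) (by simp) (by simp) (fun i => i.elim))
    let k : D.adjoin ⟶ V := D.desc e (fun _ => u) Empty.elim (fun _ => hX.symm)
      (fun _ => hY.symm) (fun i => i.elim) (fun i => i.elim) (fun i => i.elim)
    have hk : IsExt k := ih (e := k) ⟨h.node, h.edge.elim_cons, h.tri.elim_empty _, h.ut, h.upb,
      h.ui, h.upo, h.ul⟩
    exact .comp D.incl k (.simple _ hD) hk

/-- A simple equivalence extension adjoins a universal, or else only edges and commutativities. -/
theorem SimpleEquivExt.universal_or_edge_tri {e : U ⟶ V} (h : SimpleEquivExt e) :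
    AddsUniversal e ∨ ∃ es ts, ProtoExt e { edge := es, tri := ts } := by
  have hc : ∀ {u v w}, AddsComm e u v w → ∃ es ts, ProtoExt e { edge := es, tri := ts } :=
    fun ⟨_, _, h⟩ => ⟨_, _, h⟩
  have hi : ∀ {u}, AddsInverse e u → ∃ es ts, ProtoExt e { edge := es, tri := ts } :=
    fun ⟨_, _, _, _, _, h⟩ => ⟨_, _, h⟩
  cases h
  case universal h => exact .inl h
  all_goals first
    | exact .inr (hc ‹AddsComm _ _ _ _›)
    | exact .inr (hi ‹AddsInverse _ _›)
    | exact .inr ⟨_, _, ‹ProtoExt _ _›⟩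

/-- Apart from universals, the rules add only edges and commutativities, and these can be adjoined
one at a time. Consequently equivalence extensions of contexts, in particular the apexes of context
maps, are contexts. -/
theorem IsEquivExt.isExt {e : U ⟶ V} (h : IsEquivExt e) : IsExt e := by
  induction h with
  | iso e h => exact .iso e h
  | simple e h =>
    obtain h | ⟨es, ts, h⟩ := h.universal_or_edge_tri
    · exact .simple e (.universal h)
    · exact isExt_of_protoExt_edge_tri h
  | comp e e' _ _ ih ih' => exact .comp _ _ ih ih'

/-! ### Injectivity, finiteness, and subjects of universals -/

/-- A homomorphism injective on each sort. -/
structure Sketch.Hom.Inj (e : U ⟶ V) : Prop where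
  node : Function.Injective e.node
  edge : Function.Injective e.edge
  tri : Function.Injective e.tri
  ut : Function.Injective e.ut
  upb : Function.Injective e.upb
  ui : Function.Injective e.ui
  upo : Function.Injective e.upo
  ul : Function.Injective e.ul

theorem ProtoExt.inj {e : U ⟶ V} {δ : Fresh V} (h : ProtoExt e δ) : e.Inj :=
  ⟨h.node.1, h.edge.1, h.tri.1, h.ut.1, h.upb.1, h.ui.1, h.upo.1, h.ul.1⟩

theorem AddsUniversal.exists_protoExt {e : U ⟶ V} (h : AddsUniversal e) : ∃ δ, ProtoExt e δ := by
  cases h <;> exact ⟨_, ‹_›⟩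

theorem SimpleExt.exists_protoExt {e : U ⟶ V} (h : SimpleExt e) : ∃ δ, ProtoExt e δ := by
  cases h
  case universal h => exact h.exists_protoExt
  all_goals exact ⟨_, ‹_›⟩

theorem Sketch.Hom.Inj.comp {e : U ⟶ V} {k : V ⟶ W} (he : e.Inj) (hk : k.Inj) : (e ≫ k).Inj :=
  ⟨hk.node.comp he.node, hk.edge.comp he.edge, hk.tri.comp he.tri, hk.ut.comp he.ut,
    hk.upb.comp he.upb, hk.ui.comp he.ui, hk.upo.comp he.upo, hk.ul.comp he.ul⟩

theorem Sketch.Hom.Inj.of_comp_eq_id {e : U ⟶ V} {k : V ⟶ U} (h : e ≫ k = 𝟙 U) : e.Inj :=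
  ⟨Function.LeftInverse.injective (congrFun (congrArg Sketch.Hom.node h)),
    Function.LeftInverse.injective (congrFun (congrArg Sketch.Hom.edge h)),
    Function.LeftInverse.injective (congrFun (congrArg Sketch.Hom.tri h)),
    Function.LeftInverse.injective (congrFun (congrArg Sketch.Hom.ut h)),
    Function.LeftInverse.injective (congrFun (congrArg Sketch.Hom.upb h)),
    Function.LeftInverse.injective (congrFun (congrArg Sketch.Hom.ui h)),
    Function.LeftInverse.injective (congrFun (congrArg Sketch.Hom.upo h)),
    Function.LeftInverse.injective (congrFun (congrArg Sketch.Hom.ul h))⟩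

theorem IsExt.inj {e : U ⟶ V} (h : IsExt e) : e.Inj := by
  induction h with
  | iso e h => exact .of_comp_eq_id (IsIso.hom_inv_id e)
  | simple e h => exact h.exists_protoExt.choose_spec.inj
  | comp e e' _ _ ih ih' => exact ih.comp ih'

/-! ### Finiteness of extensions. -/

theorem IsCoprod.finite {α β : Type} {f : α → β} {s : List β} (h : IsCoprod f s) [Finite α] :
    Finite β := by
  have : (Set.range f ∪ {b | b ∈ s}) = Set.univ := by
    ext b
    rw [Set.mem_union, Set.mem_ofPred_eq, h.2.2 b]
    exact iff_of_true (em _) trivial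
  exact Set.finite_univ_iff.1 (this ▸ (Set.finite_range f).union (List.finite_toSet s))

theorem IsExt.finite {e : U ⟶ V} (h : IsExt e) (hU : Finite U.N ∧ Finite U.E) :
    Finite V.N ∧ Finite V.E := by
  induction h with
  | iso e h =>
    obtain ⟨_, _⟩ := hU
    have := (Sketch.Hom.Inj.of_comp_eq_id (IsIso.inv_hom_id e))
    exact ⟨.of_injective _ this.node, .of_injective _ this.edge⟩
  | simple e h =>
    obtain ⟨_, _⟩ := hU
    obtain ⟨δ, h⟩ := h.exists_protoExt
    exact ⟨h.node.finite, h.edge.finite⟩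
  | comp e e' _ _ ih ih' => exact ih' (ih hU)

/-! ### Distinct universals have distinct subjects. -/

/-- The subject of a universal. -/
def Sketch.subject (U : Sketch) : U.Ut ⊕ U.Upb ⊕ U.Ui ⊕ U.Upo ⊕ U.Ul → U.N :=
  Sum.elim U.tn <| Sum.elim (fun w => U.dom (U.c (U.pb1 w))) <| Sum.elim U.in0 <|
    Sum.elim (fun w => U.cod (U.c (U.po1 w))) fun w => U.cod (U.le w)

/-- The action of a homomorphism on universals. -/
def Sketch.Hom.univ (e : U ⟶ V) :
    U.Ut ⊕ U.Upb ⊕ U.Ui ⊕ U.Upo ⊕ U.Ul → V.Ut ⊕ V.Upb ⊕ V.Ui ⊕ V.Upo ⊕ V.Ul :=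
  Sum.map e.ut <| Sum.map e.upb <| Sum.map e.ui <| Sum.map e.upo e.ul

theorem Sketch.Hom.subject_univ (e : U ⟶ V) (x) : V.subject (e.univ x) = e.node (U.subject x) := by
  rcases x with x | x | x | x | x
  · exact (e.map_tn x).symm
  · simp only [univ, subject, Sum.map_inl, Sum.map_inr, Sum.elim_inl, Sum.elim_inr, e.map_dom,
      e.map_c, e.map_pb1]
  · exact (e.map_in0 x).symm
  · simp only [univ, subject, Sum.map_inl, Sum.map_inr, Sum.elim_inl, Sum.elim_inr, e.map_cod,
      e.map_c, e.map_po1]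
  · simp only [univ, subject, Sum.map_inr, Sum.elim_inr, e.map_cod, e.map_le]

theorem Sketch.Hom.Inj.univ {e : U ⟶ V} (h : e.Inj) : Function.Injective e.univ :=
  h.ut.sumMap <| h.upb.sumMap <| h.ui.sumMap <| h.upo.sumMap h.ul

/-- If distinct universals have distinct subjects, this remains so after adjoining universals with
distinct fresh subjects. -/
theorem subject_injective_of_fresh {e : U ⟶ V} (hn : Function.Injective e.node)
    (hU : Function.Injective U.subject)
    (h₁ : ∀ x, x ∉ Set.range e.univ → V.subject x ∉ Set.range e.node)
    (h₂ : ∀ x y, x ∉ Set.range e.univ → y ∉ Set.range e.univ → V.subject x = V.subject y → x = y) :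
    Function.Injective V.subject := by
  intro x y hxy
  by_cases hx : x ∈ Set.range e.univ <;> by_cases hy : y ∈ Set.range e.univ
  · obtain ⟨x, rfl⟩ := hx
    obtain ⟨y, rfl⟩ := hy
    rw [e.subject_univ, e.subject_univ] at hxy
    rw [hU (hn hxy)]
  · obtain ⟨x, rfl⟩ := hx
    exact absurd ⟨_, (e.subject_univ x).symm.trans hxy⟩ (h₁ y hy)
  · obtain ⟨y, rfl⟩ := hy
    exact absurd ⟨_, (e.subject_univ y).symm.trans hxy.symm⟩ (h₁ x hx)
  · exact h₂ x y hx hy hxy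

theorem ProtoExt.mem_range_univ {e : U ⟶ V} {δ : Fresh V} (h : ProtoExt e δ) (x) :
    x ∉ Set.range e.univ ↔ (∃ w ∈ δ.ut, x = .inl w) ∨ (∃ w ∈ δ.upb, x = .inr (.inl w)) ∨
      (∃ w ∈ δ.ui, x = .inr (.inr (.inl w))) ∨ (∃ w ∈ δ.upo, x = .inr (.inr (.inr (.inl w)))) ∨
      ∃ w ∈ δ.ul, x = .inr (.inr (.inr (.inr w))) := by
  rcases x with x | x | x | x | x <;>
    simp [Sketch.Hom.univ, h.ut.2.2, h.upb.2.2, h.ui.2.2, h.upo.2.2, h.ul.2.2]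

theorem ProtoExt.subject_injective {e : U ⟶ V} {δ : Fresh V} (h : ProtoExt e δ)
    (h₁ : δ.ut = []) (h₂ : δ.upb = []) (h₃ : δ.ui = []) (h₄ : δ.upo = []) (h₅ : δ.ul = [])
    (hU : Function.Injective U.subject) : Function.Injective V.subject := by
  have : ∀ x, x ∈ Set.range e.univ := fun x => by
    by_contra hx
    rw [h.mem_range_univ] at hx
    simp [h₁, h₂, h₃, h₄, h₅] at hx
  exact subject_injective_of_fresh h.node.1 hU (fun x hx => absurd (this x) hx)
    (fun x _ hx => absurd (this x) hx)

theorem AddsUniversal.subject_injective {e : U ⟶ V} (h : AddsUniversal e)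
    (hU : Function.Injective U.subject) : Function.Injective V.subject := by
  cases h with
  | term w h =>
    have hr := h.mem_range_univ
    have hn := h.node.2.2
    refine subject_injective_of_fresh h.node.1 hU (fun x hx => ?_) (fun x y hx hy hxy => ?_)
    · rw [hr] at hx
      rw [← hn]
      simp at hx; subst hx; simp [Sketch.subject]
    · rw [hr] at hx hy
      simp at hx hy; rw [hx, hy]
  | init0 w h =>
    have hr := h.mem_range_univ
    have hn := h.node.2.2
    refine subject_injective_of_fresh h.node.1 hU (fun x hx => ?_) (fun x y hx hy hxy => ?_)
    · rw [hr] at hx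
      rw [← hn]
      simp at hx; subst hx; simp [Sketch.subject]
    · rw [hr] at hx hy
      simp at hx hy; rw [hx, hy]
  | pb u₁ u₂ w _ _ _ h =>
    have hr := h.mem_range_univ
    have hn := h.node.2.2
    refine subject_injective_of_fresh h.node.1 hU (fun x hx => ?_) (fun x y hx hy hxy => ?_)
    · rw [hr] at hx
      rw [← hn]
      simp at hx; subst hx; simp [Sketch.subject]
    · rw [hr] at hx hy
      simp at hx hy; rw [hx, hy]
  | po u₁ u₂ w _ _ _ h =>
    have hr := h.mem_range_univ
    have hn := h.node.2.2
    refine subject_injective_of_fresh h.node.1 hU (fun x hx => ?_) (fun x y hx hy hxy => ?_)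
    · rw [hr] at hx
      rw [← hn]
      simp at hx; subst hx; simp [Sketch.subject]
    · rw [hr] at hx hy
      simp at hx hy; rw [hx, hy]
  | lst A w _ h =>
    have hr := h.mem_range_univ
    have hn := h.node.2.2
    -- A list universal brings a terminal and a pullback universal with it. The three subjects are
    -- the three fresh nodes, which are distinct because the list of fresh nodes has no duplicates.
    have hd := h.node.2.1
    have hT : V.tn (V.lt w) = V.dom (V.le w) := (V.dom_le w).symm
    have hP : V.dom (V.c (V.pb1 (V.lpb w))) = V.dom (V.lcons w) := by rw [V.dom_lcons, V.dom_l]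
    simp only [List.nodup_cons, List.mem_cons, List.not_mem_nil, or_false, not_or] at hd
    obtain ⟨⟨d₁, d₂⟩, d₃, -⟩ := hd
    refine subject_injective_of_fresh h.node.1 hU (fun x hx => ?_) (fun x y hx hy hxy => ?_)
    · rw [hr] at hx
      rw [← hn]
      simp at hx
      rcases hx with rfl | rfl | rfl <;> simp [Sketch.subject, hT, hP]
    · rw [hr] at hx hy
      simp at hx hy
      rcases hx with rfl | rfl | rfl <;> rcases hy with rfl | rfl | rfl <;>
        simp only [Sketch.subject, hT, hP, Sum.elim_inl, Sum.elim_inr] at hxy <;>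
        first | rfl | exact absurd hxy ‹_› | exact absurd hxy.symm ‹_›

/-- A universal is never imposed on a given node but adjoined with a fresh subject. This separates
contexts from arbitrary sketches, and it is what makes object equalities composable. -/
theorem IsExt.subject_injective {e : U ⟶ V} (h : IsExt e) (hU : Function.Injective U.subject) :
    Function.Injective V.subject := by
  induction h with
  | iso e h =>
    intro x y hxy
    have hi := Sketch.Hom.Inj.of_comp_eq_id (IsIso.inv_hom_id e)
    refine hi.univ (hU ?_)
    rw [Sketch.Hom.subject_univ, Sketch.Hom.subject_univ, hxy]
  | simple e h =>
    cases h with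
    | node X h => exact h.subject_injective rfl rfl rfl rfl rfl hU
    | edge X Y u _ _ h => exact h.subject_injective rfl rfl rfl rfl rfl hU
    | comm u v w t _ _ _ _ h => exact h.subject_injective rfl rfl rfl rfl rfl hU
    | universal h => exact h.subject_injective hU
  | comp e e' _ _ ih ih' => exact ih' (ih hU)

namespace Context

theorem finite (S : Context) : Finite S.sk.N ∧ Finite S.sk.E := by
  obtain ⟨e, he⟩ := S.isContext
  exact he.finite ⟨inferInstanceAs (Finite Empty), inferInstanceAs (Finite Empty)⟩

theorem subject_injective (S : Context) : Function.Injective S.sk.subject := by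
  obtain ⟨e, he⟩ := S.isContext
  refine he.subject_injective fun x => ?_
  rcases x with x | x | x | x | x <;> exact Empty.elim x

/-- An equivalence extension of a context is a context. -/
def ofEquivExt (S : Context) {W : Sketch} (e : S.sk ⟶ W) (h : IsEquivExt e) : Context :=
  ⟨W, S.isContext.choose ≫ e, .comp _ _ S.isContext.choose_spec h.isExt⟩

end Context

/-! ### Homomorphisms that agree on nodes and edges -/

/-- The components of a fresh universal are fresh. -/
structure FreshClosed (e : U ⟶ V) : Prop where
  pb1 : ∀ w, V.pb1 w ∈ Set.range e.tri → w ∈ Set.range e.upb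
  pb2 : ∀ w, V.pb2 w ∈ Set.range e.tri → w ∈ Set.range e.upb
  po1 : ∀ w, V.po1 w ∈ Set.range e.tri → w ∈ Set.range e.upo
  po2 : ∀ w, V.po2 w ∈ Set.range e.tri → w ∈ Set.range e.upo
  lpb : ∀ w, V.lpb w ∈ Set.range e.upb → w ∈ Set.range e.ul
  lt : ∀ w, V.lt w ∈ Set.range e.ut → w ∈ Set.range e.ul

theorem ProtoExt.freshClosed {e : U ⟶ V} {δ : Fresh V} (h : ProtoExt e δ)
    (h₁ : ∀ w ∈ δ.upb, V.pb1 w ∈ δ.tri ∧ V.pb2 w ∈ δ.tri)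
    (h₂ : ∀ w ∈ δ.upo, V.po1 w ∈ δ.tri ∧ V.po2 w ∈ δ.tri)
    (h₃ : ∀ w ∈ δ.ul, V.lpb w ∈ δ.upb ∧ V.lt w ∈ δ.ut) : FreshClosed e := by
  simp only [h.upb.2.2, h.upo.2.2, h.ul.2.2, h.tri.2.2, h.ut.2.2] at h₁ h₂ h₃
  refine ⟨?_, ?_, ?_, ?_, ?_, ?_⟩ <;> intro w hw <;> by_contra hn
  exacts [(h₁ w hn).1 hw, (h₁ w hn).2 hw, (h₂ w hn).1 hw, (h₂ w hn).2 hw, (h₃ w hn).1 hw,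
    (h₃ w hn).2 hw]

theorem SimpleEquivExt.freshClosed {e : U ⟶ V} (h : SimpleEquivExt e) : FreshClosed e := by
  obtain h | ⟨es, ts, h⟩ := h.universal_or_edge_tri
  · cases h <;> refine ProtoExt.freshClosed ‹_› ?_ ?_ ?_ <;> simp
  · refine h.freshClosed ?_ ?_ ?_ <;> simp

open Classical in
/-- Redefine a function on the range of an injection. -/
noncomputable def override {α β γ : Type} (i : α → β) (h : α → γ) (k : β → γ) (b : β) : γ :=
  if hb : ∃ a, i a = b then h hb.choose else k b

theorem override_apply {α β γ : Type} {i : α → β} (hi : Function.Injective i) (h : α → γ)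
    (k : β → γ) (a : α) : override i h k (i a) = h a := by
  have hb : ∃ a', i a' = i a := ⟨a, rfl⟩
  rw [override, dif_pos hb, hi hb.choose_spec]

theorem override_of_notMem {α β γ : Type} {i : α → β} (h : α → γ) {k : β → γ} {b : β}
    (hb : b ∉ Set.range i) : override i h k b = k b :=
  dif_neg hb

theorem override_cases {α β γ : Type} {i : α → β} (hi : Function.Injective i) (h : α → γ)
    (k : β → γ) (b : β) : (∃ a, i a = b ∧ override i h k b = h a) ∨
      (b ∉ Set.range i ∧ override i h k b = k b) := by
  by_cases hb : b ∈ Set.range i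
  · obtain ⟨a, rfl⟩ := hb
    exact .inl ⟨a, rfl, override_apply hi h k a⟩
  · exact .inr ⟨hb, override_of_notMem h hb⟩

/-- If `e ≫ k` agrees with `h` on nodes and edges, then `k` may be changed, on other sorts only, so
that `e ≫ k = h`. -/
theorem SimpleEquivExt.exists_comp_eq {e : U ⟶ V} (he : SimpleEquivExt e) {Z : Sketch} (h : U ⟶ Z)
    (k : V ⟶ Z) (hs : Sketch.Hom.Same (e ≫ k) h) :
    ∃ k' : V ⟶ Z, Sketch.Hom.Same k' k ∧ e ≫ k' = h := by
  have hi := (IsEquivExt.simple e he).isExt.inj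
  have hf := he.freshClosed
  have hn : ∀ x, k.node (e.node x) = h.node x := congrFun hs.1
  have hE : ∀ x, k.edge (e.edge x) = h.edge x := congrFun hs.2
  -- On nodes and edges `e ≫ k` already agrees with `h`. On the other sorts the values on the range
  -- of `e` are replaced by those of `h`.
  refine ⟨Sketch.Hom.mk k.node k.edge (override e.tri h.tri k.tri) (override e.ut h.ut k.ut)
    (override e.upb h.upb k.upb) (override e.ui h.ui k.ui) (override e.upo h.upo k.upo)
    (override e.ul h.ul k.ul) k.map_idn k.map_dom k.map_cod ?_ ?_ ?_ ?_ ?_ ?_ ?_ ?_ ?_ ?_ ?_ ?_ ?_,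
    ⟨rfl, rfl⟩, Sketch.Hom.ext hs.1 hs.2 (funext (override_apply hi.tri _ _))
      (funext (override_apply hi.ut _ _)) (funext (override_apply hi.upb _ _))
      (funext (override_apply hi.ui _ _)) (funext (override_apply hi.upo _ _))
      (funext (override_apply hi.ul _ _))⟩ <;> intro x
  · obtain ⟨a, rfl, h'⟩ | ⟨-, h'⟩ := override_cases hi.tri h.tri k.tri x <;> rw [h']
    · rw [← e.map_l, hE, h.map_l]
    · exact k.map_l x
  · obtain ⟨a, rfl, h'⟩ | ⟨-, h'⟩ := override_cases hi.tri h.tri k.tri x <;> rw [h']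
    · rw [← e.map_r, hE, h.map_r]
    · exact k.map_r x
  · obtain ⟨a, rfl, h'⟩ | ⟨-, h'⟩ := override_cases hi.tri h.tri k.tri x <;> rw [h']
    · rw [← e.map_c, hE, h.map_c]
    · exact k.map_c x
  · obtain ⟨a, rfl, h'⟩ | ⟨-, h'⟩ := override_cases hi.ut h.ut k.ut x <;> rw [h']
    · rw [← e.map_tn, hn, h.map_tn]
    · exact k.map_tn x
  -- Operations between two overridden sorts are the critical ones: a fresh universal keeps its
  -- value under `k`, so its components must do so too. They do, because they are fresh
  -- (`FreshClosed`).
  · obtain ⟨a, rfl, h'⟩ | ⟨hx, h'⟩ := override_cases hi.upb h.upb k.upb x <;> rw [h']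
    · rw [← e.map_pb1, override_apply hi.tri, h.map_pb1]
    · rw [override_of_notMem _ (fun hr => hx (hf.pb1 x hr)), k.map_pb1]
  · obtain ⟨a, rfl, h'⟩ | ⟨hx, h'⟩ := override_cases hi.upb h.upb k.upb x <;> rw [h']
    · rw [← e.map_pb2, override_apply hi.tri, h.map_pb2]
    · rw [override_of_notMem _ (fun hr => hx (hf.pb2 x hr)), k.map_pb2]
  · obtain ⟨a, rfl, h'⟩ | ⟨-, h'⟩ := override_cases hi.ui h.ui k.ui x <;> rw [h']
    · rw [← e.map_in0, hn, h.map_in0]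
    · exact k.map_in0 x
  · obtain ⟨a, rfl, h'⟩ | ⟨hx, h'⟩ := override_cases hi.upo h.upo k.upo x <;> rw [h']
    · rw [← e.map_po1, override_apply hi.tri, h.map_po1]
    · rw [override_of_notMem _ (fun hr => hx (hf.po1 x hr)), k.map_po1]
  · obtain ⟨a, rfl, h'⟩ | ⟨hx, h'⟩ := override_cases hi.upo h.upo k.upo x <;> rw [h']
    · rw [← e.map_po2, override_apply hi.tri, h.map_po2]
    · rw [override_of_notMem _ (fun hr => hx (hf.po2 x hr)), k.map_po2]
  · obtain ⟨a, rfl, h'⟩ | ⟨hx, h'⟩ := override_cases hi.ul h.ul k.ul x <;> rw [h']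
    · rw [← e.map_lpb, override_apply hi.upb, h.map_lpb]
    · rw [override_of_notMem _ (fun hr => hx (hf.lpb x hr)), k.map_lpb]
  · obtain ⟨a, rfl, h'⟩ | ⟨hx, h'⟩ := override_cases hi.ul h.ul k.ul x <;> rw [h']
    · rw [← e.map_lt, override_apply hi.ut, h.map_lt]
    · rw [override_of_notMem _ (fun hr => hx (hf.lt x hr)), k.map_lt]
  · obtain ⟨a, rfl, h'⟩ | ⟨-, h'⟩ := override_cases hi.ul h.ul k.ul x <;> rw [h']
    · rw [← e.map_le, hE, h.map_le]
    · exact k.map_le x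
  · obtain ⟨a, rfl, h'⟩ | ⟨-, h'⟩ := override_cases hi.ul h.ul k.ul x <;> rw [h']
    · rw [← e.map_lcons, hE, h.map_lcons]
    · exact k.map_lcons x

/-- Context maps are compared on nodes and edges only, whereas pushouts of sketches need squares
that commute on all sorts. This lemma passes from the weaker comparison to the stronger one. -/
theorem IsEquivExt.exists_comp_eq {e : U ⟶ V} (he : IsEquivExt e) {Z : Sketch} (h : U ⟶ Z)
    (k : V ⟶ Z) (hs : Sketch.Hom.Same (e ≫ k) h) :
    ∃ k' : V ⟶ Z, Sketch.Hom.Same k' k ∧ e ≫ k' = h := by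
  induction he with
  | @iso U V e he =>
    refine ⟨inv e ≫ h, ?_, by simp⟩
    have := Sketch.Hom.Same.comp ((same_equivalence _ _).refl (inv e)) ((same_equivalence _ _).symm hs)
    rwa [IsIso.inv_hom_id_assoc] at this
  | simple e he => exact he.exists_comp_eq h k hs
  | comp e e' _ _ ih ih' =>
    rw [Category.assoc] at hs
    -- The restriction of `k` to the middle sketch is corrected to `k₁`, and afterwards `k` is
    -- corrected so as to restrict to `k₁`.
    obtain ⟨k₁, h₁, h₂⟩ := ih h (e' ≫ k) hs
    obtain ⟨k₂, h₃, h₄⟩ := ih' k₁ k ((same_equivalence _ _).symm h₁)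
    exact ⟨k₂, h₃, by rw [Category.assoc, h₄, h₂]⟩

end AUSketch

namespace AUSketch

variable {U V W : Sketch}

/-! ### Saturation -/

/-- Every instance in `U` of the rules for composition, pullbacks, and fillins is realized in `V`
along `e`. -/
structure Saturates (e : U ⟶ V) : Prop where
  comp : ∀ u v, U.cod u = U.dom v → ∃ w, V.Comm (e.edge u) (e.edge v) w
  unitLeft : ∀ u, V.Comm (e.edge (U.idn (U.dom u))) (e.edge u) (e.edge u)
  unitRight : ∀ u, V.Comm (e.edge u) (e.edge (U.idn (U.cod u))) (e.edge u)
  assocLeft : ∀ u v w k l m, U.Comm u v k → U.Comm v w l → U.Comm u l m →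
    V.Comm (e.edge k) (e.edge w) (e.edge m)
  assocRight : ∀ u v w k l m, U.Comm u v k → U.Comm v w l → U.Comm k w m →
    V.Comm (e.edge u) (e.edge l) (e.edge m)
  -- Pullbacks are the only universals whose existence is required: they supply the products that
  -- occur in the configuration for list recursion.
  pb : ∀ u₁ u₂, U.cod u₁ = U.cod u₂ → ∃ p₁ p₂, V.Pb p₁ p₂ (e.edge u₁) (e.edge u₂)
  termFill : ∀ X T, U.Term T → ∃ w, V.dom w = e.node X ∧ V.cod w = e.node T
  termUniq : ∀ w w', U.Term (U.cod w) → U.dom w = U.dom w' → U.cod w = U.cod w' →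
    V.UComm (e.edge w) (e.edge w')
  initFill : ∀ X T, U.Init0 T → ∃ w, V.dom w = e.node T ∧ V.cod w = e.node X
  initUniq : ∀ w w', U.Init0 (U.dom w) → U.dom w = U.dom w' → U.cod w = U.cod w' →
    V.UComm (e.edge w) (e.edge w')
  pbFill : ∀ p₁ p₂ u₁ u₂ v₁ v₂ v, U.Pb p₁ p₂ u₁ u₂ → U.Comm v₁ u₁ v → U.Comm v₂ u₂ v →
    ∃ w, V.Comm w (e.edge p₁) (e.edge v₁) ∧ V.Comm w (e.edge p₂) (e.edge v₂)
  pbUniq : ∀ p₁ p₂ u₁ u₂ v₁ v₂ w w', U.Pb p₁ p₂ u₁ u₂ → U.Comm w p₁ v₁ → U.Comm w p₂ v₂ →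
    U.Comm w' p₁ v₁ → U.Comm w' p₂ v₂ → V.UComm (e.edge w) (e.edge w')
  poFill : ∀ q₁ q₂ u₁ u₂ v₁ v₂ v, U.Po q₁ q₂ u₁ u₂ → U.Comm u₁ v₁ v → U.Comm u₂ v₂ v →
    ∃ w, V.Comm (e.edge q₁) w (e.edge v₁) ∧ V.Comm (e.edge q₂) w (e.edge v₂)
  poUniq : ∀ q₁ q₂ u₁ u₂ v₁ v₂ w w', U.Po q₁ q₂ u₁ u₂ → U.Comm q₁ w v₁ → U.Comm q₂ w v₂ →
    U.Comm q₁ w' v₁ → U.Comm q₂ w' v₂ → V.UComm (e.edge w) (e.edge w')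
  recFill : ∀ p₁ p₂ ε k q₁ q₂ π₁ π₂ s₁ s₂ z₁ z₂ y g i κ a,
    U.RecData p₁ p₂ ε k q₁ q₂ π₁ π₂ s₁ s₂ z₁ z₂ y g i κ a →
    ∃ r r' r'' g' g'', V.RecSol (e.edge s₁) (e.edge s₂) (e.edge z₁) (e.edge z₂) (e.edge y)
      (e.edge g) (e.edge i) (e.edge κ) (e.edge a) r r' r'' g' g''
  recUniq : ∀ p₁ p₂ ε k q₁ q₂ π₁ π₂ s₁ s₂ z₁ z₂ y g i κ a,
    U.RecData p₁ p₂ ε k q₁ q₂ π₁ π₂ s₁ s₂ z₁ z₂ y g i κ a → ∀ r₁ r₂,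
    (∃ r' r'' g' g'', U.RecSol s₁ s₂ z₁ z₂ y g i κ a r₁ r' r'' g' g'') →
    (∃ r' r'' g' g'', U.RecSol s₁ s₂ z₁ z₂ y g i κ a r₂ r' r'' g' g'') →
    V.UComm (e.edge r₁) (e.edge r₂)

/-- A property of homomorphisms out of `U` that is stable under composition and holds for some
equivalence extension. -/
structure EventuallyHolds (U : Sketch) (P : ∀ V : Sketch, (U ⟶ V) → Prop) : Prop where
  stable : ∀ (V Z : Sketch) (e : U ⟶ V) (k : V ⟶ Z), P V e → P Z (e ≫ k)
  ev : ∃ (V : Sketch) (e : U ⟶ V), IsEquivExt e ∧ P V e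

namespace EventuallyHolds

variable {P Q : ∀ V : Sketch, (U ⟶ V) → Prop}

theorem of_forall (h : ∀ V e, P V e) : EventuallyHolds U P :=
  ⟨fun _ _ _ _ _ => h _ _, U, 𝟙 U, .iso _ inferInstance, h _ _⟩

/-- By stability, both properties hold for the pushout of the two equivalence extensions. -/
theorem and (hP : EventuallyHolds U P) (hQ : EventuallyHolds U Q) :
    EventuallyHolds U fun V e => P V e ∧ Q V e := by
  refine ⟨fun V Z e k h => ⟨hP.stable _ _ _ _ h.1, hQ.stable _ _ _ _ h.2⟩, ?_⟩
  obtain ⟨V, e, he, h⟩ := hP.ev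
  obtain ⟨V', e', he', h'⟩ := hQ.ev
  refine ⟨reindex e e', e ≫ reindexExt e e', .comp _ _ he (he'.reindex _), hP.stable _ _ _ _ h, ?_⟩
  rw [reindex_cond]
  exact hQ.stable _ _ _ _ h'

theorem imp {p : Prop} (h : p → EventuallyHolds U P) :
    EventuallyHolds U fun V e => p → P V e := by
  by_cases hp : p
  · simpa [hp] using h hp
  · exact of_forall fun _ _ h => absurd h hp

/-- Finiteness of contexts enters here, since one equivalence extension can take care of finitely
many instances only. -/
theorem all {ι : Type} [Finite ι] {P : ι → ∀ V : Sketch, (U ⟶ V) → Prop}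
    (h : ∀ i, EventuallyHolds U (P i)) : EventuallyHolds U fun V e => ∀ i, P i V e := by
  classical
  have := Fintype.ofFinite ι
  suffices ∀ s : Finset ι, EventuallyHolds U fun V e => ∀ i ∈ s, P i V e by
    simpa using this Finset.univ
  intro s
  induction s using Finset.induction with
  | empty => exact of_forall (by simp)
  | insert i s _ ih => simpa using (h i).and ih

/-- The common form of the rules that adjoin one commutativity between given edges; the rule in
question is the last hypothesis. -/
theorem comm {u v w : U.E} (h₁ : U.cod u = U.dom v) (h₂ : U.dom u = U.dom w)
    (h₃ : U.cod v = U.cod w)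
    (h : ∀ (V : Sketch) (e : U ⟶ V), AddsComm e u v w → SimpleEquivExt e) :
    EventuallyHolds U fun V e => V.Comm (e.edge u) (e.edge v) (e.edge w) := by
  refine ⟨fun _ _ _ k h => h.map k, ?_⟩
  let D : EdgeData U Empty Unit :=
    { d := Empty.elim, k := Empty.elim, tl := fun _ => .inl u, tr := fun _ => .inl v
      tc := fun _ => .inl w, cod_l := fun _ => h₁, dom_l := fun _ => h₂, cod_r := fun _ => h₃ }
  exact ⟨D.adjoin, D.incl, .simple _ (h _ _ ⟨.inr (), ⟨rfl, rfl, rfl⟩,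
      D.protoExt (s := []) (s' := [()]) (by simp) (fun i => i.elim) (by simp) (by simp)⟩),
    .inr (), rfl, rfl, rfl⟩

theorem ucomm {w w' : U.E} (h₁ : U.dom w = U.dom w') (h₂ : U.cod w = U.cod w')
    (h : ∀ (V : Sketch) (e : U ⟶ V), AddsComm e (U.idn (U.dom w)) w w' → SimpleEquivExt e) :
    EventuallyHolds U fun V e => V.UComm (e.edge w) (e.edge w') := by
  have := comm (by rw [U.cod_idn]) (by rw [U.dom_idn, h₁]) h₂ h
  simpa only [Sketch.UComm, Sketch.Hom.map_idn, Sketch.Hom.map_dom] using this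

end EventuallyHolds

/-! Typing of the edges in configurations. -/

namespace Sketch

theorem Comm.cod_left {u v w : U.E} (h : U.Comm u v w) : U.cod u = U.dom v := by
  obtain ⟨t, rfl, rfl, rfl⟩ := h; exact U.cod_l t

theorem Comm.dom_eq {u v w : U.E} (h : U.Comm u v w) : U.dom w = U.dom u := by
  obtain ⟨t, rfl, rfl, rfl⟩ := h; exact (U.dom_l t).symm

theorem Comm.cod_eq {u v w : U.E} (h : U.Comm u v w) : U.cod w = U.cod v := by
  obtain ⟨t, rfl, rfl, rfl⟩ := h; exact (U.cod_r t).symm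

theorem Pb.comm {p₁ p₂ u₁ u₂ : U.E} (h : U.Pb p₁ p₂ u₁ u₂) :
    ∃ p, U.Comm p₁ u₁ p ∧ U.Comm p₂ u₂ p := by
  obtain ⟨w, rfl, rfl, rfl, rfl⟩ := h
  exact ⟨_, ⟨_, rfl, rfl, rfl⟩, ⟨_, rfl, rfl, (U.c_pb w).symm⟩⟩

theorem Po.comm {q₁ q₂ u₁ u₂ : U.E} (h : U.Po q₁ q₂ u₁ u₂) :
    ∃ q, U.Comm u₁ q₁ q ∧ U.Comm u₂ q₂ q := by
  obtain ⟨w, rfl, rfl, rfl, rfl⟩ := h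
  exact ⟨_, ⟨_, rfl, rfl, rfl⟩, ⟨_, rfl, rfl, (U.c_po w).symm⟩⟩

theorem Pb.dom_eq {p₁ p₂ u₁ u₂ : U.E} (h : U.Pb p₁ p₂ u₁ u₂) : U.dom p₁ = U.dom p₂ := by
  obtain ⟨p, h₁, h₂⟩ := h.comm; rw [← h₁.dom_eq, h₂.dom_eq]

theorem Prod0.dom_eq {p₁ p₂ : U.E} (h : U.Prod0 p₁ p₂) : U.dom p₁ = U.dom p₂ := by
  obtain ⟨_, _, h, _⟩ := h; exact h.dom_eq

theorem Po.cod_eq {p₁ p₂ u₁ u₂ : U.E} (h : U.Po p₁ p₂ u₁ u₂) : U.cod p₁ = U.cod p₂ := by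
  obtain ⟨p, h₁, h₂⟩ := h.comm; rw [← h₁.cod_eq, h₂.cod_eq]

end Sketch

/-! ### Adjoining a pullback universal -/

/-- The sketch with a pullback universal of `u₁, u₂` adjoined. -/
def adjoinPb (U : Sketch) (u₁ u₂ : U.E) (h : U.cod u₁ = U.cod u₂) : Sketch where
  N := U.N ⊕ Unit
  -- The fresh edges are the first projection, the diagonal, the second projection and the identity
  -- of the new vertex, numbered in the order in which `AddsUniversal.pb` lists them. The two fresh
  -- commutativities are numbered in the same way.
  E := U.E ⊕ Fin 4
  Tri := U.Tri ⊕ Fin 2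
  Ut := U.Ut
  Upb := U.Upb ⊕ Unit
  Ui := U.Ui
  Upo := U.Upo
  Ul := U.Ul
  idn := Sum.elim (fun X => .inl (U.idn X)) fun _ => .inr 3
  dom := Sum.elim (fun u => .inl (U.dom u)) fun _ => .inr ()
  cod := Sum.elim (fun u => .inl (U.cod u))
    ![.inl (U.dom u₁), .inl (U.cod u₁), .inl (U.dom u₂), .inr ()]
  l := Sum.elim (fun t => .inl (U.l t)) ![.inr 0, .inr 2]
  r := Sum.elim (fun t => .inl (U.r t)) ![.inl u₁, .inl u₂]
  c := Sum.elim (fun t => .inl (U.c t)) fun _ => .inr 1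
  tn w := .inl (U.tn w)
  pb1 := Sum.elim (fun w => .inl (U.pb1 w)) fun _ => .inr 0
  pb2 := Sum.elim (fun w => .inl (U.pb2 w)) fun _ => .inr 1
  in0 w := .inl (U.in0 w)
  po1 w := .inl (U.po1 w)
  po2 w := .inl (U.po2 w)
  lpb w := .inl (U.lpb w)
  lt := U.lt
  le w := .inl (U.le w)
  lcons w := .inl (U.lcons w)
  dom_idn := by rintro (x | x); exacts [congrArg Sum.inl (U.dom_idn x), rfl]
  cod_idn := by rintro (x | x); exacts [congrArg Sum.inl (U.cod_idn x), rfl]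
  cod_l := by
    rintro (x | x)
    · exact congrArg Sum.inl (U.cod_l x)
    · fin_cases x <;> rfl
  dom_l := by
    rintro (x | x)
    · exact congrArg Sum.inl (U.dom_l x)
    · fin_cases x <;> rfl
  cod_r := by
    rintro (x | x)
    · exact congrArg Sum.inl (U.cod_r x)
    · fin_cases x
      · rfl
      · exact congrArg Sum.inl h.symm
  c_pb := by rintro (x | x); exacts [congrArg Sum.inl (U.c_pb x), rfl]
  c_po w := congrArg Sum.inl (U.c_po w)
  cod_c_lpb w := congrArg Sum.inl (U.cod_c_lpb w)
  dom_le w := congrArg Sum.inl (U.dom_le w)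
  dom_lcons w := congrArg Sum.inl (U.dom_lcons w)
  cod_le w := congrArg Sum.inl (U.cod_le w)
  cod_lcons w := congrArg Sum.inl (U.cod_lcons w)

/-- The inclusion of a sketch in the result of adjoining a pullback universal. -/
def adjoinPbIncl (U : Sketch) (u₁ u₂ : U.E) (h : U.cod u₁ = U.cod u₂) : U ⟶ adjoinPb U u₁ u₂ h :=
  Sketch.Hom.mk .inl .inl .inl id .inl id id id
    (fun _ => rfl) (fun _ => rfl) (fun _ => rfl) (fun _ => rfl) (fun _ => rfl) (fun _ => rfl)
    (fun _ => rfl) (fun _ => rfl) (fun _ => rfl) (fun _ => rfl) (fun _ => rfl) (fun _ => rfl)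
    (fun _ => rfl) (fun _ => rfl) (fun _ => rfl) (fun _ => rfl)

theorem simpleEquivExt_adjoinPbIncl (u₁ u₂ : U.E) (h : U.cod u₁ = U.cod u₂) :
    SimpleEquivExt (adjoinPbIncl U u₁ u₂ h) := by
  refine .universal (.pb u₁ u₂ (.inr ()) h rfl rfl ⟨?_, ?_, ?_, isCoprod_id, ?_, isCoprod_id,
    isCoprod_id, isCoprod_id⟩)
  · exact isCoprod_inl (s := [()]) (by simp) (by simp)
  · exact isCoprod_inl (s := [(0 : Fin 4), 1, 2, 3]) (by decide) (by decide)
  · exact isCoprod_inl (s := [(0 : Fin 2), 1]) (by decide) (by decide)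
  · exact isCoprod_inl (s := [()]) (by simp) (by simp)

/-! ### Realizing the rules one at a time. -/

namespace EventuallyHolds

theorem comp_rule [Finite U.E] :
    EventuallyHolds U fun V e => ∀ u v, U.cod u = U.dom v →
    ∃ w, V.Comm (e.edge u) (e.edge v) w := by
  refine .all fun u => .all fun v => .imp fun h => ⟨fun _ _ _ k ⟨w, h⟩ => ⟨_, h.map k⟩, ?_⟩
  let D : EdgeData U Unit Unit :=
    { d := fun _ => U.dom u, k := fun _ => U.cod v, tl := fun _ => .inl u, tr := fun _ => .inl v
      tc := fun _ => .inr (), cod_l := fun _ => h, dom_l := fun _ => rfl, cod_r := fun _ => rfl }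
  exact ⟨D.adjoin, D.incl, .simple _ (.composite u v (.inr ()) (.inr ()) h ⟨rfl, rfl, rfl⟩
    (D.protoExt (s := [()]) (s' := [()]) (by simp) (by simp) (by simp) (by simp))),
    .inr (), .inr (), rfl, rfl, rfl⟩

theorem unitLeft_rule [Finite U.E] :
    EventuallyHolds U fun V e => ∀ u,
    V.Comm (e.edge (U.idn (U.dom u))) (e.edge u) (e.edge u) :=
  .all fun u => .comm (U.cod_idn _) (U.dom_idn _) rfl fun _ _ h => .unitLeft u h

theorem unitRight_rule [Finite U.E] :
    EventuallyHolds U fun V e => ∀ u,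
    V.Comm (e.edge u) (e.edge (U.idn (U.cod u))) (e.edge u) :=
  .all fun u => .comm (U.dom_idn _).symm rfl (U.cod_idn _) fun _ _ h => .unitRight u h

theorem assocLeft_rule [Finite U.E] :
    EventuallyHolds U fun V e => ∀ u v w k l m, U.Comm u v k → U.Comm v w l →
    U.Comm u l m → V.Comm (e.edge k) (e.edge w) (e.edge m) :=
  .all fun u => .all fun v => .all fun w => .all fun k => .all fun l => .all fun m =>
    .imp fun h₁ => .imp fun h₂ => .imp fun h₃ =>
    .comm (by rw [h₁.cod_eq, h₂.cod_left]) (by rw [h₁.dom_eq, h₃.dom_eq])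
      (by rw [h₃.cod_eq, h₂.cod_eq]) fun _ _ h => .assocLeft u v w k l m h₁ h₂ h₃ h

theorem assocRight_rule [Finite U.E] :
    EventuallyHolds U fun V e => ∀ u v w k l m, U.Comm u v k → U.Comm v w l →
    U.Comm k w m → V.Comm (e.edge u) (e.edge l) (e.edge m) :=
  .all fun u => .all fun v => .all fun w => .all fun k => .all fun l => .all fun m =>
    .imp fun h₁ => .imp fun h₂ => .imp fun h₃ =>
    .comm (by rw [h₁.cod_left, h₂.dom_eq]) (by rw [h₃.dom_eq, h₁.dom_eq])
      (by rw [h₃.cod_eq, h₂.cod_eq]) fun _ _ h => .assocRight u v w k l m h₁ h₂ h₃ h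

theorem pb_rule [Finite U.E] :
    EventuallyHolds U fun V e => ∀ u₁ u₂, U.cod u₁ = U.cod u₂ →
    ∃ p₁ p₂, V.Pb p₁ p₂ (e.edge u₁) (e.edge u₂) := by
  refine .all fun u => .all fun v => .imp fun h =>
    ⟨fun _ _ _ k ⟨p₁, p₂, h⟩ => ⟨_, _, h.map k⟩, ?_⟩
  exact ⟨_, _, .simple _ (simpleEquivExt_adjoinPbIncl u v h), _, _, .inr (), rfl, rfl, rfl, rfl⟩

theorem termFill_rule [Finite U.N] :
    EventuallyHolds U fun V e => ∀ X T, U.Term T →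
    ∃ w, V.dom w = e.node X ∧ V.cod w = e.node T := by
  refine .all fun X => .all fun T => .imp fun h =>
    ⟨fun _ _ e k ⟨w, h, h'⟩ => ⟨k.edge w, (k.map_dom w).symm.trans (congrArg k.node h),
      (k.map_cod w).symm.trans (congrArg k.node h')⟩, ?_⟩
  let D : EdgeData U Unit Empty :=
    { d := fun _ => X, k := fun _ => T, tl := Empty.elim, tr := Empty.elim
      tc := Empty.elim, cod_l := fun i => i.elim, dom_l := fun i => i.elim
      cod_r := fun i => i.elim }
  exact ⟨D.adjoin, D.incl, .simple _ (.termFill X T (.inr ()) h rfl rfl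
    (D.protoExt (s := [()]) (s' := []) (by simp) (by simp) (by simp) (fun i => i.elim))),
    .inr (), rfl, rfl⟩

theorem termUniq_rule [Finite U.E] :
    EventuallyHolds U fun V e => ∀ w w', U.Term (U.cod w) → U.dom w = U.dom w' →
    U.cod w = U.cod w' → V.UComm (e.edge w) (e.edge w') :=
  .all fun w => .all fun w' => .imp fun h₁ => .imp fun h₂ => .imp fun h₃ =>
    .ucomm h₂ h₃ fun _ _ h => .termUniq w w' h₁ h₂ h₃ h

theorem initFill_rule [Finite U.N] :
    EventuallyHolds U fun V e => ∀ X T, U.Init0 T →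
    ∃ w, V.dom w = e.node T ∧ V.cod w = e.node X := by
  refine .all fun X => .all fun T => .imp fun h =>
    ⟨fun _ _ e k ⟨w, h, h'⟩ => ⟨k.edge w, (k.map_dom w).symm.trans (congrArg k.node h),
      (k.map_cod w).symm.trans (congrArg k.node h')⟩, ?_⟩
  let D : EdgeData U Unit Empty :=
    { d := fun _ => T, k := fun _ => X, tl := Empty.elim, tr := Empty.elim
      tc := Empty.elim, cod_l := fun i => i.elim, dom_l := fun i => i.elim
      cod_r := fun i => i.elim }
  exact ⟨D.adjoin, D.incl, .simple _ (.initFill X T (.inr ()) h rfl rfl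
    (D.protoExt (s := [()]) (s' := []) (by simp) (by simp) (by simp) (fun i => i.elim))),
    .inr (), rfl, rfl⟩

theorem initUniq_rule [Finite U.E] :
    EventuallyHolds U fun V e => ∀ w w', U.Init0 (U.dom w) → U.dom w = U.dom w' →
    U.cod w = U.cod w' → V.UComm (e.edge w) (e.edge w') :=
  .all fun w => .all fun w' => .imp fun h₁ => .imp fun h₂ => .imp fun h₃ =>
    .ucomm h₂ h₃ fun _ _ h => .initUniq w w' h₁ h₂ h₃ h

theorem pbFill_rule [Finite U.E] :
    EventuallyHolds U fun V e => ∀ p₁ p₂ u₁ u₂ v₁ v₂ v, U.Pb p₁ p₂ u₁ u₂ →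
    U.Comm v₁ u₁ v → U.Comm v₂ u₂ v →
    ∃ w, V.Comm w (e.edge p₁) (e.edge v₁) ∧ V.Comm w (e.edge p₂) (e.edge v₂) := by
  refine .all fun p₁ => .all fun p₂ => .all fun u₁ => .all fun u₂ => .all fun v₁ =>
    .all fun v₂ => .all fun v => .imp fun h₁ => .imp fun h₂ => .imp fun h₃ =>
    ⟨fun _ _ _ k ⟨w, h, h'⟩ => ⟨_, h.map k, h'.map k⟩, ?_⟩
  obtain ⟨p, h₄, h₅⟩ := h₁.comm
  let D : EdgeData U Unit Bool :=
    -- `true` labels the triangle over `p₁` and `false` the one over `p₂`; the arguments of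
    -- `Bool.rec` start with the case `false`.
    { d := fun _ => U.dom v₁, k := fun _ => U.dom p₁, tl := fun _ => .inr ()
      tr := fun b => .inl (cond b p₁ p₂), tc := fun b => .inl (cond b v₁ v₂)
      cod_l := Bool.rec h₁.dom_eq rfl
      dom_l := Bool.rec (h₂.dom_eq.symm.trans h₃.dom_eq) rfl
      cod_r := Bool.rec (h₅.cod_left.trans h₃.cod_left.symm) (h₄.cod_left.trans h₂.cod_left.symm) }
  exact ⟨D.adjoin, D.incl, .simple _ (.pbFill p₁ p₂ u₁ u₂ v₁ v₂ v (.inr ()) (.inr true)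
    (.inr false) h₁ h₂ h₃ ⟨rfl, rfl, rfl⟩ ⟨rfl, rfl, rfl⟩
    (D.protoExt (s := [()]) (s' := [true, false]) (by simp) (by simp) (by simp) (by simp))),
    .inr (), ⟨.inr true, rfl, rfl, rfl⟩, .inr false, rfl, rfl, rfl⟩

theorem pbUniq_rule [Finite U.E] :
    EventuallyHolds U fun V e => ∀ p₁ p₂ u₁ u₂ v₁ v₂ w w', U.Pb p₁ p₂ u₁ u₂ →
    U.Comm w p₁ v₁ → U.Comm w p₂ v₂ → U.Comm w' p₁ v₁ → U.Comm w' p₂ v₂ →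
    V.UComm (e.edge w) (e.edge w') :=
  .all fun p₁ => .all fun p₂ => .all fun u₁ => .all fun u₂ => .all fun v₁ =>
    .all fun v₂ => .all fun w => .all fun w' => .imp fun h₁ => .imp fun h₂ => .imp fun h₃ =>
    .imp fun h₄ => .imp fun h₅ => .ucomm (h₂.dom_eq.symm.trans h₄.dom_eq)
      (h₂.cod_left.trans h₄.cod_left.symm)
      fun _ _ h => .pbUniq p₁ p₂ u₁ u₂ v₁ v₂ w w' h₁ h₂ h₃ h₄ h₅ h

theorem poFill_rule [Finite U.E] :
    EventuallyHolds U fun V e => ∀ q₁ q₂ u₁ u₂ v₁ v₂ v, U.Po q₁ q₂ u₁ u₂ →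
    U.Comm u₁ v₁ v → U.Comm u₂ v₂ v →
    ∃ w, V.Comm (e.edge q₁) w (e.edge v₁) ∧ V.Comm (e.edge q₂) w (e.edge v₂) := by
  refine .all fun q₁ => .all fun q₂ => .all fun u₁ => .all fun u₂ => .all fun v₁ =>
    .all fun v₂ => .all fun v => .imp fun h₁ => .imp fun h₂ => .imp fun h₃ =>
    ⟨fun _ _ _ k ⟨w, h, h'⟩ => ⟨_, h.map k, h'.map k⟩, ?_⟩
  obtain ⟨p, h₄, h₅⟩ := h₁.comm
  let D : EdgeData U Unit Bool :=
    { d := fun _ => U.cod q₁, k := fun _ => U.cod v₁, tr := fun _ => .inr ()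
      tl := fun b => .inl (cond b q₁ q₂), tc := fun b => .inl (cond b v₁ v₂)
      cod_l := Bool.rec h₁.cod_eq.symm rfl
      cod_r := Bool.rec (h₂.cod_eq.symm.trans h₃.cod_eq) rfl
      dom_l := Bool.rec (h₅.cod_left.symm.trans h₃.cod_left) (h₄.cod_left.symm.trans h₂.cod_left) }
  exact ⟨D.adjoin, D.incl, .simple _ (.poFill q₁ q₂ u₁ u₂ v₁ v₂ v (.inr ()) (.inr true)
    (.inr false) h₁ h₂ h₃ ⟨rfl, rfl, rfl⟩ ⟨rfl, rfl, rfl⟩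
    (D.protoExt (s := [()]) (s' := [true, false]) (by simp) (by simp) (by simp) (by simp))),
    .inr (), ⟨.inr true, rfl, rfl, rfl⟩, .inr false, rfl, rfl, rfl⟩

theorem poUniq_rule [Finite U.E] :
    EventuallyHolds U fun V e => ∀ q₁ q₂ u₁ u₂ v₁ v₂ w w', U.Po q₁ q₂ u₁ u₂ →
    U.Comm q₁ w v₁ → U.Comm q₂ w v₂ → U.Comm q₁ w' v₁ → U.Comm q₂ w' v₂ →
    V.UComm (e.edge w) (e.edge w') :=
  .all fun q₁ => .all fun q₂ => .all fun u₁ => .all fun u₂ => .all fun v₁ =>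
    .all fun v₂ => .all fun w => .all fun w' => .imp fun h₁ => .imp fun h₂ => .imp fun h₃ =>
    .imp fun h₄ => .imp fun h₅ => .ucomm (h₂.cod_left.symm.trans h₄.cod_left)
      (h₂.cod_eq.symm.trans h₄.cod_eq)
      fun _ _ h => .poUniq q₁ q₂ u₁ u₂ v₁ v₂ w w' h₁ h₂ h₃ h₄ h₅ h

/-! ### Realizing list recursion. -/

/-- Names for the edges adjoined by list recursion. -/
inductive RecEdge
  -- These stand for `r`, `r'`, `r''`, `g'`, `g''` of `RecSol`, in this order.
  | fn | prod | snd | alg | diag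

/-- Names for the commutativities adjoined by list recursion. -/
inductive RecTri
  | base | step₁ | step₂ | step₃ | fst | snd₁ | snd₂

/-- The data for adjoining a solution of the equations of list recursion. -/
def recEdgeData {p₁ p₂ ε k q₁ q₂ π₁ π₂ s₁ s₂ z₁ z₂ y g i κ a : U.E}
    (h : U.RecData p₁ p₂ ε k q₁ q₂ π₁ π₂ s₁ s₂ z₁ z₂ y g i κ a) : EdgeData U RecEdge RecTri where
  d
    | .fn => U.dom q₁
    | .prod => U.dom s₁
    | .snd => U.dom s₂
    | .alg => U.dom s₁
    | .diag => U.dom κ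
  k
    | .prod => U.dom z₁
    | _ => U.cod y
  tl
    | .base => .inl i
    | .step₁ => .inl κ
    | .step₂ => .inl a
    | .snd₂ => .inl s₂
    | _ => .inr .prod
  tr
    | .base => .inr .fn
    | .step₁ => .inr .fn
    | .step₂ => .inr .alg
    | .step₃ => .inl g
    | .fst => .inl z₁
    | .snd₁ => .inl z₂
    | .snd₂ => .inr .fn
  tc
    | .base => .inl y
    | .step₁ => .inr .diag
    | .step₂ => .inr .diag
    | .step₃ => .inr .alg
    | .fst => .inl s₁
    | .snd₁ => .inr .snd
    | .snd₂ => .inr .snd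
  cod_l := by
    obtain ⟨_, b, -, i₁, i₂⟩ := h.spec_i
    obtain ⟨b', -, k₁, k₂⟩ := h.spec_κ
    obtain ⟨_, _, _, a₁, a₂, -, -, -, a₃⟩ := h.spec_a
    rintro (_ | _)
    exacts [i₁.cod_left, k₁.cod_left, a₂.cod_left, h.dom_g.symm, rfl, h.prodAY.dom_eq, h.cod_s₂]
  dom_l := by
    obtain ⟨_, b, -, i₁, i₂⟩ := h.spec_i
    obtain ⟨b', -, k₁, k₂⟩ := h.spec_κ
    obtain ⟨_, _, _, a₁, a₂, -, -, -, a₃⟩ := h.spec_a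
    -- The edge `diag` is the diagonal of two triangles, which start with `κ` and with `a`; both of
    -- these start at the vertex of the product with projections `π₁`, `π₂`.
    have ha : U.dom a = U.dom κ := by
      rw [← a₂.dom_eq, a₁.dom_eq, h.prodPB.dom_eq, ← k₂.dom_eq]
    rintro (_ | _)
    exacts [i₂.dom_eq.symm.trans ((U.dom_idn _).trans h.dom_y.symm), rfl, ha, rfl, rfl,
      h.prodALB.dom_eq, rfl]
  cod_r := by
    rintro (_ | _)
    exacts [rfl, rfl, rfl, h.cod_g.trans h.cod_y.symm, h.cod_z₁.trans h.cod_s₁.symm,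
      h.cod_y.symm, rfl]

theorem exists_recSol {p₁ p₂ ε k q₁ q₂ π₁ π₂ s₁ s₂ z₁ z₂ y g i κ a : U.E}
    (h : U.RecData p₁ p₂ ε k q₁ q₂ π₁ π₂ s₁ s₂ z₁ z₂ y g i κ a) :
    ∃ (V : Sketch) (e : U ⟶ V), IsEquivExt e ∧ ∃ r r' r'' g' g'',
      V.RecSol (e.edge s₁) (e.edge s₂) (e.edge z₁) (e.edge z₂) (e.edge y)
        (e.edge g) (e.edge i) (e.edge κ) (e.edge a) r r' r'' g' g'' := by
  refine ⟨(recEdgeData h).adjoin, (recEdgeData h).incl, .simple _ (.recFill _ _ _ _ _ _ _ _ _ _ _ _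
    _ _ _ _ _ (.inr .fn) (.inr .prod) (.inr .snd) (.inr .alg) (.inr .diag) (.inr .base)
    (.inr .step₁) (.inr .step₂) (.inr .step₃) (.inr .fst) (.inr .snd₁) (.inr .snd₂) h
    ⟨rfl, rfl, rfl⟩ ⟨rfl, rfl, rfl⟩ ⟨rfl, rfl, rfl⟩ ⟨rfl, rfl, rfl⟩
    ⟨rfl, rfl, rfl⟩ ⟨rfl, rfl, rfl⟩ ⟨rfl, rfl, rfl⟩
    ((recEdgeData h).protoExt (s := [.fn, .prod, .snd, .alg, .diag])
      (s' := [.base, .step₁, .step₂, .step₃, .fst, .snd₁, .snd₂]) (by simp) ?_ (by simp) ?_)),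
    .inr .fn, .inr .prod, .inr .snd, .inr .alg, .inr .diag, ⟨.inr .base, rfl, rfl, rfl⟩,
    ⟨.inr .step₁, rfl, rfl, rfl⟩, ⟨.inr .step₂, rfl, rfl, rfl⟩, ⟨.inr .step₃, rfl, rfl, rfl⟩,
    ⟨.inr .fst, rfl, rfl, rfl⟩, ⟨.inr .snd₁, rfl, rfl, rfl⟩, ⟨.inr .snd₂, rfl, rfl, rfl⟩⟩
  · rintro (_ | _) <;> simp
  · rintro (_ | _) <;> simp

theorem recFill_rule [Finite U.E] :
    EventuallyHolds U fun V e => ∀ p₁ p₂ ε k q₁ q₂ π₁ π₂ s₁ s₂ z₁ z₂ y g i κ a,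
    U.RecData p₁ p₂ ε k q₁ q₂ π₁ π₂ s₁ s₂ z₁ z₂ y g i κ a →
    ∃ r r' r'' g' g'', V.RecSol (e.edge s₁) (e.edge s₂) (e.edge z₁) (e.edge z₂) (e.edge y)
      (e.edge g) (e.edge i) (e.edge κ) (e.edge a) r r' r'' g' g'' := by
  refine .all fun p₁ => .all fun p₂ => .all fun ε => .all fun k => .all fun q₁ => .all fun q₂ =>
    .all fun π₁ => .all fun π₂ => .all fun s₁ => .all fun s₂ => .all fun z₁ => .all fun z₂ =>
    .all fun y => .all fun g => .all fun i => .all fun κ => .all fun a => .imp fun h =>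
    ⟨fun _ _ _ k ⟨_, _, _, _, _, h⟩ => ⟨_, _, _, _, _, h.map k⟩, exists_recSol h⟩

theorem recUniq_rule [Finite U.E] :
    EventuallyHolds U fun V e => ∀ p₁ p₂ ε k q₁ q₂ π₁ π₂ s₁ s₂ z₁ z₂ y g i κ a,
    U.RecData p₁ p₂ ε k q₁ q₂ π₁ π₂ s₁ s₂ z₁ z₂ y g i κ a → ∀ r₁ r₂,
    (∃ r' r'' g' g'', U.RecSol s₁ s₂ z₁ z₂ y g i κ a r₁ r' r'' g' g'') →
    (∃ r' r'' g' g'', U.RecSol s₁ s₂ z₁ z₂ y g i κ a r₂ r' r'' g' g'') →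
    V.UComm (e.edge r₁) (e.edge r₂) := by
  refine .all fun p₁ => .all fun p₂ => .all fun ε => .all fun k => .all fun q₁ => .all fun q₂ =>
    .all fun π₁ => .all fun π₂ => .all fun s₁ => .all fun s₂ => .all fun z₁ => .all fun z₂ =>
    .all fun y => .all fun g => .all fun i => .all fun κ => .all fun a => .imp fun h =>
    .all fun r₁ => .all fun r₂ => .imp fun h₁ => .imp fun h₂ => ?_
  obtain ⟨_, _, _, _, h₁⟩ := h₁
  obtain ⟨_, _, _, _, h₂⟩ := h₂
  exact .ucomm (h₁.base.cod_left.symm.trans h₂.base.cod_left)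
    (h₁.base.cod_eq.symm.trans h₂.base.cod_eq)
    fun _ _ h' => .recUniq _ _ _ _ _ _ _ _ _ _ _ _ _ _ _ _ _ _ _ _ _ _ _ _ _ _ _ h h₁ h₂ h'

end EventuallyHolds

open EventuallyHolds in
/-- A finite sketch has an equivalence extension that realizes all instances of the rules. -/
theorem exists_saturates (U : Sketch) [Finite U.N] [Finite U.E] :
    ∃ (V : Sketch) (e : U ⟶ V), IsEquivExt e ∧ Saturates e := by
  obtain ⟨V, e, he, h₁, h₂, h₃, h₄, h₅, h₆, h₇, h₈, h₉, h₁₀, h₁₁, h₁₂, h₁₃, h₁₄, h₁₅, h₁₆⟩ :=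
    ((comp_rule (U := U)).and <| unitLeft_rule.and <| unitRight_rule.and <| assocLeft_rule.and <|
      assocRight_rule.and <| pb_rule.and <| termFill_rule.and <| termUniq_rule.and <|
      initFill_rule.and <| initUniq_rule.and <| pbFill_rule.and <| pbUniq_rule.and <|
      poFill_rule.and <| poUniq_rule.and <| recFill_rule.and recUniq_rule).ev
  exact ⟨V, e, he, h₁, h₂, h₃, h₄, h₅, h₆, h₇, h₈, h₉, h₁₀, h₁₁, h₁₂, h₁₃, h₁₄, h₁₅, h₁₆⟩

end AUSketch

namespace AUSketch

open Filter

/-! ### Unions of chains -/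

section SeqLim

variable {X Y Z : ℕ → Type}

/-- The colimit of a sequence of sets. -/
def SeqLim (s : ∀ n, X n → X (n + 1)) : Type :=
  Quot fun a b : Σ n, X n => b = ⟨a.1 + 1, s a.1 a.2⟩

namespace SeqLim

variable {s : ∀ n, X n → X (n + 1)} {t : ∀ n, Y n → Y (n + 1)}

def mk (s : ∀ n, X n → X (n + 1)) (n : ℕ) (x : X n) : SeqLim s := Quot.mk _ ⟨n, x⟩

theorem mk_succ (n : ℕ) (x : X n) : mk s (n + 1) (s n x) = mk s n x :=
  (Quot.sound (r := fun a b : Σ n, X n => b = ⟨a.1 + 1, s a.1 a.2⟩) (a := ⟨n, x⟩)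
    (b := ⟨n + 1, s n x⟩) rfl).symm

theorem ind {P : SeqLim s → Prop} (h : ∀ n x, P (mk s n x)) (x : SeqLim s) : P x := by
  rcases x with ⟨n, x⟩
  exact h n x

def map (φ : ∀ n, X n → Y n) (h : ∀ n x, φ (n + 1) (s n x) = t n (φ n x)) :
    SeqLim s → SeqLim t :=
  Quot.lift (fun a => mk t a.1 (φ a.1 a.2)) (by
    rintro ⟨n, x⟩ _ rfl
    change mk t n (φ n x) = mk t (n + 1) (φ (n + 1) (s n x))
    rw [h, mk_succ])

theorem eventually_mem_range (x : SeqLim s) : ∀ᶠ n in atTop, x ∈ Set.range (mk s n) := by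
  induction x using ind with | _ m x
  filter_upwards [eventually_ge_atTop m] with n hn
  induction n, hn using Nat.le_induction with
  | base => exact ⟨x, rfl⟩
  | succ n _ ih =>
    obtain ⟨y, hy⟩ := ih
    exact ⟨s n y, by rw [mk_succ, hy]⟩

/-- Elements identified in the colimit have a common descendant, because the generating relation is
a function and therefore confluent. Each transition map being injective, descendants can be traced
back uniquely, so two ancestors at the same stage coincide. -/
theorem mk_injective (hs : ∀ n, Function.Injective (s n)) (n : ℕ) :
    Function.Injective (mk s n) := by
  let R : (Σ n, X n) → (Σ n, X n) → Prop := fun a b => b = ⟨a.1 + 1, s a.1 a.2⟩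
  have le : ∀ a b, Relation.ReflTransGen R a b → a.1 ≤ b.1 := fun a b h => by
    induction h with
    | refl => exact le_rfl
    | tail _ h ih => rw [h]; exact ih.trans (Nat.le_succ _)
  have step : ∀ a a' b, R a b → R a' b → a = a' := by
    rintro ⟨m, x⟩ ⟨m', x'⟩ _ rfl h
    obtain rfl : m = m' := Nat.succ.inj (congrArg Sigma.fst h)
    obtain rfl : x = x' := hs m (eq_of_heq (Sigma.mk.inj h).2)
    rfl
  have inj : ∀ a b, Relation.ReflTransGen R a b → ∀ a', Relation.ReflTransGen R a' b →
      a.1 = a'.1 → a = a' := fun a b h => by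
    induction h with
    | refl =>
      intro a' h' e
      rcases Relation.ReflTransGen.cases_tail h' with h' | ⟨c, h', hc⟩
      · exact h'
      · have := le _ _ h'
        have : a.1 = c.1 + 1 := congrArg Sigma.fst hc
        omega
    | tail h hb ih =>
      intro a' h' e
      rcases Relation.ReflTransGen.cases_tail h' with h' | ⟨c, h', hc⟩
      · have h₁ := le _ _ h
        have h₂ := congrArg Sigma.fst (h'.symm.trans hb)
        simp only at h₂
        omega
      · rw [step _ _ _ hc hb] at h'
        exact ih a' h' e
  intro x y hxy
  -- Church–Rosser is immediate here, as every element has exactly one `R`-successor.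
  have hj : ∀ {a b c}, Relation.ReflTransGen R a b → Relation.ReflTransGen R a c →
      Relation.Join (Relation.ReflTransGen R) b c :=
    Relation.church_rosser fun a b c hb hc => ⟨b, .refl, by
      obtain rfl : b = c := hb.trans hc.symm
      exact .refl⟩
  have he : ∀ a b, Relation.EqvGen R a b → Relation.Join (Relation.ReflTransGen R) a b := by
    intro a b hab
    induction hab with
    | rel a b h => exact ⟨b, .single h, .refl⟩
    | refl a => exact ⟨a, .refl, .refl⟩
    | symm a b _ ih => obtain ⟨c, h₁, h₂⟩ := ih; exact ⟨c, h₂, h₁⟩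
    | trans a b c _ _ ih ih' =>
      obtain ⟨d, h₁, h₂⟩ := ih
      obtain ⟨d', h₁', h₂'⟩ := ih'
      obtain ⟨d'', h₃, h₄⟩ := hj h₂ h₁'
      exact ⟨d'', h₁.trans h₃, h₂'.trans h₄⟩
  obtain ⟨c, h₁, h₂⟩ := he _ _ (Quot.eqvGen_exact hxy)
  exact eq_of_heq (Sigma.mk.inj (inj _ _ h₁ _ h₂ rfl)).2

end SeqLim

end SeqLim

/-- The colimit of a sequence of sketches, computed sort by sort. -/
def seqColimit (W : ℕ → Sketch) (s : ∀ n, W n ⟶ W (n + 1)) : Sketch where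
  N := SeqLim fun n => (s n).node
  E := SeqLim fun n => (s n).edge
  Tri := SeqLim fun n => (s n).tri
  Ut := SeqLim fun n => (s n).ut
  Upb := SeqLim fun n => (s n).upb
  Ui := SeqLim fun n => (s n).ui
  Upo := SeqLim fun n => (s n).upo
  Ul := SeqLim fun n => (s n).ul
  idn := SeqLim.map (fun n => (W n).idn) fun n x => ((s n).map_idn x).symm
  dom := SeqLim.map (fun n => (W n).dom) fun n x => ((s n).map_dom x).symm
  cod := SeqLim.map (fun n => (W n).cod) fun n x => ((s n).map_cod x).symm
  l := SeqLim.map (fun n => (W n).l) fun n x => ((s n).map_l x).symm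
  r := SeqLim.map (fun n => (W n).r) fun n x => ((s n).map_r x).symm
  c := SeqLim.map (fun n => (W n).c) fun n x => ((s n).map_c x).symm
  tn := SeqLim.map (fun n => (W n).tn) fun n x => ((s n).map_tn x).symm
  pb1 := SeqLim.map (fun n => (W n).pb1) fun n x => ((s n).map_pb1 x).symm
  pb2 := SeqLim.map (fun n => (W n).pb2) fun n x => ((s n).map_pb2 x).symm
  in0 := SeqLim.map (fun n => (W n).in0) fun n x => ((s n).map_in0 x).symm
  po1 := SeqLim.map (fun n => (W n).po1) fun n x => ((s n).map_po1 x).symm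
  po2 := SeqLim.map (fun n => (W n).po2) fun n x => ((s n).map_po2 x).symm
  lpb := SeqLim.map (fun n => (W n).lpb) fun n x => ((s n).map_lpb x).symm
  lt := SeqLim.map (fun n => (W n).lt) fun n x => ((s n).map_lt x).symm
  le := SeqLim.map (fun n => (W n).le) fun n x => ((s n).map_le x).symm
  lcons := SeqLim.map (fun n => (W n).lcons) fun n x => ((s n).map_lcons x).symm
  dom_idn := SeqLim.ind fun n x => congrArg (SeqLim.mk (fun n => (s n).node) n) ((W n).dom_idn x)
  cod_idn := SeqLim.ind fun n x => congrArg (SeqLim.mk (fun n => (s n).node) n) ((W n).cod_idn x)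
  cod_l := SeqLim.ind fun n x => congrArg (SeqLim.mk (fun n => (s n).node) n) ((W n).cod_l x)
  dom_l := SeqLim.ind fun n x => congrArg (SeqLim.mk (fun n => (s n).node) n) ((W n).dom_l x)
  cod_r := SeqLim.ind fun n x => congrArg (SeqLim.mk (fun n => (s n).node) n) ((W n).cod_r x)
  c_pb := SeqLim.ind fun n x => congrArg (SeqLim.mk (fun n => (s n).edge) n) ((W n).c_pb x)
  c_po := SeqLim.ind fun n x => congrArg (SeqLim.mk (fun n => (s n).edge) n) ((W n).c_po x)
  cod_c_lpb := SeqLim.ind fun n x => congrArg (SeqLim.mk (fun n => (s n).node) n) ((W n).cod_c_lpb x)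
  dom_le := SeqLim.ind fun n x => congrArg (SeqLim.mk (fun n => (s n).node) n) ((W n).dom_le x)
  dom_lcons := SeqLim.ind fun n x => congrArg (SeqLim.mk (fun n => (s n).node) n) ((W n).dom_lcons x)
  cod_le := SeqLim.ind fun n x => congrArg (SeqLim.mk (fun n => (s n).node) n) ((W n).cod_le x)
  cod_lcons := SeqLim.ind fun n x => congrArg (SeqLim.mk (fun n => (s n).node) n) ((W n).cod_lcons x)

/-- The homomorphisms into the colimit of a sequence. -/
def seqColimitι (W : ℕ → Sketch) (s : ∀ n, W n ⟶ W (n + 1)) (n : ℕ) : W n ⟶ seqColimit W s :=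
  Sketch.Hom.mk (SeqLim.mk (fun n => (s n).node) n)
    (SeqLim.mk (fun n => (s n).edge) n)
    (SeqLim.mk (fun n => (s n).tri) n)
    (SeqLim.mk (fun n => (s n).ut) n)
    (SeqLim.mk (fun n => (s n).upb) n)
    (SeqLim.mk (fun n => (s n).ui) n)
    (SeqLim.mk (fun n => (s n).upo) n)
    (SeqLim.mk (fun n => (s n).ul) n)
    (fun _ => rfl) (fun _ => rfl) (fun _ => rfl) (fun _ => rfl) (fun _ => rfl) (fun _ => rfl)
    (fun _ => rfl) (fun _ => rfl) (fun _ => rfl) (fun _ => rfl) (fun _ => rfl) (fun _ => rfl)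
    (fun _ => rfl) (fun _ => rfl) (fun _ => rfl) (fun _ => rfl)

/-- A sequence of sketches and injective homomorphisms, with union `M`. -/
structure IsUnion (W : ℕ → Sketch) (s : ∀ n, W n ⟶ W (n + 1)) {M : Sketch} (ι : ∀ n, W n ⟶ M) :
    Prop where
  comp : ∀ n, s n ≫ ι (n + 1) = ι n
  inj : ∀ n, (ι n).Inj
  node : ∀ x, ∀ᶠ n in atTop, x ∈ Set.range (ι n).node
  edge : ∀ x, ∀ᶠ n in atTop, x ∈ Set.range (ι n).edge
  tri : ∀ x, ∀ᶠ n in atTop, x ∈ Set.range (ι n).tri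
  ut : ∀ x, ∀ᶠ n in atTop, x ∈ Set.range (ι n).ut
  upb : ∀ x, ∀ᶠ n in atTop, x ∈ Set.range (ι n).upb
  ui : ∀ x, ∀ᶠ n in atTop, x ∈ Set.range (ι n).ui
  upo : ∀ x, ∀ᶠ n in atTop, x ∈ Set.range (ι n).upo
  ul : ∀ x, ∀ᶠ n in atTop, x ∈ Set.range (ι n).ul

theorem isUnion_seqColimit (W : ℕ → Sketch) (s : ∀ n, W n ⟶ W (n + 1)) (hs : ∀ n, (s n).Inj) :
    IsUnion W s (seqColimitι W s) where
  comp n := by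
    apply Sketch.Hom.ext <;> funext x
    · exact SeqLim.mk_succ (s := fun n => (s n).node) n x
    · exact SeqLim.mk_succ (s := fun n => (s n).edge) n x
    · exact SeqLim.mk_succ (s := fun n => (s n).tri) n x
    · exact SeqLim.mk_succ (s := fun n => (s n).ut) n x
    · exact SeqLim.mk_succ (s := fun n => (s n).upb) n x
    · exact SeqLim.mk_succ (s := fun n => (s n).ui) n x
    · exact SeqLim.mk_succ (s := fun n => (s n).upo) n x
    · exact SeqLim.mk_succ (s := fun n => (s n).ul) n x
  inj n := ⟨SeqLim.mk_injective (s := fun n => (s n).node) (fun n => (hs n).node) n,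
    SeqLim.mk_injective (s := fun n => (s n).edge) (fun n => (hs n).edge) n,
    SeqLim.mk_injective (s := fun n => (s n).tri) (fun n => (hs n).tri) n,
    SeqLim.mk_injective (s := fun n => (s n).ut) (fun n => (hs n).ut) n,
    SeqLim.mk_injective (s := fun n => (s n).upb) (fun n => (hs n).upb) n,
    SeqLim.mk_injective (s := fun n => (s n).ui) (fun n => (hs n).ui) n,
    SeqLim.mk_injective (s := fun n => (s n).upo) (fun n => (hs n).upo) n,
    SeqLim.mk_injective (s := fun n => (s n).ul) (fun n => (hs n).ul) n⟩
  node := SeqLim.eventually_mem_range (s := fun n => (s n).node)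
  edge := SeqLim.eventually_mem_range (s := fun n => (s n).edge)
  tri := SeqLim.eventually_mem_range (s := fun n => (s n).tri)
  ut := SeqLim.eventually_mem_range (s := fun n => (s n).ut)
  upb := SeqLim.eventually_mem_range (s := fun n => (s n).upb)
  ui := SeqLim.eventually_mem_range (s := fun n => (s n).ui)
  upo := SeqLim.eventually_mem_range (s := fun n => (s n).upo)
  ul := SeqLim.eventually_mem_range (s := fun n => (s n).ul)

/-! ### Descent of configurations from a union to its stages. -/

namespace IsUnion

variable {W : ℕ → Sketch} {s : ∀ n, W n ⟶ W (n + 1)} {M : Sketch} {ι : ∀ n, W n ⟶ M}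
  (h : IsUnion W s ι)
include h

theorem comp_edge (n : ℕ) (u : (W n).E) : (ι (n + 1)).edge ((s n).edge u) = (ι n).edge u :=
  congrFun (congrArg Sketch.Hom.edge (h.comp n)) u

theorem comp_node (n : ℕ) (u : (W n).N) : (ι (n + 1)).node ((s n).node u) = (ι n).node u :=
  congrFun (congrArg Sketch.Hom.node (h.comp n)) u

theorem dom_inj {n : ℕ} {u v : (W n).E} (e : M.dom ((ι n).edge u) = M.dom ((ι n).edge v)) :
    (W n).dom u = (W n).dom v :=
  (h.inj n).node (by rw [(ι n).map_dom, (ι n).map_dom, e])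

theorem cod_inj {n : ℕ} {u v : (W n).E} (e : M.cod ((ι n).edge u) = M.cod ((ι n).edge v)) :
    (W n).cod u = (W n).cod v :=
  (h.inj n).node (by rw [(ι n).map_cod, (ι n).map_cod, e])

theorem cod_dom_inj {n : ℕ} {u v : (W n).E} (e : M.cod ((ι n).edge u) = M.dom ((ι n).edge v)) :
    (W n).cod u = (W n).dom v :=
  (h.inj n).node (by rw [(ι n).map_cod, (ι n).map_dom, e])

/-- Quantifying over all preimages allows facts about different elements to be intersected in
`atTop` before preimages are chosen at a stage; `ι n` being injective, the choice is immaterial. The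
analogous lemmas below have this form for the same reason. -/
theorem comm {u v w : M.E} (hc : M.Comm u v w) : ∀ᶠ n in atTop, ∀ u' v' w',
    (ι n).edge u' = u → (ι n).edge v' = v → (ι n).edge w' = w → (W n).Comm u' v' w' := by
  obtain ⟨t, rfl, rfl, rfl⟩ := hc
  filter_upwards [h.tri t] with n ⟨t', ht⟩ u v w hu hv hw
  subst ht
  rw [← (ι n).map_l] at hu
  rw [← (ι n).map_r] at hv
  rw [← (ι n).map_c] at hw
  exact ⟨t', ((h.inj n).edge hu).symm, ((h.inj n).edge hv).symm, ((h.inj n).edge hw).symm⟩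

theorem term {X : M.N} (hX : M.Term X) : ∀ᶠ n in atTop, ∀ X', (ι n).node X' = X → (W n).Term X' := by
  obtain ⟨w, rfl⟩ := hX
  filter_upwards [h.ut w] with n ⟨t', ht⟩ u hu
  subst ht
  rw [← (ι n).map_tn] at hu
  exact ⟨t', ((h.inj n).node hu).symm⟩

theorem init0 {X : M.N} (hX : M.Init0 X) :
    ∀ᶠ n in atTop, ∀ X', (ι n).node X' = X → (W n).Init0 X' := by
  obtain ⟨w, rfl⟩ := hX
  filter_upwards [h.ui w] with n ⟨t', ht⟩ u hu
  subst ht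
  rw [← (ι n).map_in0] at hu
  exact ⟨t', ((h.inj n).node hu).symm⟩

theorem pb {p₁ p₂ u₁ u₂ : M.E} (hp : M.Pb p₁ p₂ u₁ u₂) : ∀ᶠ n in atTop, ∀ p₁' p₂' u₁' u₂',
    (ι n).edge p₁' = p₁ → (ι n).edge p₂' = p₂ → (ι n).edge u₁' = u₁ → (ι n).edge u₂' = u₂ →
      (W n).Pb p₁' p₂' u₁' u₂' := by
  obtain ⟨w, rfl, rfl, rfl, rfl⟩ := hp
  filter_upwards [h.upb w] with n ⟨t', ht⟩ p q u v hp hq hu hv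
  subst ht
  rw [← (ι n).map_pb1, ← (ι n).map_l] at hp
  rw [← (ι n).map_pb2, ← (ι n).map_l] at hq
  rw [← (ι n).map_pb1, ← (ι n).map_r] at hu
  rw [← (ι n).map_pb2, ← (ι n).map_r] at hv
  exact ⟨t', ((h.inj n).edge hp).symm, ((h.inj n).edge hq).symm, ((h.inj n).edge hu).symm,
    ((h.inj n).edge hv).symm⟩

theorem po {p₁ p₂ u₁ u₂ : M.E} (hp : M.Po p₁ p₂ u₁ u₂) : ∀ᶠ n in atTop, ∀ p₁' p₂' u₁' u₂',
    (ι n).edge p₁' = p₁ → (ι n).edge p₂' = p₂ → (ι n).edge u₁' = u₁ → (ι n).edge u₂' = u₂ →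
      (W n).Po p₁' p₂' u₁' u₂' := by
  obtain ⟨w, rfl, rfl, rfl, rfl⟩ := hp
  filter_upwards [h.upo w] with n ⟨t', ht⟩ p q u v hp hq hu hv
  subst ht
  rw [← (ι n).map_po1, ← (ι n).map_r] at hp
  rw [← (ι n).map_po2, ← (ι n).map_r] at hq
  rw [← (ι n).map_po1, ← (ι n).map_l] at hu
  rw [← (ι n).map_po2, ← (ι n).map_l] at hv
  exact ⟨t', ((h.inj n).edge hp).symm, ((h.inj n).edge hq).symm, ((h.inj n).edge hu).symm,
    ((h.inj n).edge hv).symm⟩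

theorem lst {p₁ p₂ ε k : M.E} (hp : M.Lst p₁ p₂ ε k) : ∀ᶠ n in atTop, ∀ p₁' p₂' ε' k',
    (ι n).edge p₁' = p₁ → (ι n).edge p₂' = p₂ → (ι n).edge ε' = ε → (ι n).edge k' = k →
      (W n).Lst p₁' p₂' ε' k' := by
  obtain ⟨w, rfl, rfl, rfl, rfl⟩ := hp
  filter_upwards [h.ul w] with n ⟨t', ht⟩ p q u v hp hq hu hv
  subst ht
  rw [← (ι n).map_lpb, ← (ι n).map_pb1, ← (ι n).map_l] at hp
  rw [← (ι n).map_lpb, ← (ι n).map_pb2, ← (ι n).map_l] at hq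
  rw [← (ι n).map_le] at hu
  rw [← (ι n).map_lcons] at hv
  exact ⟨t', ((h.inj n).edge hp).symm, ((h.inj n).edge hq).symm, ((h.inj n).edge hu).symm,
    ((h.inj n).edge hv).symm⟩

theorem prod0 {p₁ p₂ : M.E} (hp : M.Prod0 p₁ p₂) : ∀ᶠ n in atTop, ∀ p₁' p₂',
    (ι n).edge p₁' = p₁ → (ι n).edge p₂' = p₂ → (W n).Prod0 p₁' p₂' := by
  obtain ⟨u₁, u₂, hp, ht⟩ := hp
  filter_upwards [h.edge u₁, h.edge u₂, h.pb hp, h.term ht] with n hu hv hp ht p q hp₁ hp₂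
  obtain ⟨u, rfl⟩ := hu
  obtain ⟨v, rfl⟩ := hv
  exact ⟨u, v, hp _ _ _ _ hp₁ hp₂ rfl rfl, ht _ ((ι n).map_cod u)⟩

theorem ucomm {u v : M.E} (hc : M.UComm u v) : ∀ᶠ n in atTop, ∀ u' v',
    (ι n).edge u' = u → (ι n).edge v' = v → (W n).UComm u' v' := by
  filter_upwards [h.comm hc] with n hc u v hu hv
  exact hc _ _ _ (by rw [(ι n).map_idn, (ι n).map_dom, hu]) hu hv

theorem recData {p₁ p₂ ε k q₁ q₂ π₁ π₂ s₁ s₂ z₁ z₂ y g i κ a : M.E}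
    (hr : M.RecData p₁ p₂ ε k q₁ q₂ π₁ π₂ s₁ s₂ z₁ z₂ y g i κ a) :
    ∀ᶠ n in atTop, ∀ p₁' p₂' ε' k' q₁' q₂' π₁' π₂' s₁' s₂' z₁' z₂' y' g' i' κ' a',
      (ι n).edge p₁' = p₁ → (ι n).edge p₂' = p₂ → (ι n).edge ε' = ε → (ι n).edge k' = k →
      (ι n).edge q₁' = q₁ → (ι n).edge q₂' = q₂ → (ι n).edge π₁' = π₁ → (ι n).edge π₂' = π₂ →
      (ι n).edge s₁' = s₁ → (ι n).edge s₂' = s₂ → (ι n).edge z₁' = z₁ → (ι n).edge z₂' = z₂ →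
      (ι n).edge y' = y → (ι n).edge g' = g → (ι n).edge i' = i → (ι n).edge κ' = κ →
      (ι n).edge a' = a → (W n).RecData p₁' p₂' ε' k' q₁' q₂' π₁' π₂' s₁' s₂' z₁' z₂' y' g' i' κ' a'
      := by
  obtain ⟨t, b, i₁, i₂, i₃⟩ := hr.spec_i
  obtain ⟨b', k₁, k₂, k₃⟩ := hr.spec_κ
  obtain ⟨c₁, c₂, j, a₁, a₂, a₃, a₄, a₅, a₆⟩ := hr.spec_a
  filter_upwards [h.lst hr.lst, h.prod0 hr.prodLB, h.prod0 hr.prodPB, h.prod0 hr.prodALB,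
    h.prod0 hr.prodAY, h.edge t, h.edge b, h.edge b', h.edge c₁, h.edge c₂, h.edge j, h.comm i₁,
    h.comm i₂, h.comm i₃, h.comm k₁, h.comm k₂, h.comm k₃, h.comm a₁, h.comm a₂, h.comm a₃,
    h.comm a₄, h.comm a₅, h.comm a₆] with n lst P₁ P₂ P₃ P₄ ht hb hb' hc₁ hc₂ hj i₁ i₂ i₃ k₁ k₂ k₃
    a₁ a₂ a₃ a₄ a₅ a₆ p₁' p₂' ε' k' q₁' q₂' π₁' π₂' s₁' s₂' z₁' z₂' y' g' i' κ' a'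
  rintro rfl rfl rfl rfl rfl rfl rfl rfl rfl rfl rfl rfl rfl rfl rfl rfl rfl
  obtain ⟨t, rfl⟩ := ht
  obtain ⟨b, rfl⟩ := hb
  obtain ⟨b', rfl⟩ := hb'
  obtain ⟨c₁, rfl⟩ := hc₁
  obtain ⟨c₂, rfl⟩ := hc₂
  obtain ⟨j, rfl⟩ := hj
  exact
    { lst := lst _ _ _ _ rfl rfl rfl rfl
      prodLB := P₁ _ _ rfl rfl
      cod_q₁ := h.cod_inj hr.cod_q₁
      prodPB := P₂ _ _ rfl rfl
      cod_π₁ := h.cod_dom_inj hr.cod_π₁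
      cod_π₂ := h.cod_inj hr.cod_π₂
      prodALB := P₃ _ _ rfl rfl
      cod_s₁ := h.cod_inj hr.cod_s₁
      cod_s₂ := h.cod_dom_inj hr.cod_s₂
      prodAY := P₄ _ _ rfl rfl
      cod_z₁ := h.cod_inj hr.cod_z₁
      dom_y := (h.cod_dom_inj hr.dom_y.symm).symm
      cod_y := h.cod_inj hr.cod_y
      dom_g := h.dom_inj hr.dom_g
      cod_g := h.cod_inj hr.cod_g
      spec_i := ⟨t, b, i₁ _ _ _ rfl rfl rfl, i₂ _ _ _ rfl rfl rfl, i₃ _ _ _ rfl rfl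
        (by rw [(ι n).map_idn, (ι n).map_cod])⟩
      spec_κ := ⟨b', k₁ _ _ _ rfl rfl rfl, k₂ _ _ _ rfl rfl rfl, k₃ _ _ _ rfl rfl rfl⟩
      spec_a := ⟨c₁, c₂, j, a₁ _ _ _ rfl rfl rfl, a₂ _ _ _ rfl rfl rfl, a₃ _ _ _ rfl rfl rfl,
        a₄ _ _ _ rfl rfl rfl, a₅ _ _ _ rfl rfl rfl, a₆ _ _ _ rfl rfl rfl⟩ }

theorem recSol {s₁ s₂ z₁ z₂ y g i κ a r r' r'' d' d'' : M.E}
    (hr : M.RecSol s₁ s₂ z₁ z₂ y g i κ a r r' r'' d' d'') :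
    ∀ᶠ n in atTop, ∀ s₁' s₂' z₁' z₂' y' g' i' κ' a' ρ,
      (ι n).edge s₁' = s₁ → (ι n).edge s₂' = s₂ → (ι n).edge z₁' = z₁ → (ι n).edge z₂' = z₂ →
      (ι n).edge y' = y → (ι n).edge g' = g → (ι n).edge i' = i → (ι n).edge κ' = κ →
      (ι n).edge a' = a → (ι n).edge ρ = r →
      ∃ ρ' ρ'' e' e'', (W n).RecSol s₁' s₂' z₁' z₂' y' g' i' κ' a' ρ ρ' ρ'' e' e'' := by
  obtain ⟨h₁, h₂, h₃, h₄, h₅, h₆, h₇⟩ := hr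
  filter_upwards [h.edge r', h.edge r'', h.edge d', h.edge d'', h.comm h₁, h.comm h₂, h.comm h₃,
    h.comm h₄, h.comm h₅, h.comm h₆, h.comm h₇] with n e₁ e₂ e₃ e₄ h₁ h₂ h₃ h₄ h₅ h₆ h₇
    s₁' s₂' z₁' z₂' y' g' i' κ' a' ρ
  rintro rfl rfl rfl rfl rfl rfl rfl rfl rfl rfl
  obtain ⟨r', rfl⟩ := e₁
  obtain ⟨r'', rfl⟩ := e₂
  obtain ⟨d', rfl⟩ := e₃
  obtain ⟨d'', rfl⟩ := e₄
  exact ⟨r', r'', d', d'', h₁ _ _ _ rfl rfl rfl, h₂ _ _ _ rfl rfl rfl, h₃ _ _ _ rfl rfl rfl,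
    h₄ _ _ _ rfl rfl rfl, h₅ _ _ _ rfl rfl rfl, h₆ _ _ _ rfl rfl rfl, h₇ _ _ _ rfl rfl rfl⟩

/-- A derivation of an object equality is a finite tree of edges, universals and commutativities, so
it lives in all sufficiently late stages. -/
theorem objEq {γ : M.E} (hγ : M.ObjEq γ) : ∀ᶠ n in atTop, ∀ γ', (ι n).edge γ' = γ →
    (W n).ObjEq γ' := by
  induction hγ with
  | @refl γ h₁ h₂ =>
    filter_upwards [h.ucomm h₂] with n h₂ γ'
    rintro rfl
    exact .refl (h.cod_dom_inj h₁.symm).symm (h₂ _ _ rfl (by rw [(ι n).map_idn, (ι n).map_dom]))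
  | @term γ h₁ h₂ =>
    filter_upwards [h.term h₁, h.term h₂] with n h₁ h₂ γ'
    rintro rfl
    exact .term (h₁ _ ((ι n).map_dom _)) (h₂ _ ((ι n).map_cod _))
  | @init0 γ h₁ h₂ =>
    filter_upwards [h.init0 h₁, h.init0 h₂] with n h₁ h₂ γ'
    rintro rfl
    exact .init0 (h₁ _ ((ι n).map_dom _)) (h₂ _ ((ι n).map_cod _))
  | @pb p₁ p₂ u₁ u₂ q₁ q₂ v₁ v₂ γ₁ γ₂ γ₃ γ d₁ d₂ k₁ k₂ d P Q _ _ _ c₁ c₂ c₃ c₄ c₅ c₆ c₇ c₈ c₉ c₁₀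
      o₁ o₂ o₃ =>
    filter_upwards [h.pb P, h.pb Q, o₁, o₂, o₃, h.comm c₁, h.comm c₂, h.comm c₃, h.comm c₄,
      h.comm c₅, h.comm c₆, h.comm c₇, h.comm c₈, h.comm c₉, h.comm c₁₀, h.edge p₁, h.edge p₂,
      h.edge u₁, h.edge u₂, h.edge q₁, h.edge q₂, h.edge v₁, h.edge v₂, h.edge γ₁, h.edge γ₂,
      h.edge γ₃, h.edge d₁, h.edge d₂, h.edge k₁, h.edge k₂, h.edge d] with n P Q o₁ o₂ o₃ c₁ c₂ c₃
      c₄ c₅ c₆ c₇ c₈ c₉ c₁₀ e₁ e₂ e₃ e₄ e₅ e₆ e₇ e₈ e₉ e₁₀ e₁₁ e₁₂ e₁₃ e₁₄ e₁₅ e₁₆ γ'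
    rintro rfl
    obtain ⟨p₁, rfl⟩ := e₁
    obtain ⟨p₂, rfl⟩ := e₂
    obtain ⟨u₁, rfl⟩ := e₃
    obtain ⟨u₂, rfl⟩ := e₄
    obtain ⟨q₁, rfl⟩ := e₅
    obtain ⟨q₂, rfl⟩ := e₆
    obtain ⟨v₁, rfl⟩ := e₇
    obtain ⟨v₂, rfl⟩ := e₈
    obtain ⟨γ₁, rfl⟩ := e₉
    obtain ⟨γ₂, rfl⟩ := e₁₀
    obtain ⟨γ₃, rfl⟩ := e₁₁
    obtain ⟨d₁, rfl⟩ := e₁₂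
    obtain ⟨d₂, rfl⟩ := e₁₃
    obtain ⟨k₁, rfl⟩ := e₁₄
    obtain ⟨k₂, rfl⟩ := e₁₅
    obtain ⟨d, rfl⟩ := e₁₆
    exact .pb (P _ _ _ _ rfl rfl rfl rfl) (Q _ _ _ _ rfl rfl rfl rfl) (o₁ _ rfl) (o₂ _ rfl)
      (o₃ _ rfl) (c₁ _ _ _ rfl rfl rfl) (c₂ _ _ _ rfl rfl rfl) (c₃ _ _ _ rfl rfl rfl)
      (c₄ _ _ _ rfl rfl rfl) (c₅ _ _ _ rfl rfl rfl) (c₆ _ _ _ rfl rfl rfl) (c₇ _ _ _ rfl rfl rfl)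
      (c₈ _ _ _ rfl rfl rfl) (c₉ _ _ _ rfl rfl rfl) (c₁₀ _ _ _ rfl rfl rfl)
  | @po p₁ p₂ u₁ u₂ q₁ q₂ v₁ v₂ γ₁ γ₂ γ₃ γ d₁ d₂ k₁ k₂ d P Q _ _ _ c₁ c₂ c₃ c₄ c₅ c₆ c₇ c₈ c₉ c₁₀
      o₁ o₂ o₃ =>
    filter_upwards [h.po P, h.po Q, o₁, o₂, o₃, h.comm c₁, h.comm c₂, h.comm c₃, h.comm c₄,
      h.comm c₅, h.comm c₆, h.comm c₇, h.comm c₈, h.comm c₉, h.comm c₁₀, h.edge p₁, h.edge p₂,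
      h.edge u₁, h.edge u₂, h.edge q₁, h.edge q₂, h.edge v₁, h.edge v₂, h.edge γ₁, h.edge γ₂,
      h.edge γ₃, h.edge d₁, h.edge d₂, h.edge k₁, h.edge k₂, h.edge d] with n P Q o₁ o₂ o₃ c₁ c₂ c₃
      c₄ c₅ c₆ c₇ c₈ c₉ c₁₀ e₁ e₂ e₃ e₄ e₅ e₆ e₇ e₈ e₉ e₁₀ e₁₁ e₁₂ e₁₃ e₁₄ e₁₅ e₁₆ γ'
    rintro rfl
    obtain ⟨p₁, rfl⟩ := e₁
    obtain ⟨p₂, rfl⟩ := e₂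
    obtain ⟨u₁, rfl⟩ := e₃
    obtain ⟨u₂, rfl⟩ := e₄
    obtain ⟨q₁, rfl⟩ := e₅
    obtain ⟨q₂, rfl⟩ := e₆
    obtain ⟨v₁, rfl⟩ := e₇
    obtain ⟨v₂, rfl⟩ := e₈
    obtain ⟨γ₁, rfl⟩ := e₉
    obtain ⟨γ₂, rfl⟩ := e₁₀
    obtain ⟨γ₃, rfl⟩ := e₁₁
    obtain ⟨d₁, rfl⟩ := e₁₂
    obtain ⟨d₂, rfl⟩ := e₁₃
    obtain ⟨k₁, rfl⟩ := e₁₄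
    obtain ⟨k₂, rfl⟩ := e₁₅
    obtain ⟨d, rfl⟩ := e₁₆
    exact .po (P _ _ _ _ rfl rfl rfl rfl) (Q _ _ _ _ rfl rfl rfl rfl) (o₁ _ rfl) (o₂ _ rfl)
      (o₃ _ rfl) (c₁ _ _ _ rfl rfl rfl) (c₂ _ _ _ rfl rfl rfl) (c₃ _ _ _ rfl rfl rfl)
      (c₄ _ _ _ rfl rfl rfl) (c₅ _ _ _ rfl rfl rfl) (c₆ _ _ _ rfl rfl rfl) (c₇ _ _ _ rfl rfl rfl)
      (c₈ _ _ _ rfl rfl rfl) (c₉ _ _ _ rfl rfl rfl) (c₁₀ _ _ _ rfl rfl rfl)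
  | @lst p₁ p₂ ε k p₁' p₂' ε' k' γA γL γT γP b d₁ d₂ d₃ P Q _ c₁ c₂ c₃ c₄ c₅ c₆ c₇ c₈ o =>
    filter_upwards [h.lst P, h.lst Q, o, h.comm c₁, h.comm c₂, h.comm c₃, h.comm c₄,
      h.comm c₅, h.comm c₆, h.comm c₇, h.comm c₈, h.edge p₁, h.edge p₂,
      h.edge ε, h.edge k, h.edge p₁', h.edge p₂', h.edge ε', h.edge k', h.edge γA, h.edge γT,
      h.edge γP, h.edge b, h.edge d₁, h.edge d₂, h.edge d₃] with n P Q o c₁ c₂ c₃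
      c₄ c₅ c₆ c₇ c₈ e₁ e₂ e₃ e₄ e₅ e₆ e₇ e₈ e₉ e₁₀ e₁₁ e₁₂ e₁₃ e₁₄ e₁₅ γ'
    rintro rfl
    obtain ⟨p₁, rfl⟩ := e₁
    obtain ⟨p₂, rfl⟩ := e₂
    obtain ⟨ε, rfl⟩ := e₃
    obtain ⟨k, rfl⟩ := e₄
    obtain ⟨p₁', rfl⟩ := e₅
    obtain ⟨p₂', rfl⟩ := e₆
    obtain ⟨ε', rfl⟩ := e₇
    obtain ⟨k', rfl⟩ := e₈
    obtain ⟨γA, rfl⟩ := e₉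
    obtain ⟨γT, rfl⟩ := e₁₀
    obtain ⟨γP, rfl⟩ := e₁₁
    obtain ⟨b, rfl⟩ := e₁₂
    obtain ⟨d₁, rfl⟩ := e₁₃
    obtain ⟨d₂, rfl⟩ := e₁₄
    obtain ⟨d₃, rfl⟩ := e₁₅
    exact .lst (P _ _ _ _ rfl rfl rfl rfl) (Q _ _ _ _ rfl rfl rfl rfl) (o _ rfl)
      (c₁ _ _ _ rfl rfl rfl) (c₂ _ _ _ rfl rfl rfl) (c₃ _ _ _ rfl rfl rfl)
      (c₄ _ _ _ rfl rfl rfl) (c₅ _ _ _ rfl rfl rfl) (c₆ _ _ _ rfl rfl rfl) (c₇ _ _ _ rfl rfl rfl)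
      (c₈ _ _ _ rfl rfl rfl)

/-- An object equality in the union is one at some stage. -/
theorem objectEquality {S : Sketch} [Finite S.N] [Finite S.E] {f g : ∀ n, S ⟶ W n} {f' g' : S ⟶ M}
    (hf : ∀ n, f n ≫ ι n = f') (hg : ∀ n, g n ≫ ι n = g') (ho : ObjectEquality f' g') :
    ∃ n, ObjectEquality (f n) (g n) := by
  obtain ⟨α, hα⟩ := ho
  have hfn : ∀ n X, (ι n).node ((f n).node X) = f'.node X := fun n X =>
    congrFun (congrArg Sketch.Hom.node (hf n)) X
  have hgn : ∀ n X, (ι n).node ((g n).node X) = g'.node X := fun n X =>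
    congrFun (congrArg Sketch.Hom.node (hg n)) X
  have hfe : ∀ n X, (ι n).edge ((f n).edge X) = f'.edge X := fun n X =>
    congrFun (congrArg Sketch.Hom.edge (hf n)) X
  have hge : ∀ n X, (ι n).edge ((g n).edge X) = g'.edge X := fun n X =>
    congrFun (congrArg Sketch.Hom.edge (hg n)) X
  -- Since `S` has finitely many nodes and edges, the conditions on all components hold together at
  -- some stage.
  have h₁ := eventually_all.2 fun X => h.edge (α.carrier X)
  have h₂ := eventually_all.2 fun u => h.edge (α.diag u)
  have h₃ := eventually_all.2 fun u => h.comm (α.comm₀ u)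
  have h₄ := eventually_all.2 fun u => h.comm (α.comm₁ u)
  have h₅ := eventually_all.2 fun X => h.objEq (hα X)
  obtain ⟨n, h₁, h₂, h₃, h₄, h₅⟩ := (h₁.and <| h₂.and <| h₃.and <| h₄.and h₅).exists
  choose a ha using h₁
  choose d hd using h₂
  refine ⟨n, ⟨a, d, fun X => (h.inj n).node ?_, fun X => (h.inj n).node ?_,
    fun u => h₃ u _ _ _ (hfe n u) (ha _) (hd _), fun u => h₄ u _ _ _ (ha _) (hge n u) (hd _)⟩,
    fun X => h₅ X _ (ha X)⟩
  · rw [(ι n).map_dom, ha, α.dom_carrier, hfn]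
  · rw [(ι n).map_cod, ha, α.cod_carrier, hgn]

theorem subject_injective (hW : ∀ n, Function.Injective (W n).subject) :
    Function.Injective M.subject := by
  have hr : ∀ x, ∀ᶠ n in atTop, x ∈ Set.range (ι n).univ := by
    rintro (x | x | x | x | x)
    · filter_upwards [h.ut x] with n ⟨y, hy⟩ using ⟨.inl y, by rw [← hy]; rfl⟩
    · filter_upwards [h.upb x] with n ⟨y, hy⟩ using ⟨.inr (.inl y), by rw [← hy]; rfl⟩
    · filter_upwards [h.ui x] with n ⟨y, hy⟩ using ⟨.inr (.inr (.inl y)), by rw [← hy]; rfl⟩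
    · filter_upwards [h.upo x] with n ⟨y, hy⟩ using
        ⟨.inr (.inr (.inr (.inl y))), by rw [← hy]; rfl⟩
    · filter_upwards [h.ul x] with n ⟨y, hy⟩ using
        ⟨.inr (.inr (.inr (.inr y))), by rw [← hy]; rfl⟩
  intro x y hxy
  obtain ⟨n, ⟨x, rfl⟩, ⟨y, rfl⟩⟩ := ((hr x).and (hr y)).exists
  rw [Sketch.Hom.subject_univ, Sketch.Hom.subject_univ] at hxy
  rw [hW n ((h.inj n).node hxy)]

/-- Each instance of a rule at stage `n` is realized at stage `n + 1`; this transports its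
conclusion to the union. -/
theorem map_comm {n : ℕ} {u v w : (W n).E}
    (hc : (W (n + 1)).Comm ((s n).edge u) ((s n).edge v) ((s n).edge w)) :
    M.Comm ((ι n).edge u) ((ι n).edge v) ((ι n).edge w) := by
  simpa only [h.comp_edge] using hc.map (ι (n + 1))

theorem map_ucomm {n : ℕ} {u v : (W n).E}
    (hc : (W (n + 1)).UComm ((s n).edge u) ((s n).edge v)) :
    M.UComm ((ι n).edge u) ((ι n).edge v) := by
  simpa only [h.comp_edge] using hc.map (ι (n + 1))

/-- A union of a saturating chain is saturated. -/
theorem saturates (hs : ∀ n, Saturates (s n)) : Saturates (𝟙 M) where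
  comp u v huv := by
    obtain ⟨n, ⟨u, rfl⟩, v, rfl⟩ := ((h.edge u).and (h.edge v)).exists
    obtain ⟨w, hw⟩ := (hs n).comp u v (h.cod_dom_inj huv)
    have := hw.map (ι (n + 1))
    simp only [h.comp_edge] at this
    exact ⟨_, this⟩
  unitLeft u := by
    obtain ⟨n, u, rfl⟩ := (h.edge u).exists
    have := h.map_comm ((hs n).unitLeft u)
    rwa [(ι n).map_idn, (ι n).map_dom] at this
  unitRight u := by
    obtain ⟨n, u, rfl⟩ := (h.edge u).exists
    have := h.map_comm ((hs n).unitRight u)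
    rwa [(ι n).map_idn, (ι n).map_cod] at this
  assocLeft u v w k l m h₁ h₂ h₃ := by
    obtain ⟨n, ⟨u, rfl⟩, ⟨v, rfl⟩, ⟨w, rfl⟩, ⟨k, rfl⟩, ⟨l, rfl⟩, ⟨m, rfl⟩, h₁, h₂, h₃⟩ :=
      ((h.edge u).and <| (h.edge v).and <| (h.edge w).and <| (h.edge k).and <| (h.edge l).and <|
        (h.edge m).and <| (h.comm h₁).and <| (h.comm h₂).and (h.comm h₃)).exists
    exact h.map_comm ((hs n).assocLeft u v w k l m (h₁ _ _ _ rfl rfl rfl) (h₂ _ _ _ rfl rfl rfl)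
      (h₃ _ _ _ rfl rfl rfl))
  assocRight u v w k l m h₁ h₂ h₃ := by
    obtain ⟨n, ⟨u, rfl⟩, ⟨v, rfl⟩, ⟨w, rfl⟩, ⟨k, rfl⟩, ⟨l, rfl⟩, ⟨m, rfl⟩, h₁, h₂, h₃⟩ :=
      ((h.edge u).and <| (h.edge v).and <| (h.edge w).and <| (h.edge k).and <| (h.edge l).and <|
        (h.edge m).and <| (h.comm h₁).and <| (h.comm h₂).and (h.comm h₃)).exists
    exact h.map_comm ((hs n).assocRight u v w k l m (h₁ _ _ _ rfl rfl rfl) (h₂ _ _ _ rfl rfl rfl)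
      (h₃ _ _ _ rfl rfl rfl))
  pb u v huv := by
    obtain ⟨n, ⟨u, rfl⟩, v, rfl⟩ := ((h.edge u).and (h.edge v)).exists
    obtain ⟨p, q, hw⟩ := (hs n).pb u v (h.cod_inj huv)
    have := hw.map (ι (n + 1))
    simp only [h.comp_edge] at this
    exact ⟨_, _, this⟩
  termFill X T hT := by
    obtain ⟨n, ⟨X, rfl⟩, ⟨T, rfl⟩, hT⟩ := ((h.node X).and <| (h.node T).and (h.term hT)).exists
    obtain ⟨w, h₁, h₂⟩ := (hs n).termFill X T (hT _ rfl)
    exact ⟨(ι (n + 1)).edge w, by rw [← Sketch.Hom.map_dom, h₁, h.comp_node]; rfl,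
      by rw [← Sketch.Hom.map_cod, h₂, h.comp_node]; rfl⟩
  termUniq u v h₁ h₂ h₃ := by
    obtain ⟨n, ⟨u, rfl⟩, ⟨v, rfl⟩, h₁⟩ := ((h.edge u).and <| (h.edge v).and (h.term h₁)).exists
    exact h.map_ucomm ((hs n).termUniq u v (h₁ _ ((ι n).map_cod u)) (h.dom_inj h₂) (h.cod_inj h₃))
  initFill X T hT := by
    obtain ⟨n, ⟨X, rfl⟩, ⟨T, rfl⟩, hT⟩ := ((h.node X).and <| (h.node T).and (h.init0 hT)).exists
    obtain ⟨w, h₁, h₂⟩ := (hs n).initFill X T (hT _ rfl)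
    exact ⟨(ι (n + 1)).edge w, by rw [← Sketch.Hom.map_dom, h₁, h.comp_node]; rfl,
      by rw [← Sketch.Hom.map_cod, h₂, h.comp_node]; rfl⟩
  initUniq u v h₁ h₂ h₃ := by
    obtain ⟨n, ⟨u, rfl⟩, ⟨v, rfl⟩, h₁⟩ := ((h.edge u).and <| (h.edge v).and (h.init0 h₁)).exists
    exact h.map_ucomm ((hs n).initUniq u v (h₁ _ ((ι n).map_dom u)) (h.dom_inj h₂) (h.cod_inj h₃))
  pbFill p₁ p₂ u₁ u₂ v₁ v₂ v h₁ h₂ h₃ := by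
    obtain ⟨n, ⟨p₁, rfl⟩, ⟨p₂, rfl⟩, ⟨u₁, rfl⟩, ⟨u₂, rfl⟩, ⟨v₁, rfl⟩, ⟨v₂, rfl⟩, ⟨v, rfl⟩, h₁, h₂,
      h₃⟩ := ((h.edge p₁).and <| (h.edge p₂).and <| (h.edge u₁).and <| (h.edge u₂).and <|
        (h.edge v₁).and <| (h.edge v₂).and <| (h.edge v).and <| (h.pb h₁).and <|
        (h.comm h₂).and (h.comm h₃)).exists
    obtain ⟨w, h₄, h₅⟩ := (hs n).pbFill p₁ p₂ u₁ u₂ v₁ v₂ v (h₁ _ _ _ _ rfl rfl rfl rfl)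
      (h₂ _ _ _ rfl rfl rfl) (h₃ _ _ _ rfl rfl rfl)
    replace h₄ := h₄.map (ι (n + 1))
    replace h₅ := h₅.map (ι (n + 1))
    simp only [h.comp_edge] at h₄ h₅
    exact ⟨_, h₄, h₅⟩
  pbUniq p₁ p₂ u₁ u₂ v₁ v₂ w w' h₁ h₂ h₃ h₄ h₅ := by
    obtain ⟨n, ⟨p₁, rfl⟩, ⟨p₂, rfl⟩, ⟨u₁, rfl⟩, ⟨u₂, rfl⟩, ⟨v₁, rfl⟩, ⟨v₂, rfl⟩, ⟨w, rfl⟩,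
      ⟨w', rfl⟩, h₁, h₂, h₃, h₄, h₅⟩ := ((h.edge p₁).and <| (h.edge p₂).and <| (h.edge u₁).and <|
        (h.edge u₂).and <| (h.edge v₁).and <| (h.edge v₂).and <| (h.edge w).and <|
        (h.edge w').and <| (h.pb h₁).and <| (h.comm h₂).and <| (h.comm h₃).and <|
        (h.comm h₄).and (h.comm h₅)).exists
    exact h.map_ucomm ((hs n).pbUniq p₁ p₂ u₁ u₂ v₁ v₂ w w' (h₁ _ _ _ _ rfl rfl rfl rfl)
      (h₂ _ _ _ rfl rfl rfl) (h₃ _ _ _ rfl rfl rfl) (h₄ _ _ _ rfl rfl rfl) (h₅ _ _ _ rfl rfl rfl))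
  poFill p₁ p₂ u₁ u₂ v₁ v₂ v h₁ h₂ h₃ := by
    obtain ⟨n, ⟨p₁, rfl⟩, ⟨p₂, rfl⟩, ⟨u₁, rfl⟩, ⟨u₂, rfl⟩, ⟨v₁, rfl⟩, ⟨v₂, rfl⟩, ⟨v, rfl⟩, h₁, h₂,
      h₃⟩ := ((h.edge p₁).and <| (h.edge p₂).and <| (h.edge u₁).and <| (h.edge u₂).and <|
        (h.edge v₁).and <| (h.edge v₂).and <| (h.edge v).and <| (h.po h₁).and <|
        (h.comm h₂).and (h.comm h₃)).exists
    obtain ⟨w, h₄, h₅⟩ := (hs n).poFill p₁ p₂ u₁ u₂ v₁ v₂ v (h₁ _ _ _ _ rfl rfl rfl rfl)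
      (h₂ _ _ _ rfl rfl rfl) (h₃ _ _ _ rfl rfl rfl)
    replace h₄ := h₄.map (ι (n + 1))
    replace h₅ := h₅.map (ι (n + 1))
    simp only [h.comp_edge] at h₄ h₅
    exact ⟨_, h₄, h₅⟩
  poUniq p₁ p₂ u₁ u₂ v₁ v₂ w w' h₁ h₂ h₃ h₄ h₅ := by
    obtain ⟨n, ⟨p₁, rfl⟩, ⟨p₂, rfl⟩, ⟨u₁, rfl⟩, ⟨u₂, rfl⟩, ⟨v₁, rfl⟩, ⟨v₂, rfl⟩, ⟨w, rfl⟩,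
      ⟨w', rfl⟩, h₁, h₂, h₃, h₄, h₅⟩ := ((h.edge p₁).and <| (h.edge p₂).and <| (h.edge u₁).and <|
        (h.edge u₂).and <| (h.edge v₁).and <| (h.edge v₂).and <| (h.edge w).and <|
        (h.edge w').and <| (h.po h₁).and <| (h.comm h₂).and <| (h.comm h₃).and <|
        (h.comm h₄).and (h.comm h₅)).exists
    exact h.map_ucomm ((hs n).poUniq p₁ p₂ u₁ u₂ v₁ v₂ w w' (h₁ _ _ _ _ rfl rfl rfl rfl)
      (h₂ _ _ _ rfl rfl rfl) (h₃ _ _ _ rfl rfl rfl) (h₄ _ _ _ rfl rfl rfl) (h₅ _ _ _ rfl rfl rfl))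
  recFill p₁ p₂ ε k q₁ q₂ π₁ π₂ s₁ s₂ z₁ z₂ y g i κ a hr := by
    obtain ⟨n, ⟨p₁, rfl⟩, ⟨p₂, rfl⟩, ⟨ε, rfl⟩, ⟨k, rfl⟩, ⟨q₁, rfl⟩, ⟨q₂, rfl⟩, ⟨π₁, rfl⟩,
      ⟨π₂, rfl⟩, ⟨s₁, rfl⟩, ⟨s₂, rfl⟩, ⟨z₁, rfl⟩, ⟨z₂, rfl⟩, ⟨y, rfl⟩, ⟨g, rfl⟩, ⟨i, rfl⟩, ⟨κ, rfl⟩,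
      ⟨a, rfl⟩, hr⟩ := ((h.edge p₁).and <| (h.edge p₂).and <| (h.edge ε).and <| (h.edge k).and <|
        (h.edge q₁).and <| (h.edge q₂).and <| (h.edge π₁).and <| (h.edge π₂).and <|
        (h.edge s₁).and <| (h.edge s₂).and <| (h.edge z₁).and <| (h.edge z₂).and <|
        (h.edge y).and <| (h.edge g).and <| (h.edge i).and <| (h.edge κ).and <| (h.edge a).and <|
        h.recData hr).exists
    obtain ⟨_, _, _, _, _, h₄⟩ := (hs n).recFill _ _ _ _ _ _ _ _ _ _ _ _ _ _ _ _ _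
      (hr p₁ p₂ ε k q₁ q₂ π₁ π₂ s₁ s₂ z₁ z₂ y g i κ a
      rfl rfl rfl rfl rfl rfl rfl rfl rfl rfl rfl rfl rfl rfl rfl rfl rfl)
    replace h₄ := h₄.map (ι (n + 1))
    simp only [h.comp_edge] at h₄
    exact ⟨_, _, _, _, _, h₄⟩
  recUniq p₁ p₂ ε k q₁ q₂ π₁ π₂ s₁ s₂ z₁ z₂ y g i κ a hr r₁ r₂ h₁ h₂ := by
    obtain ⟨_, _, _, _, h₁⟩ := h₁
    obtain ⟨_, _, _, _, h₂⟩ := h₂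
    obtain ⟨n, ⟨p₁, rfl⟩, ⟨p₂, rfl⟩, ⟨ε, rfl⟩, ⟨k, rfl⟩, ⟨q₁, rfl⟩, ⟨q₂, rfl⟩, ⟨π₁, rfl⟩,
      ⟨π₂, rfl⟩, ⟨s₁, rfl⟩, ⟨s₂, rfl⟩, ⟨z₁, rfl⟩, ⟨z₂, rfl⟩, ⟨y, rfl⟩, ⟨g, rfl⟩, ⟨i, rfl⟩, ⟨κ, rfl⟩,
      ⟨a, rfl⟩, ⟨r₁, rfl⟩, ⟨r₂, rfl⟩, hr, h₁, h₂⟩ := ((h.edge p₁).and <| (h.edge p₂).and <|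
        (h.edge ε).and <| (h.edge k).and <| (h.edge q₁).and <| (h.edge q₂).and <|
        (h.edge π₁).and <| (h.edge π₂).and <| (h.edge s₁).and <| (h.edge s₂).and <|
        (h.edge z₁).and <| (h.edge z₂).and <| (h.edge y).and <| (h.edge g).and <|
        (h.edge i).and <| (h.edge κ).and <| (h.edge a).and <| (h.edge r₁).and <|
        (h.edge r₂).and <| (h.recData hr).and <| (h.recSol h₁).and <| h.recSol h₂).exists
    exact h.map_ucomm ((hs n).recUniq _ _ _ _ _ _ _ _ _ _ _ _ _ _ _ _ _
      (hr p₁ p₂ ε k q₁ q₂ π₁ π₂ s₁ s₂ z₁ z₂ y g i κ a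
        rfl rfl rfl rfl rfl rfl rfl rfl rfl rfl rfl rfl rfl rfl rfl rfl rfl) r₁ r₂
      (h₁ _ _ _ _ _ _ _ _ _ _ rfl rfl rfl rfl rfl rfl rfl rfl rfl rfl)
      (h₂ _ _ _ _ _ _ _ _ _ _ rfl rfl rfl rfl rfl rfl rfl rfl rfl rfl))

end IsUnion

/-! ### The saturation of a context. -/

/-- A sketch in which all instances of the rules for composition, pullbacks, and fillins are
realized. -/
class Saturated (M : Sketch) : Prop where
  saturates : Saturates (𝟙 M)

theorem Context.exists_saturates (S : Context) :
    ∃ (T : Context) (e : S.sk ⟶ T.sk), IsEquivExt e ∧ Saturates e := by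
  obtain ⟨_, _⟩ := S.finite
  obtain ⟨V, e, he, hs⟩ := AUSketch.exists_saturates S.sk
  exact ⟨S.ofEquivExt e he, e, he, hs⟩

/-- Iterated saturation of a context. -/
noncomputable def Context.chain (S : Context) : ℕ → Context
  | 0 => S
  | n + 1 => (S.chain n).exists_saturates.choose

/-- The steps of iterated saturation. -/
noncomputable def Context.chainStep (S : Context) (n : ℕ) : (S.chain n).sk ⟶ (S.chain (n + 1)).sk :=
  (S.chain n).exists_saturates.choose_spec.choose

/-- The homomorphism from a context to a stage of its iterated saturation. -/
noncomputable def Context.chainMap (S : Context) : ∀ n, S.sk ⟶ (S.chain n).sk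
  | 0 => 𝟙 S.sk
  | n + 1 => S.chainMap n ≫ S.chainStep n

theorem Context.isEquivExt_chainMap (S : Context) (n : ℕ) : IsEquivExt (S.chainMap n) := by
  induction n with
  | zero => exact .iso _ (inferInstanceAs (IsIso (𝟙 S.sk)))
  | succ n ih => exact .comp _ _ ih (S.chain n).exists_saturates.choose_spec.choose_spec.1

/-- Every context maps to a saturated sketch, in such a way that the object equalities that hold in
the latter hold in equivalence extensions of the former. -/
theorem Context.exists_saturation (S : Context) :
    ∃ (M : Sketch) (ι : S.sk ⟶ M), Saturated M ∧ Function.Injective M.subject ∧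
      ∀ (T : Context) (f g : T.sk ⟶ S.sk), ObjectEquality (f ≫ ι) (g ≫ ι) →
        ∃ (W : Sketch) (e : S.sk ⟶ W), IsEquivExt e ∧ ObjectEquality (f ≫ e) (g ≫ e) := by
  let W := fun n => (S.chain n).sk
  let s : ∀ n, W n ⟶ W (n + 1) := S.chainStep
  have hs : ∀ n, IsEquivExt (s n) ∧ Saturates (s n) := fun n =>
    (S.chain n).exists_saturates.choose_spec.choose_spec
  have h := isUnion_seqColimit W s fun n => (hs n).1.isExt.inj
  refine ⟨seqColimit W s, seqColimitι W s 0, ⟨h.saturates fun n => (hs n).2⟩,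
    h.subject_injective fun n => (S.chain n).subject_injective, fun T f g ho => ?_⟩
  obtain ⟨_, _⟩ := T.finite
  -- The homomorphism from `S` to the union factors through every stage, so that `objectEquality`
  -- applies to the maps `f ≫ S.chainMap n` and `g ≫ S.chainMap n`.
  have hc : ∀ n, S.chainMap n ≫ seqColimitι W s n = seqColimitι W s 0 := fun n => by
    induction n with
    | zero => exact Category.id_comp _
    | succ n ih => rw [← ih, ← h.comp n]; exact Category.assoc _ _ _
  obtain ⟨n, hn⟩ := h.objectEquality (f := fun n => f ≫ S.chainMap n)
    (g := fun n => g ≫ S.chainMap n) (fun n => by rw [Category.assoc, hc])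
    (fun n => by rw [Category.assoc, hc]) ho
  exact ⟨_, S.chainMap n, S.isEquivExt_chainMap n, hn⟩

end AUSketch

namespace AUSketch

/-! ### List objects in a category -/

section ListObject

variable {C : Type*} [Category C]

/-- `p₁` and `p₂` are the projections of a product. -/
structure IsProd {P A B : C} (p₁ : P ⟶ A) (p₂ : P ⟶ B) : Prop where
  lift : ∀ {X : C} (a : X ⟶ A) (b : X ⟶ B), ∃ c, c ≫ p₁ = a ∧ c ≫ p₂ = b
  ext : ∀ {X : C} {c d : X ⟶ P}, c ≫ p₁ = d ≫ p₁ → c ≫ p₂ = d ≫ p₂ → c = d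

/-- `T` is terminal. -/
structure IsFinal (T : C) : Prop where
  exists_hom : ∀ X : C, Nonempty (X ⟶ T)
  ext : ∀ {X : C} (a b : X ⟶ T), a = b

/-- `ε : T ⟶ L` and `k : A × L ⟶ L` make `L` a list object on `A`. -/
structure IsListObject {A L P T : C} (p₁ : P ⟶ A) (p₂ : P ⟶ L) (ε : T ⟶ L) (k : P ⟶ L) : Prop where
  final : IsFinal T
  prod : IsProd p₁ p₂
  -- Recursion without a parameter object, stated for one product of `A` and `Y`, whose existence is
  -- part of the condition.
  fold : ∀ Y : C, ∃ (Z : C) (z₁ : Z ⟶ A) (z₂ : Z ⟶ Y), IsProd z₁ z₂ ∧ ∀ (y : T ⟶ Y) (g : Z ⟶ Y),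
    ∃! r : L ⟶ Y, ε ≫ r = y ∧ ∃ r', r' ≫ z₁ = p₁ ∧ r' ≫ z₂ = p₂ ≫ r ∧ k ≫ r = r' ≫ g

/-- `b` is the map of list objects induced by a map of the objects of entries. -/
structure IsListMap {A L P T A' L' P' T' : C} (p₁ : P ⟶ A) (p₂ : P ⟶ L) (ε : T ⟶ L) (k : P ⟶ L)
    (p₁' : P' ⟶ A') (p₂' : P' ⟶ L') (ε' : T' ⟶ L') (k' : P' ⟶ L') (a : A ⟶ A') (b : L ⟶ L')
    (t : T ⟶ T') (p : P ⟶ P') : Prop where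
  nil : ε ≫ b = t ≫ ε'
  fst : p ≫ p₁' = p₁ ≫ a
  snd : p ≫ p₂' = p₂ ≫ b
  cons : k ≫ b = p ≫ k'

variable {A L P T A' L' P' T' A'' L'' P'' T'' : C}
  {p₁ : P ⟶ A} {p₂ : P ⟶ L} {ε : T ⟶ L} {k : P ⟶ L}
  {p₁' : P' ⟶ A'} {p₂' : P' ⟶ L'} {ε' : T' ⟶ L'} {k' : P' ⟶ L'}
  {p₁'' : P'' ⟶ A''} {p₂'' : P'' ⟶ L''} {ε'' : T'' ⟶ L''} {k'' : P'' ⟶ L''}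

/-- Recursion into `L'`, with step the composite `A × L' ⟶ A' × L' ⟶ L'` of the map induced by `a`
with `k'`. -/
theorem IsListObject.exists_isListMap (h : IsListObject p₁ p₂ ε k)
    (h' : IsListObject p₁' p₂' ε' k') (a : A ⟶ A') :
    ∃ b t p, IsListMap p₁ p₂ ε k p₁' p₂' ε' k' a b t p := by
  obtain ⟨t⟩ := h'.final.exists_hom T
  obtain ⟨Z, z₁, z₂, hz, hf⟩ := h.fold L'
  obtain ⟨ζ, hζ₁, hζ₂⟩ := h'.prod.lift (z₁ ≫ a) z₂
  obtain ⟨b, ⟨hb, r', h₁, h₂, h₃⟩, -⟩ := hf (t ≫ ε') (ζ ≫ k')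
  refine ⟨b, t, r' ≫ ζ, hb, ?_, ?_, ?_⟩
  · rw [Category.assoc, hζ₁, reassoc_of% h₁]
  · rw [Category.assoc, hζ₂, h₂]
  · rw [h₃, Category.assoc]

/-- A list map over `a` solves the recursion of `exists_isListMap`; its auxiliary maps are forced by
the terminal object and the product on the target side. -/
theorem IsListObject.isListMap_unique (h : IsListObject p₁ p₂ ε k)
    (h' : IsListObject p₁' p₂' ε' k') {a : A ⟶ A'} {b₁ b₂ t₁ t₂ q₁ q₂}
    (h₁ : IsListMap p₁ p₂ ε k p₁' p₂' ε' k' a b₁ t₁ q₁)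
    (h₂ : IsListMap p₁ p₂ ε k p₁' p₂' ε' k' a b₂ t₂ q₂) : b₁ = b₂ := by
  obtain ⟨Z, z₁, z₂, hz, hf⟩ := h.fold L'
  obtain ⟨ζ, hζ₁, hζ₂⟩ := h'.prod.lift (z₁ ≫ a) z₂
  have key : ∀ {b t q}, IsListMap p₁ p₂ ε k p₁' p₂' ε' k' a b t q → ε ≫ b = t₁ ≫ ε' ∧
      ∃ r', r' ≫ z₁ = p₁ ∧ r' ≫ z₂ = p₂ ≫ b ∧ k ≫ b = r' ≫ ζ ≫ k' := by
    intro b t q hb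
    obtain ⟨r', e₁, e₂⟩ := hz.lift p₁ (p₂ ≫ b)
    refine ⟨by rw [hb.nil, h'.final.ext t t₁], r', e₁, e₂, ?_⟩
    have : r' ≫ ζ = q := h'.prod.ext (by rw [Category.assoc, hζ₁, reassoc_of% e₁, hb.fst])
      (by rw [Category.assoc, hζ₂, e₂, hb.snd])
    rw [reassoc_of% this, hb.cons]
  exact (hf (t₁ ≫ ε') (ζ ≫ k')).unique (key h₁) (key h₂)

theorem IsListMap.comp {a : A ⟶ A'} {b t p} {a' : A' ⟶ A''} {b' t' p'}
    (h : IsListMap p₁ p₂ ε k p₁' p₂' ε' k' a b t p)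
    (h' : IsListMap p₁' p₂' ε' k' p₁'' p₂'' ε'' k'' a' b' t' p') :
    IsListMap p₁ p₂ ε k p₁'' p₂'' ε'' k'' (a ≫ a') (b ≫ b') (t ≫ t') (p ≫ p') where
  nil := by rw [reassoc_of% h.nil, h'.nil, Category.assoc]
  fst := by rw [Category.assoc, h'.fst, reassoc_of% h.fst]
  snd := by rw [Category.assoc, h'.snd, reassoc_of% h.snd]
  cons := by rw [reassoc_of% h.cons, h'.cons, Category.assoc]

theorem isListMap_id : IsListMap p₁ p₂ ε k p₁ p₂ ε k (𝟙 A) (𝟙 L) (𝟙 T) (𝟙 P) := by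
  constructor <;> simp

/-- List maps over `a` and over its inverse compose to list maps over identities, which are
identities by uniqueness. -/
theorem IsListObject.exists_inv (h : IsListObject p₁ p₂ ε k)
    (h' : IsListObject p₁' p₂' ε' k') {a : A ⟶ A'} [IsIso a] {b t p}
    (hb : IsListMap p₁ p₂ ε k p₁' p₂' ε' k' a b t p) :
    ∃ b' t' p', IsListMap p₁' p₂' ε' k' p₁ p₂ ε k (inv a) b' t' p' ∧ b ≫ b' = 𝟙 L ∧
      b' ≫ b = 𝟙 L' := by
  obtain ⟨b', t', p', hb'⟩ := h'.exists_isListMap h (inv a)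
  refine ⟨b', t', p', hb', ?_, ?_⟩
  · have := hb.comp hb'
    rw [IsIso.hom_inv_id] at this
    exact h.isListMap_unique h this isListMap_id
  · have := hb'.comp hb
    rw [IsIso.inv_hom_id] at this
    exact h'.isListMap_unique h' this isListMap_id

/-! ### Recursion with and without parameters. -/

/-- Recursion with a terminal parameter gives recursion without parameters. -/
theorem exists_fold_of_rec {LT PT ALT Z Y : C} (hT : IsFinal T)
    {q₁ : LT ⟶ L} {q₂ : LT ⟶ T} (hq : IsProd q₁ q₂) {π₁ : PT ⟶ P} {π₂ : PT ⟶ T}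
    (hπ : IsProd π₁ π₂) {s₁ : ALT ⟶ A} {s₂ : ALT ⟶ LT}
    {z₁ : Z ⟶ A} {z₂ : Z ⟶ Y} {i : T ⟶ LT} (hi : i ≫ q₁ = ε)
    {κ : PT ⟶ LT} (hκ : κ ≫ q₁ = π₁ ≫ k) {a : PT ⟶ ALT} (ha₁ : a ≫ s₁ = π₁ ≫ p₁)
    (ha₂ : a ≫ s₂ ≫ q₁ = π₁ ≫ p₂) {y : T ⟶ Y} {g : Z ⟶ Y} {r : LT ⟶ Y} {r' : ALT ⟶ Z}
    (h₁ : i ≫ r = y) (h₂ : κ ≫ r = a ≫ r' ≫ g) (h₃ : r' ≫ z₁ = s₁) (h₄ : r' ≫ z₂ = s₂ ≫ r) :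
    ∃ r : L ⟶ Y, ε ≫ r = y ∧ ∃ r', r' ≫ z₁ = p₁ ∧ r' ≫ z₂ = p₂ ≫ r ∧ k ≫ r = r' ≫ g := by
  obtain ⟨t⟩ := hT.exists_hom L
  obtain ⟨t'⟩ := hT.exists_hom P
  -- `c` and `c'` are sections of the projections `L × T ⟶ L` and `P × T ⟶ P`. Because `T` is
  -- terminal, they intertwine `ε`, `k` and `p₂` with `i`, `κ` and `a ≫ s₂`.
  obtain ⟨c, hc, -⟩ := hq.lift (𝟙 L) t
  obtain ⟨c', hc', -⟩ := hπ.lift (𝟙 P) t'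
  have e₁ : ε ≫ c = i := hq.ext (by rw [Category.assoc, hc, Category.comp_id, hi]) (hT.ext _ _)
  have e₂ : k ≫ c = c' ≫ κ := hq.ext (by
    rw [Category.assoc, hc, Category.comp_id, Category.assoc, hκ, reassoc_of% hc']) (hT.ext _ _)
  have e₃ : c' ≫ a ≫ s₂ = p₂ ≫ c := hq.ext (by
    simp only [Category.assoc]
    rw [hc, Category.comp_id, ha₂, reassoc_of% hc']) (hT.ext _ _)
  refine ⟨c ≫ r, by rw [reassoc_of% e₁, h₁], c' ≫ a ≫ r', ?_, ?_, ?_⟩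
  · rw [Category.assoc, Category.assoc, h₃, ha₁, reassoc_of% hc']
  · rw [Category.assoc, Category.assoc, h₄, ← reassoc_of% e₃]
  · rw [reassoc_of% e₂, h₂]
    simp only [Category.assoc]

/-- Composing a fold with the projection `q₁` solves the equations with parameter. Through this,
uniqueness of parametrized recursion yields uniqueness of folds. -/
theorem exists_rec_of_fold {LT PT ALT Z Y : C}
    {q₁ : LT ⟶ L} {π₁ : PT ⟶ P} {s₁ : ALT ⟶ A} {s₂ : ALT ⟶ LT}
    {z₁ : Z ⟶ A} {z₂ : Z ⟶ Y} (hz : IsProd z₁ z₂) {i : T ⟶ LT} (hi : i ≫ q₁ = ε)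
    {κ : PT ⟶ LT} (hκ : κ ≫ q₁ = π₁ ≫ k) {a : PT ⟶ ALT} (ha₁ : a ≫ s₁ = π₁ ≫ p₁)
    (ha₂ : a ≫ s₂ ≫ q₁ = π₁ ≫ p₂) {y : T ⟶ Y} {g : Z ⟶ Y} {r : L ⟶ Y}
    (hr : ε ≫ r = y ∧ ∃ r', r' ≫ z₁ = p₁ ∧ r' ≫ z₂ = p₂ ≫ r ∧ k ≫ r = r' ≫ g) :
    i ≫ q₁ ≫ r = y ∧ ∃ r', κ ≫ q₁ ≫ r = a ≫ r' ≫ g ∧ r' ≫ z₁ = s₁ ∧ r' ≫ z₂ = s₂ ≫ q₁ ≫ r := by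
  obtain ⟨h₁, ρ, h₂, h₃, h₄⟩ := hr
  obtain ⟨r', e₁, e₂⟩ := hz.lift s₁ (s₂ ≫ q₁ ≫ r)
  have : a ≫ r' = π₁ ≫ ρ := hz.ext (by rw [Category.assoc, e₁, ha₁, Category.assoc, h₂]) (by
    rw [Category.assoc, e₂, Category.assoc, h₃, ← reassoc_of% ha₂])
  refine ⟨by rw [reassoc_of% hi, h₁], r', ?_, e₁, e₂⟩
  rw [reassoc_of% hκ, h₄, reassoc_of% this]

end ListObject

/-! ### The category presented by a saturated sketch -/

namespace Sketch

variable {M : Sketch} [Saturated M]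

theorem comm_unitLeft (u : M.E) : M.Comm (M.idn (M.dom u)) u u := Saturated.saturates.unitLeft u

theorem comm_unitRight (u : M.E) : M.Comm u (M.idn (M.cod u)) u := Saturated.saturates.unitRight u

theorem exists_comm {u v : M.E} (h : M.cod u = M.dom v) : ∃ w, M.Comm u v w :=
  Saturated.saturates.comp u v h

theorem comm_assocLeft {u v w k l m : M.E} (h₁ : M.Comm u v k) (h₂ : M.Comm v w l)
    (h₃ : M.Comm u l m) : M.Comm k w m :=
  Saturated.saturates.assocLeft u v w k l m h₁ h₂ h₃

theorem comm_assocRight {u v w k l m : M.E} (h₁ : M.Comm u v k) (h₂ : M.Comm v w l)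
    (h₃ : M.Comm k w m) : M.Comm u l m :=
  Saturated.saturates.assocRight u v w k l m h₁ h₂ h₃

theorem UComm.refl (u : M.E) : M.UComm u u := comm_unitLeft u

/-- Associativity for `id`, `u`, `v`. Composites are therefore unique up to unary commutativity,
which makes the latter the right equality of morphisms. -/
theorem Comm.unique {u v w w' : M.E} (h : M.Comm u v w) (h' : M.Comm u v w') : M.UComm w w' := by
  rw [UComm, h.dom_eq]
  exact comm_assocRight (comm_unitLeft u) h h'

omit [Saturated M] in
theorem UComm.dom_eq {u u' : M.E} (h : M.UComm u u') : M.dom u' = M.dom u :=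
  (Comm.dom_eq h).trans (M.dom_idn _)

theorem UComm.symm {u u' : M.E} (h : M.UComm u u') : M.UComm u' u :=
  Comm.unique h (comm_unitLeft u)

theorem UComm.trans {u v w : M.E} (h : M.UComm u v) (h' : M.UComm v w) : M.UComm u w := by
  rw [UComm, h.dom_eq] at h'
  have := comm_unitLeft (M.idn (M.dom u))
  rw [M.dom_idn] at this
  exact comm_assocLeft this h h'

/-- Associativity with an identity edge in one position. With `congr_right` and `congr_comp`, a
triangle is invariant under unary commutativity of each of its edges, so composition descends to
classes. -/
theorem Comm.congr_left {u u' v w : M.E} (h : M.Comm u v w) (h' : M.UComm u u') :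
    M.Comm u' v w := by
  refine comm_assocLeft h' h ?_
  rw [← h.dom_eq]
  exact comm_unitLeft w

theorem Comm.congr_right {u v v' w : M.E} (h : M.Comm u v w) (h' : M.UComm v v') :
    M.Comm u v' w := by
  rw [UComm, ← h.cod_left] at h'
  exact comm_assocRight (comm_unitRight u) h' h

theorem Comm.congr_comp {u v w w' : M.E} (h : M.Comm u v w) (h' : M.UComm w w') :
    M.Comm u v w' := by
  rw [UComm, h.dom_eq] at h'
  exact comm_assocLeft (comm_unitLeft u) h h'

/-- The objects of the category presented by a sketch. -/
structure Obj (M : Sketch) where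
  of ::
  node : M.N

/-- The edges between two nodes. -/
def Arrow (M : Sketch) (X Y : M.N) : Type := {u : M.E // M.dom u = X ∧ M.cod u = Y}

instance arrowSetoid (X Y : M.N) : Setoid (M.Arrow X Y) where
  r u v := M.UComm u.1 v.1
  iseqv := ⟨fun u => .refl u.1, fun h => h.symm, fun h h' => h.trans h'⟩

/-- A composite of edges. -/
noncomputable def Arrow.comp {X Y Z : M.N} (u : M.Arrow X Y) (v : M.Arrow Y Z) : M.Arrow X Z :=
  have h := exists_comm (u.2.2.trans v.2.1.symm)
  ⟨h.choose, h.choose_spec.dom_eq.trans u.2.1, h.choose_spec.cod_eq.trans v.2.2⟩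

theorem Arrow.comm_comp {X Y Z : M.N} (u : M.Arrow X Y) (v : M.Arrow Y Z) :
    M.Comm u.1 v.1 (u.comp v).1 :=
  (exists_comm (u.2.2.trans v.2.1.symm)).choose_spec

/-- The category presented by a saturated sketch: edges modulo unary commutativities. -/
noncomputable instance : Category M.Obj where
  Hom X Y := Quotient (arrowSetoid X.node Y.node)
  id X := Quotient.mk _ ⟨M.idn X.node, M.dom_idn _, M.cod_idn _⟩
  comp a b := Quotient.map₂ Arrow.comp (fun u u' h v v' h' =>
    (((u.comm_comp v).congr_left h).congr_right h').unique (u'.comm_comp v')) a b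
  id_comp a := by
    induction a using Quotient.ind with | _ u
    refine Quotient.sound (Comm.unique (Arrow.comm_comp _ _) ?_)
    have := comm_unitLeft u.1
    rwa [u.2.1] at this
  comp_id a := by
    induction a using Quotient.ind with | _ u
    refine Quotient.sound (Comm.unique (Arrow.comm_comp _ _) ?_)
    have := comm_unitRight u.1
    rwa [u.2.2] at this
  assoc a b c := by
    induction a using Quotient.ind with | _ u
    induction b using Quotient.ind with | _ v
    induction c using Quotient.ind with | _ w
    exact Quotient.sound ((Arrow.comm_comp _ _).unique
      (comm_assocLeft (u.comm_comp v) (v.comm_comp w) (Arrow.comm_comp _ _)))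

/-- The morphism given by an edge. -/
def mor {X Y : M.N} (u : M.E) (hX : M.dom u = X) (hY : M.cod u = Y) : Obj.of X ⟶ Obj.of Y :=
  Quotient.mk (arrowSetoid X Y) ⟨u, hX, hY⟩

theorem exists_mor {X Y : M.N} (a : Obj.of X ⟶ Obj.of Y) :
    ∃ (u : M.E) (hX : M.dom u = X) (hY : M.cod u = Y), mor u hX hY = a := by
  induction a using Quotient.ind with | _ u
  exact ⟨u.1, u.2.1, u.2.2, rfl⟩

theorem mor_eq_iff {X Y : M.N} {u v : M.E} {hX : M.dom u = X} {hY : M.cod u = Y}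
    {hX' : M.dom v = X} {hY' : M.cod v = Y} : mor u hX hY = mor v hX' hY' ↔ M.UComm u v :=
  Quotient.eq (r := arrowSetoid X Y)

/-- The dictionary between equations in the category and commutativities of the sketch; it is exact
in both directions. -/
theorem mor_comp_eq_iff {X Y Z : M.N} {u v w : M.E} {hX : M.dom u = X} {hY : M.cod u = Y}
    {hY' : M.dom v = Y} {hZ : M.cod v = Z} {hX' : M.dom w = X} {hZ' : M.cod w = Z} :
    mor u hX hY ≫ mor v hY' hZ = mor w hX' hZ' ↔ M.Comm u v w := by
  have h := Arrow.comm_comp (⟨u, hX, hY⟩ : M.Arrow X Y) (⟨v, hY', hZ⟩ : M.Arrow Y Z)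
  exact Iff.trans (Quotient.eq (r := arrowSetoid X Z))
    ⟨fun h' => h.congr_comp h', fun h' => h.unique h'⟩

theorem Comm.mor_comp {X Y Z : M.N} {u v w : M.E} (h : M.Comm u v w) {hX : M.dom u = X}
    {hY : M.cod u = Y} {hY' : M.dom v = Y} {hZ : M.cod v = Z} {hX' : M.dom w = X}
    {hZ' : M.cod w = Z} : mor u hX hY ≫ mor v hY' hZ = mor w hX' hZ' :=
  mor_comp_eq_iff.2 h

theorem mor_idn (X : M.N) : mor (M.idn X) (M.dom_idn X) (M.cod_idn X) = 𝟙 (Obj.of X) := rfl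

/-- Edges with commuting composites. -/
theorem exists_comm_of_eq {X Y Y' Z : M.N} {u v u' v' : M.E} {h₁ : M.dom u = X} {h₂ : M.cod u = Y}
    {h₃ : M.dom v = Y} {h₄ : M.cod v = Z} {h₅ : M.dom u' = X} {h₆ : M.cod u' = Y'}
    {h₇ : M.dom v' = Y'} {h₈ : M.cod v' = Z}
    (h : mor u h₁ h₂ ≫ mor v h₃ h₄ = mor u' h₅ h₆ ≫ mor v' h₇ h₈) :
    ∃ w, M.Comm u v w ∧ M.Comm u' v' w := by
  obtain ⟨w, hX, hZ, hw⟩ := exists_mor (mor u h₁ h₂ ≫ mor v h₃ h₄)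
  exact ⟨w, mor_comp_eq_iff.1 hw.symm, mor_comp_eq_iff.1 (h.symm.trans hw.symm)⟩

/-! ### Universals of a saturated sketch as limits, colimits and list objects. -/

theorem isFinal {T : M.N} (h : M.Term T) : IsFinal (Obj.of T) where
  exists_hom X := by
    obtain ⟨w, h₁, h₂⟩ := Saturated.saturates.termFill X.node T h
    exact ⟨mor w h₁ h₂⟩
  ext {X} a b := by
    obtain ⟨u, hX, hY, rfl⟩ := exists_mor (X := X.node) a
    obtain ⟨v, hX', hY', rfl⟩ := exists_mor (X := X.node) b
    exact mor_eq_iff.2 (Saturated.saturates.termUniq u v (hY ▸ h) (hX.trans hX'.symm)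
      (hY.trans hY'.symm))

theorem exists_hom_of_init0 {T : M.N} (h : M.Init0 T) (X : M.Obj) : Nonempty (Obj.of T ⟶ X) := by
  obtain ⟨w, h₁, h₂⟩ := Saturated.saturates.initFill X.node T h
  exact ⟨mor w h₁ h₂⟩

theorem init0_hom_ext {T : M.N} (h : M.Init0 T) {X : M.Obj} (a b : Obj.of T ⟶ X) : a = b := by
  obtain ⟨u, hX, hY, rfl⟩ := exists_mor (Y := X.node) a
  obtain ⟨v, hX', hY', rfl⟩ := exists_mor (Y := X.node) b
  exact mor_eq_iff.2 (Saturated.saturates.initUniq u v (hX ▸ h) (hX.trans hX'.symm)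
    (hY.trans hY'.symm))

/-- The fillin rules are the universal property on the level of edges; every cone is represented by
edges, with its condition represented by a common diagonal. -/
theorem Pb.isPullback {P A B C : M.N} {p₁ p₂ u₁ u₂ : M.E} (h : M.Pb p₁ p₂ u₁ u₂)
    {h₁ : M.dom p₁ = P} {h₂ : M.cod p₁ = A} {h₃ : M.dom p₂ = P} {h₄ : M.cod p₂ = B}
    {h₅ : M.dom u₁ = A} {h₆ : M.cod u₁ = C} {h₇ : M.dom u₂ = B} {h₈ : M.cod u₂ = C} :
    IsPullback (mor p₁ h₁ h₂) (mor p₂ h₃ h₄) (mor u₁ h₅ h₆) (mor u₂ h₇ h₈) := by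
  have comm : mor p₁ h₁ h₂ ≫ mor u₁ h₅ h₆ = mor p₂ h₃ h₄ ≫ mor u₂ h₇ h₈ := by
    obtain ⟨p, e₁, e₂⟩ := h.comm
    rw [e₁.mor_comp (hX' := e₁.dom_eq.trans h₁) (hZ' := e₁.cod_eq.trans h₆), e₂.mor_comp]
  have lift : ∀ s : Limits.PullbackCone (mor u₁ h₅ h₆) (mor u₂ h₇ h₈),
      ∃ c, c ≫ mor p₁ h₁ h₂ = s.fst ∧ c ≫ mor p₂ h₃ h₄ = s.snd := by
    intro s
    obtain ⟨v₁, a₁, a₂, e₁⟩ := exists_mor (X := s.pt.node) s.fst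
    obtain ⟨v₂, a₃, a₄, e₂⟩ := exists_mor (X := s.pt.node) s.snd
    have hs := s.condition
    rw [← e₁, ← e₂] at hs ⊢
    obtain ⟨v, c₁, c₂⟩ := exists_comm_of_eq hs
    obtain ⟨w, d₁, d₂⟩ := Saturated.saturates.pbFill p₁ p₂ u₁ u₂ v₁ v₂ v h c₁ c₂
    exact ⟨mor w (d₁.dom_eq.symm.trans a₁) (d₁.cod_left.trans h₁), d₁.mor_comp, d₂.mor_comp⟩
  refine ⟨⟨comm⟩, ⟨Limits.PullbackCone.IsLimit.mk comm (fun s => (lift s).choose)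
    (fun s => (lift s).choose_spec.1) (fun s => (lift s).choose_spec.2) fun s m hm₁ hm₂ => ?_⟩⟩
  -- Only the composites of the chosen lift with the projections matter. Replacing it by a variable
  -- allows it to be represented by an edge.
  generalize hc : (lift s).choose = c
  have hc₁ := (lift s).choose_spec.1
  have hc₂ := (lift s).choose_spec.2
  rw [hc] at hc₁ hc₂
  obtain ⟨v₁, a₁, a₂, e₁⟩ := exists_mor (X := s.pt.node) s.fst
  obtain ⟨v₂, a₃, a₄, e₂⟩ := exists_mor (X := s.pt.node) s.snd
  obtain ⟨w, b₁, b₂, rfl⟩ := exists_mor (X := s.pt.node) m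
  obtain ⟨w', b₃, b₄, rfl⟩ := exists_mor (X := s.pt.node) c
  rw [← e₁] at hm₁ hc₁
  rw [← e₂] at hm₂ hc₂
  exact mor_eq_iff.2 (Saturated.saturates.pbUniq p₁ p₂ u₁ u₂ v₁ v₂ w w' h (mor_comp_eq_iff.1 hm₁)
    (mor_comp_eq_iff.1 hm₂) (mor_comp_eq_iff.1 hc₁) (mor_comp_eq_iff.1 hc₂))

theorem Po.isPushout {Q A B C : M.N} {q₁ q₂ u₁ u₂ : M.E} (h : M.Po q₁ q₂ u₁ u₂)
    {h₁ : M.dom q₁ = A} {h₂ : M.cod q₁ = Q} {h₃ : M.dom q₂ = B} {h₄ : M.cod q₂ = Q}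
    {h₅ : M.dom u₁ = C} {h₆ : M.cod u₁ = A} {h₇ : M.dom u₂ = C} {h₈ : M.cod u₂ = B} :
    IsPushout (mor u₁ h₅ h₆) (mor u₂ h₇ h₈) (mor q₁ h₁ h₂) (mor q₂ h₃ h₄) := by
  have comm : mor u₁ h₅ h₆ ≫ mor q₁ h₁ h₂ = mor u₂ h₇ h₈ ≫ mor q₂ h₃ h₄ := by
    obtain ⟨p, e₁, e₂⟩ := h.comm
    rw [e₁.mor_comp (hX' := e₁.dom_eq.trans h₅) (hZ' := e₁.cod_eq.trans h₂), e₂.mor_comp]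
  have lift : ∀ s : Limits.PushoutCocone (mor u₁ h₅ h₆) (mor u₂ h₇ h₈),
      ∃ c, mor q₁ h₁ h₂ ≫ c = s.inl ∧ mor q₂ h₃ h₄ ≫ c = s.inr := by
    intro s
    obtain ⟨v₁, a₁, a₂, e₁⟩ := exists_mor (Y := s.pt.node) s.inl
    obtain ⟨v₂, a₃, a₄, e₂⟩ := exists_mor (Y := s.pt.node) s.inr
    have hs := s.condition
    rw [← e₁, ← e₂] at hs ⊢
    obtain ⟨v, c₁, c₂⟩ := exists_comm_of_eq hs
    obtain ⟨w, d₁, d₂⟩ := Saturated.saturates.poFill q₁ q₂ u₁ u₂ v₁ v₂ v h c₁ c₂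
    exact ⟨mor w (d₁.cod_left.symm.trans h₂) (d₁.cod_eq.symm.trans a₂), d₁.mor_comp, d₂.mor_comp⟩
  refine ⟨⟨comm⟩, ⟨Limits.PushoutCocone.IsColimit.mk comm (fun s => (lift s).choose)
    (fun s => (lift s).choose_spec.1) (fun s => (lift s).choose_spec.2) fun s m hm₁ hm₂ => ?_⟩⟩
  generalize hc : (lift s).choose = c
  have hc₁ := (lift s).choose_spec.1
  have hc₂ := (lift s).choose_spec.2
  rw [hc] at hc₁ hc₂
  obtain ⟨v₁, a₁, a₂, e₁⟩ := exists_mor (Y := s.pt.node) s.inl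
  obtain ⟨v₂, a₃, a₄, e₂⟩ := exists_mor (Y := s.pt.node) s.inr
  obtain ⟨w, b₁, b₂, rfl⟩ := exists_mor (Y := s.pt.node) m
  obtain ⟨w', b₃, b₄, rfl⟩ := exists_mor (Y := s.pt.node) c
  rw [← e₁] at hm₁ hc₁
  rw [← e₂] at hm₂ hc₂
  exact mor_eq_iff.2 (Saturated.saturates.poUniq q₁ q₂ u₁ u₂ v₁ v₂ w w' h (mor_comp_eq_iff.1 hm₁)
    (mor_comp_eq_iff.1 hm₂) (mor_comp_eq_iff.1 hc₁) (mor_comp_eq_iff.1 hc₂))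

theorem Prod0.isProd {P A B : M.N} {p₁ p₂ : M.E} (h : M.Prod0 p₁ p₂) {h₁ : M.dom p₁ = P}
    {h₂ : M.cod p₁ = A} {h₃ : M.dom p₂ = P} {h₄ : M.cod p₂ = B} :
    IsProd (mor p₁ h₁ h₂) (mor p₂ h₃ h₄) := by
  obtain ⟨u₁, u₂, hp, ht⟩ := h
  obtain ⟨p, e₁, e₂⟩ := hp.comm
  have hp := hp.isPullback (h₁ := h₁) (h₂ := h₂) (h₃ := h₃) (h₄ := h₄)
    (h₅ := e₁.cod_left.symm.trans h₂) (h₆ := rfl) (h₇ := e₂.cod_left.symm.trans h₄)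
    (h₈ := e₂.cod_eq.symm.trans e₁.cod_eq)
  exact ⟨fun a b => ⟨hp.lift a b ((isFinal ht).ext _ _), hp.lift_fst _ _ _, hp.lift_snd _ _ _⟩,
    fun e e' => hp.hom_ext e e'⟩

theorem exists_prod0 {T : M.N} (hT : M.Term T) (X Y : M.N) :
    ∃ p₁ p₂, M.Prod0 p₁ p₂ ∧ M.cod p₁ = X ∧ M.cod p₂ = Y := by
  obtain ⟨u, h₁, h₂⟩ := Saturated.saturates.termFill X T hT
  obtain ⟨v, h₃, h₄⟩ := Saturated.saturates.termFill Y T hT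
  obtain ⟨p₁, p₂, hp⟩ := Saturated.saturates.pb u v (h₂.trans h₄.symm)
  obtain ⟨p, e₁, e₂⟩ := hp.comm
  exact ⟨p₁, p₂, ⟨u, v, hp, h₂.symm ▸ hT⟩, e₁.cod_left.trans h₁, e₂.cod_left.trans h₃⟩

omit [Saturated M] in
theorem Lst.prod0 {p₁ p₂ ε k : M.E} (h : M.Lst p₁ p₂ ε k) : M.Prod0 p₁ p₂ := by
  obtain ⟨w, rfl, rfl, rfl, rfl⟩ := h
  exact ⟨_, _, ⟨M.lpb w, rfl, rfl, rfl, rfl⟩, M.lt w, by rw [← M.cod_c_lpb, M.cod_r]⟩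

omit [Saturated M] in
theorem Lst.term {p₁ p₂ ε k : M.E} (h : M.Lst p₁ p₂ ε k) : M.Term (M.dom ε) := by
  obtain ⟨w, rfl, rfl, rfl, rfl⟩ := h
  exact ⟨M.lt w, (M.dom_le w).symm⟩

/-- The recursion rule has a parameter object `B`; ordinary recursion is the case where `B` is the
terminal object `T`. Existence passes through `exists_fold_of_rec`. For uniqueness, two folds become
solutions with parameter after composition with `q₁ : L × T ⟶ L`, which is a split epimorphism. -/
theorem Lst.isListObject {A L P T : M.N} {p₁ p₂ ε k : M.E} (h : M.Lst p₁ p₂ ε k)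
    {h₁ : M.dom p₁ = P} {h₂ : M.cod p₁ = A} {h₃ : M.dom p₂ = P} {h₄ : M.cod p₂ = L}
    {h₅ : M.dom ε = T} {h₆ : M.cod ε = L} {h₇ : M.dom k = P} {h₈ : M.cod k = L} :
    IsListObject (mor p₁ h₁ h₂) (mor p₂ h₃ h₄) (mor ε h₅ h₆) (mor k h₇ h₈) := by
  have hT : M.Term T := h₅ ▸ h.term
  have hF := isFinal hT
  refine ⟨hF, h.prod0.isProd, fun Y => ?_⟩
  -- The products `A × Y`, `L × B`, `P × B` and `A × (L × B)` for `B = T`.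
  obtain ⟨z₁, z₂, hz, hz₁, hz₂⟩ := exists_prod0 hT A Y.node
  obtain ⟨q₁, q₂, hq, hq₁, hq₂⟩ := exists_prod0 hT L T
  obtain ⟨π₁, π₂, hπ, hπ₁, hπ₂⟩ := exists_prod0 hT P T
  obtain ⟨s₁, s₂, hs, hs₁, hs₂⟩ := exists_prod0 hT A (M.dom q₁)
  have pz := hz.isProd (h₁ := rfl) (h₂ := hz₁) (h₃ := hz.dom_eq.symm) (h₄ := hz₂)
  have pq := hq.isProd (h₁ := rfl) (h₂ := hq₁) (h₃ := hq.dom_eq.symm) (h₄ := hq₂)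
  have pπ := hπ.isProd (h₁ := rfl) (h₂ := hπ₁) (h₃ := hπ.dom_eq.symm) (h₄ := hπ₂)
  have ps := hs.isProd (h₁ := rfl) (h₂ := hs₁) (h₃ := hs.dom_eq.symm) (h₄ := hs₂)
  -- The morphisms `⟨ε !, id⟩`, `k × B`, `p₂ × B` and the associativity are built in the category
  -- and only afterwards represented by edges.
  obtain ⟨i, i₁, i₂⟩ := pq.lift (mor ε h₅ h₆) (𝟙 _)
  obtain ⟨κ, κ₁, κ₂⟩ := pq.lift (mor π₁ rfl hπ₁ ≫ mor k h₇ h₈) (mor π₂ hπ.dom_eq.symm hπ₂)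
  obtain ⟨j, j₁, j₂⟩ := pq.lift (mor π₁ rfl hπ₁ ≫ mor p₂ h₃ h₄) (mor π₂ hπ.dom_eq.symm hπ₂)
  obtain ⟨a, a₁, a₂⟩ := ps.lift (mor π₁ rfl hπ₁ ≫ mor p₁ h₁ h₂) j
  have a₂' : a ≫ mor s₂ hs.dom_eq.symm hs₂ ≫ mor q₁ rfl hq₁ =
    mor π₁ rfl hπ₁ ≫ mor p₂ h₃ h₄ := by rw [← Category.assoc, a₂, j₁]
  refine ⟨_, _, _, pz, fun y g => ?_⟩
  obtain ⟨ye, y₁, y₂, rfl⟩ := exists_mor (Y := Y.node) y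
  obtain ⟨ge, g₁, g₂, rfl⟩ := exists_mor (Y := Y.node) g
  obtain ⟨ie, i₃, i₄, rfl⟩ := exists_mor i
  obtain ⟨κe, κ₃, κ₄, rfl⟩ := exists_mor κ
  obtain ⟨je, j₃, j₄, rfl⟩ := exists_mor j
  obtain ⟨ae, a₃, a₄, rfl⟩ := exists_mor a
  have hd : M.RecData p₁ p₂ ε k q₁ q₂ π₁ π₂ s₁ s₂ z₁ z₂ ye ge ie κe ae :=
    { lst := h
      prodLB := hq
      cod_q₁ := hq₁.trans h₄.symm
      prodPB := hπ
      cod_π₁ := hπ₁.trans h₁.symm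
      cod_π₂ := hπ₂.trans hq₂.symm
      prodALB := hs
      cod_s₁ := hs₁.trans h₂.symm
      cod_s₂ := hs₂
      prodAY := hz
      cod_z₁ := hz₁.trans h₂.symm
      dom_y := y₁.trans hq₂.symm
      cod_y := y₂.trans hz₂.symm
      dom_g := g₁
      cod_g := g₂.trans hz₂.symm
      -- The map from `B` to the terminal node is the identity, as `B = T`.
      spec_i := ⟨M.idn T, ε, by rw [← h₅]; exact comm_unitLeft ε, mor_comp_eq_iff.1 i₁, by
        rw [hq₂]; exact mor_comp_eq_iff.1 (i₂.trans (mor_idn T).symm)⟩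
      spec_κ := by
        obtain ⟨b, b₁, b₂⟩ := exists_comm_of_eq κ₁
        exact ⟨b, b₂, b₁, mor_comp_eq_iff.1 κ₂⟩
      spec_a := by
        obtain ⟨b, b₁, b₂⟩ := exists_comm_of_eq a₁
        obtain ⟨c, c₁, c₂⟩ := exists_comm_of_eq j₁
        exact ⟨b, c, je, b₂, b₁, c₂, c₁, mor_comp_eq_iff.1 j₂, mor_comp_eq_iff.1 a₂⟩ }
  have sol : ∀ r : Obj.of L ⟶ Y, (mor ε h₅ h₆ ≫ r = mor ye y₁ y₂ ∧
      ∃ r', r' ≫ mor z₁ rfl hz₁ = mor p₁ h₁ h₂ ∧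
        r' ≫ mor z₂ hz.dom_eq.symm hz₂ = mor p₂ h₃ h₄ ≫ r ∧
        mor k h₇ h₈ ≫ r = r' ≫ mor ge g₁ g₂) →
      ∃ re e₁ e₂, mor re e₁ e₂ = mor q₁ rfl hq₁ ≫ r ∧
        ∃ r' r'' g' g'', M.RecSol s₁ s₂ z₁ z₂ ye ge ie κe ae re r' r'' g' g'' := by
    intro r hr
    obtain ⟨re, e₁, e₂, er⟩ := exists_mor (Y := Y.node) (mor q₁ rfl hq₁ ≫ r)
    refine ⟨re, e₁, e₂, er, ?_⟩
    have := exists_rec_of_fold pz i₁ κ₁ a₁ a₂' hr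
    rw [← er] at this
    obtain ⟨hr₁, r', hr₂, hr₃, hr₄⟩ := this
    obtain ⟨re', e₃, e₄, rfl⟩ := exists_mor r'
    obtain ⟨re'', c₁, c₂⟩ := exists_comm_of_eq hr₄
    obtain ⟨ge', e₅, e₆, eg⟩ := exists_mor (Y := Y.node) (mor re' e₃ e₄ ≫ mor ge g₁ g₂)
    rw [← eg] at hr₂
    obtain ⟨ge'', c₃, c₄⟩ := exists_comm_of_eq hr₂
    exact ⟨re', re'', ge', ge'', mor_comp_eq_iff.1 hr₁, c₃, c₄, mor_comp_eq_iff.1 eg.symm,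
      mor_comp_eq_iff.1 hr₃, c₁, c₂⟩
  refine existsUnique_of_exists_of_unique ?_ ?_
  · obtain ⟨r, r', r'', g', g'', hr⟩ := Saturated.saturates.recFill _ _ _ _ _ _ _ _ _ _ _ _ _ _ _ _
      _ hd
    change M.RecSol s₁ s₂ z₁ z₂ ye ge ie κe ae r r' r'' g' g'' at hr
    have r₁ : M.dom r = M.dom q₁ := hr.base.cod_left.symm.trans i₄
    have r₂ : M.cod r = Y.node := hr.base.cod_eq.symm.trans y₂
    have r₃ : M.dom r' = M.dom s₁ := hr.fst.dom_eq.symm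
    have r₄ : M.cod r' = M.dom z₁ := hr.fst.cod_left
    have r₅ : M.dom r'' = M.dom s₁ := hr.snd₁.dom_eq.trans r₃
    have r₆ : M.cod r'' = Y.node := hr.snd₂.cod_eq.trans r₂
    have r₇ : M.dom g' = M.dom s₁ := hr.step₃.dom_eq.trans r₃
    have r₈ : M.cod g' = Y.node := hr.step₃.cod_eq.trans g₂
    have r₉ : M.dom g'' = M.dom π₁ := hr.step₂.dom_eq.trans a₃
    have r₁₀ : M.cod g'' = Y.node := hr.step₂.cod_eq.trans r₈
    refine exists_fold_of_rec (r := mor r r₁ r₂) (r' := mor r' r₃ r₄) hF pq pπ i₁ κ₁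
      a₁ a₂' hr.base.mor_comp ?_ hr.fst.mor_comp ?_
    · rw [hr.step₃.mor_comp (hX' := r₇) (hZ' := r₈), hr.step₂.mor_comp (hX' := r₉) (hZ' := r₁₀),
        hr.step₁.mor_comp]
    · rw [hr.snd₁.mor_comp (hX' := r₅) (hZ' := r₆), hr.snd₂.mor_comp]
  · intro r r' hr hr'
    obtain ⟨re, e₁, e₂, er, hr⟩ := sol r hr
    obtain ⟨re', e₁', e₂', er', hr'⟩ := sol r' hr'
    have : mor q₁ rfl hq₁ ≫ r = mor q₁ rfl hq₁ ≫ r' := by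
      rw [← er, ← er']
      exact mor_eq_iff.2 (Saturated.saturates.recUniq _ _ _ _ _ _ _ _ _ _ _ _ _ _ _ _ _ hd re re'
        hr hr')
    obtain ⟨t⟩ := hF.exists_hom (Obj.of L)
    -- The section `c` of `q₁` cancels it.
    obtain ⟨c, hc, -⟩ := pq.lift (𝟙 _) t
    have := c ≫= this
    rwa [← Category.assoc, ← Category.assoc, hc, Category.id_comp, Category.id_comp] at this

end Sketch

end AUSketch

namespace AUSketch

/-! ### Object equalities in a saturated sketch -/

section

variable {C : Type*} [Category C] {P A₁ A₂ A₃ Q B₁ B₂ B₃ : C}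

/-- An isomorphism of cospans induces an isomorphism of pullbacks. -/
theorem exists_inv_of_isPullback {p₁ : P ⟶ A₁} {p₂ : P ⟶ A₂} {u₁ : A₁ ⟶ A₃} {u₂ : A₂ ⟶ A₃}
    {q₁ : Q ⟶ B₁} {q₂ : Q ⟶ B₂} {v₁ : B₁ ⟶ B₃} {v₂ : B₂ ⟶ B₃} (hp : IsPullback p₁ p₂ u₁ u₂)
    (hq : IsPullback q₁ q₂ v₁ v₂) {a₁ : A₁ ⟶ B₁} {a₂ : A₂ ⟶ B₂} {a₃ : A₃ ⟶ B₃} {b₁ : B₁ ⟶ A₁}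
    {b₂ : B₂ ⟶ A₂} {b₃ : B₃ ⟶ A₃} (h₁ : a₁ ≫ b₁ = 𝟙 _) (h₁' : b₁ ≫ a₁ = 𝟙 _) (h₂ : a₂ ≫ b₂ = 𝟙 _)
    (h₂' : b₂ ≫ a₂ = 𝟙 _) (h₃ : a₃ ≫ b₃ = 𝟙 _) (e₁ : u₁ ≫ a₃ = a₁ ≫ v₁) (e₂ : u₂ ≫ a₃ = a₂ ≫ v₂)
    {a : P ⟶ Q} (f₁ : a ≫ q₁ = p₁ ≫ a₁) (f₂ : a ≫ q₂ = p₂ ≫ a₂) :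
    v₁ ≫ b₃ = b₁ ≫ u₁ ∧ v₂ ≫ b₃ = b₂ ≫ u₂ ∧
      ∃ b : Q ⟶ P, a ≫ b = 𝟙 P ∧ b ≫ a = 𝟙 Q ∧ b ≫ p₁ = q₁ ≫ b₁ ∧ b ≫ p₂ = q₂ ≫ b₂ := by
  have k₁ : v₁ ≫ b₃ = b₁ ≫ u₁ := by
    rw [← Category.id_comp (v₁ ≫ b₃), ← h₁', Category.assoc, ← reassoc_of% e₁, h₃,
      Category.comp_id]
  have k₂ : v₂ ≫ b₃ = b₂ ≫ u₂ := by
    rw [← Category.id_comp (v₂ ≫ b₃), ← h₂', Category.assoc, ← reassoc_of% e₂, h₃,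
      Category.comp_id]
  have w : (q₁ ≫ b₁) ≫ u₁ = (q₂ ≫ b₂) ≫ u₂ := by
    rw [Category.assoc, Category.assoc, ← k₁, ← k₂, reassoc_of% hq.w]
  refine ⟨k₁, k₂, hp.lift _ _ w, ?_, ?_, hp.lift_fst _ _ _, hp.lift_snd _ _ _⟩
  · apply hp.hom_ext
    · rw [Category.assoc, hp.lift_fst, reassoc_of% f₁, h₁, Category.comp_id, Category.id_comp]
    · rw [Category.assoc, hp.lift_snd, reassoc_of% f₂, h₂, Category.comp_id, Category.id_comp]
  · apply hq.hom_ext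
    · rw [Category.assoc, f₁, hp.lift_fst_assoc, Category.assoc, h₁', Category.comp_id,
        Category.id_comp]
    · rw [Category.assoc, f₂, hp.lift_snd_assoc, Category.assoc, h₂', Category.comp_id,
        Category.id_comp]

/-- An isomorphism of spans induces an isomorphism of pushouts. -/
theorem exists_inv_of_isPushout {p₁ : A₁ ⟶ P} {p₂ : A₂ ⟶ P} {u₁ : A₃ ⟶ A₁} {u₂ : A₃ ⟶ A₂}
    {q₁ : B₁ ⟶ Q} {q₂ : B₂ ⟶ Q} {v₁ : B₃ ⟶ B₁} {v₂ : B₃ ⟶ B₂} (hp : IsPushout u₁ u₂ p₁ p₂)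
    (hq : IsPushout v₁ v₂ q₁ q₂) {a₁ : A₁ ⟶ B₁} {a₂ : A₂ ⟶ B₂} {a₃ : A₃ ⟶ B₃} {b₁ : B₁ ⟶ A₁}
    {b₂ : B₂ ⟶ A₂} {b₃ : B₃ ⟶ A₃} (h₁ : a₁ ≫ b₁ = 𝟙 _) (h₁' : b₁ ≫ a₁ = 𝟙 _) (h₂ : a₂ ≫ b₂ = 𝟙 _)
    (h₂' : b₂ ≫ a₂ = 𝟙 _) (h₃ : b₃ ≫ a₃ = 𝟙 _) (e₁ : u₁ ≫ a₁ = a₃ ≫ v₁) (e₂ : u₂ ≫ a₂ = a₃ ≫ v₂)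
    {a : P ⟶ Q} (f₁ : p₁ ≫ a = a₁ ≫ q₁) (f₂ : p₂ ≫ a = a₂ ≫ q₂) :
    v₁ ≫ b₁ = b₃ ≫ u₁ ∧ v₂ ≫ b₂ = b₃ ≫ u₂ ∧
      ∃ b : Q ⟶ P, a ≫ b = 𝟙 P ∧ b ≫ a = 𝟙 Q ∧ q₁ ≫ b = b₁ ≫ p₁ ∧ q₂ ≫ b = b₂ ≫ p₂ := by
  have k₁ : v₁ ≫ b₁ = b₃ ≫ u₁ := by
    rw [← Category.id_comp (v₁ ≫ b₁), ← h₃, Category.assoc, ← reassoc_of% e₁, h₁,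
      Category.comp_id]
  have k₂ : v₂ ≫ b₂ = b₃ ≫ u₂ := by
    rw [← Category.id_comp (v₂ ≫ b₂), ← h₃, Category.assoc, ← reassoc_of% e₂, h₂,
      Category.comp_id]
  have w : v₁ ≫ b₁ ≫ p₁ = v₂ ≫ b₂ ≫ p₂ := by
    rw [reassoc_of% k₁, reassoc_of% k₂, hp.w]
  refine ⟨k₁, k₂, hq.desc _ _ w, ?_, ?_, hq.inl_desc _ _ _, hq.inr_desc _ _ _⟩
  · apply hp.hom_ext
    · rw [reassoc_of% f₁, hq.inl_desc, reassoc_of% h₁, Category.comp_id]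
    · rw [reassoc_of% f₂, hq.inr_desc, reassoc_of% h₂, Category.comp_id]
  · apply hq.hom_ext
    · rw [hq.inl_desc_assoc, Category.assoc, f₁, reassoc_of% h₁', Category.comp_id]
    · rw [hq.inr_desc_assoc, Category.assoc, f₂, reassoc_of% h₂', Category.comp_id]

end

namespace Sketch

variable {M : Sketch} [Saturated M]

/-! ### Universals and object equalities in terms of morphisms. -/

/-- The morphisms are represented by edges for which there is a pullback universal. -/
def PbMor {P A B C : M.N} (f₁ : Obj.of P ⟶ Obj.of A) (f₂ : Obj.of P ⟶ Obj.of B)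
    (g₁ : Obj.of A ⟶ Obj.of C) (g₂ : Obj.of B ⟶ Obj.of C) : Prop :=
  ∃ p₁ p₂ u₁ u₂, ∃ (_ : M.Pb p₁ p₂ u₁ u₂) (h₁ : M.dom p₁ = P) (h₂ : M.cod p₁ = A)
    (h₃ : M.dom p₂ = P) (h₄ : M.cod p₂ = B) (h₅ : M.dom u₁ = A) (h₆ : M.cod u₁ = C)
    (h₇ : M.dom u₂ = B) (h₈ : M.cod u₂ = C), f₁ = mor p₁ h₁ h₂ ∧ f₂ = mor p₂ h₃ h₄ ∧
      g₁ = mor u₁ h₅ h₆ ∧ g₂ = mor u₂ h₇ h₈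

/-- The morphisms are represented by edges for which there is a pushout universal. -/
def PoMor {Q A B C : M.N} (f₁ : Obj.of A ⟶ Obj.of Q) (f₂ : Obj.of B ⟶ Obj.of Q)
    (g₁ : Obj.of C ⟶ Obj.of A) (g₂ : Obj.of C ⟶ Obj.of B) : Prop :=
  ∃ q₁ q₂ u₁ u₂, ∃ (_ : M.Po q₁ q₂ u₁ u₂) (h₁ : M.dom q₁ = A) (h₂ : M.cod q₁ = Q)
    (h₃ : M.dom q₂ = B) (h₄ : M.cod q₂ = Q) (h₅ : M.dom u₁ = C) (h₆ : M.cod u₁ = A)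
    (h₇ : M.dom u₂ = C) (h₈ : M.cod u₂ = B), f₁ = mor q₁ h₁ h₂ ∧ f₂ = mor q₂ h₃ h₄ ∧
      g₁ = mor u₁ h₅ h₆ ∧ g₂ = mor u₂ h₇ h₈

/-- The morphisms are represented by edges for which there is a list universal. -/
def LstMor {A L P T : M.N} (f₁ : Obj.of P ⟶ Obj.of A) (f₂ : Obj.of P ⟶ Obj.of L)
    (e : Obj.of T ⟶ Obj.of L) (c : Obj.of P ⟶ Obj.of L) : Prop :=
  ∃ p₁ p₂ ε k, ∃ (_ : M.Lst p₁ p₂ ε k) (h₁ : M.dom p₁ = P) (h₂ : M.cod p₁ = A)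
    (h₃ : M.dom p₂ = P) (h₄ : M.cod p₂ = L) (h₅ : M.dom ε = T) (h₆ : M.cod ε = L)
    (h₇ : M.dom k = P) (h₈ : M.cod k = L), f₁ = mor p₁ h₁ h₂ ∧ f₂ = mor p₂ h₃ h₄ ∧
      e = mor ε h₅ h₆ ∧ c = mor k h₇ h₈

theorem PbMor.isPullback {P A B C : M.N} {f₁ : Obj.of P ⟶ Obj.of A} {f₂ : Obj.of P ⟶ Obj.of B}
    {g₁ : Obj.of A ⟶ Obj.of C} {g₂ : Obj.of B ⟶ Obj.of C} (h : PbMor f₁ f₂ g₁ g₂) :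
    IsPullback f₁ f₂ g₁ g₂ := by
  obtain ⟨_, _, _, _, h, _, _, _, _, _, _, _, _, rfl, rfl, rfl, rfl⟩ := h
  exact h.isPullback

theorem PoMor.isPushout {Q A B C : M.N} {f₁ : Obj.of A ⟶ Obj.of Q} {f₂ : Obj.of B ⟶ Obj.of Q}
    {g₁ : Obj.of C ⟶ Obj.of A} {g₂ : Obj.of C ⟶ Obj.of B} (h : PoMor f₁ f₂ g₁ g₂) :
    IsPushout g₁ g₂ f₁ f₂ := by
  obtain ⟨_, _, _, _, h, _, _, _, _, _, _, _, _, rfl, rfl, rfl, rfl⟩ := h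
  exact h.isPushout

theorem LstMor.isListObject {A L P T : M.N} {f₁ : Obj.of P ⟶ Obj.of A} {f₂ : Obj.of P ⟶ Obj.of L}
    {e : Obj.of T ⟶ Obj.of L} {c : Obj.of P ⟶ Obj.of L} (h : LstMor f₁ f₂ e c) :
    IsListObject f₁ f₂ e c := by
  obtain ⟨_, _, _, _, h, _, _, _, _, _, _, _, _, rfl, rfl, rfl, rfl⟩ := h
  exact h.isListObject

/-- Object equalities, as morphisms of the category presented by a saturated sketch. -/
inductive IsObjEq : ∀ {X Y : M.N}, (Obj.of X ⟶ Obj.of Y) → Prop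
  | refl (X : M.N) : IsObjEq (𝟙 (Obj.of X))
  | term {X Y : M.N} (a : Obj.of X ⟶ Obj.of Y) : M.Term X → M.Term Y → IsObjEq a
  | init0 {X Y : M.N} (a : Obj.of X ⟶ Obj.of Y) : M.Init0 X → M.Init0 Y → IsObjEq a
  | pb {P A₁ A₂ A₃ Q B₁ B₂ B₃ : M.N} {p₁ : Obj.of P ⟶ Obj.of A₁} {p₂ : Obj.of P ⟶ Obj.of A₂}
      {u₁ : Obj.of A₁ ⟶ Obj.of A₃} {u₂ : Obj.of A₂ ⟶ Obj.of A₃} {q₁ : Obj.of Q ⟶ Obj.of B₁}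
      {q₂ : Obj.of Q ⟶ Obj.of B₂} {v₁ : Obj.of B₁ ⟶ Obj.of B₃} {v₂ : Obj.of B₂ ⟶ Obj.of B₃}
      {a₁ : Obj.of A₁ ⟶ Obj.of B₁} {a₂ : Obj.of A₂ ⟶ Obj.of B₂} {a₃ : Obj.of A₃ ⟶ Obj.of B₃}
      {a : Obj.of P ⟶ Obj.of Q} : PbMor p₁ p₂ u₁ u₂ → PbMor q₁ q₂ v₁ v₂ →
      IsObjEq a₁ → IsObjEq a₂ → IsObjEq a₃ → u₁ ≫ a₃ = a₁ ≫ v₁ → u₂ ≫ a₃ = a₂ ≫ v₂ →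
      a ≫ q₁ = p₁ ≫ a₁ → a ≫ q₂ = p₂ ≫ a₂ → IsObjEq a
  | po {P A₁ A₂ A₃ Q B₁ B₂ B₃ : M.N} {p₁ : Obj.of A₁ ⟶ Obj.of P} {p₂ : Obj.of A₂ ⟶ Obj.of P}
      {u₁ : Obj.of A₃ ⟶ Obj.of A₁} {u₂ : Obj.of A₃ ⟶ Obj.of A₂} {q₁ : Obj.of B₁ ⟶ Obj.of Q}
      {q₂ : Obj.of B₂ ⟶ Obj.of Q} {v₁ : Obj.of B₃ ⟶ Obj.of B₁} {v₂ : Obj.of B₃ ⟶ Obj.of B₂}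
      {a₁ : Obj.of A₁ ⟶ Obj.of B₁} {a₂ : Obj.of A₂ ⟶ Obj.of B₂} {a₃ : Obj.of A₃ ⟶ Obj.of B₃}
      {a : Obj.of P ⟶ Obj.of Q} : PoMor p₁ p₂ u₁ u₂ → PoMor q₁ q₂ v₁ v₂ →
      IsObjEq a₁ → IsObjEq a₂ → IsObjEq a₃ → u₁ ≫ a₁ = a₃ ≫ v₁ → u₂ ≫ a₂ = a₃ ≫ v₂ →
      p₁ ≫ a = a₁ ≫ q₁ → p₂ ≫ a = a₂ ≫ q₂ → IsObjEq a
  | lst {A L P T A' L' P' T' : M.N} {p₁ : Obj.of P ⟶ Obj.of A} {p₂ : Obj.of P ⟶ Obj.of L}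
      {ε : Obj.of T ⟶ Obj.of L} {k : Obj.of P ⟶ Obj.of L} {p₁' : Obj.of P' ⟶ Obj.of A'}
      {p₂' : Obj.of P' ⟶ Obj.of L'} {ε' : Obj.of T' ⟶ Obj.of L'} {k' : Obj.of P' ⟶ Obj.of L'}
      {a : Obj.of A ⟶ Obj.of A'} {b : Obj.of L ⟶ Obj.of L'} {t : Obj.of T ⟶ Obj.of T'}
      {p : Obj.of P ⟶ Obj.of P'} : LstMor p₁ p₂ ε k → LstMor p₁' p₂' ε' k' → IsObjEq a →
      IsListMap p₁ p₂ ε k p₁' p₂' ε' k' a b t p → IsObjEq b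

omit [Saturated M] in
theorem Lst.dom_cons {p₁ p₂ ε k : M.E} (h : M.Lst p₁ p₂ ε k) : M.dom k = M.dom p₁ := by
  obtain ⟨w, rfl, rfl, rfl, rfl⟩ := h
  exact M.dom_lcons w

omit [Saturated M] in
theorem Lst.cod_cons {p₁ p₂ ε k : M.E} (h : M.Lst p₁ p₂ ε k) : M.cod k = M.cod p₂ := by
  obtain ⟨w, rfl, rfl, rfl, rfl⟩ := h
  exact M.cod_lcons w

omit [Saturated M] in
theorem Lst.cod_nil {p₁ p₂ ε k : M.E} (h : M.Lst p₁ p₂ ε k) : M.cod ε = M.cod p₂ := by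
  obtain ⟨w, rfl, rfl, rfl, rfl⟩ := h
  exact M.cod_le w

/-- Together with `IsObjEq.objEq`, this shows that being an object equality depends only on the
class of the edge. Inverses and composites are formed on the categorical side. -/
theorem ObjEq.isObjEq {γ : M.E} (h : M.ObjEq γ) :
    ∀ {X Y : M.N} (hX : M.dom γ = X) (hY : M.cod γ = Y), IsObjEq (mor γ hX hY) := by
  induction h with
  | @refl γ h₁ h₂ =>
    intro X Y hX hY
    obtain rfl : X = Y := hX.symm.trans (h₁.trans hY)
    have : mor γ hX hY = 𝟙 (Obj.of X) := (mor_eq_iff (v := M.idn X) (hX' := M.dom_idn X)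
      (hY' := M.cod_idn X)).2 (by rwa [hX] at h₂)
    rw [this]
    exact .refl X
  | @term γ h₁ h₂ => rintro X Y rfl rfl; exact .term _ h₁ h₂
  | @init0 γ h₁ h₂ => rintro X Y rfl rfl; exact .init0 _ h₁ h₂
  | @pb p₁ p₂ u₁ u₂ q₁ q₂ v₁ v₂ γ₁ γ₂ γ₃ γ d₁ d₂ k₁ k₂ d P Q _ _ _ c₁ c₂ c₃ c₄ c₅ c₆ c₇ c₈ c₉ c₁₀
      o₁ o₂ o₃ =>
    intro X Y hX hY
    obtain ⟨p, e₁, e₂⟩ := P.comm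
    obtain ⟨q, e₃, e₄⟩ := Q.comm
    have hp₁ : M.dom p₁ = X := by rw [← c₅.dom_eq, c₉.dom_eq, hX]
    have hq₁ : M.dom q₁ = Y := by rw [← c₉.cod_left, hY]
    have hp₂ : M.dom p₂ = X := P.dom_eq.symm.trans hp₁
    have hq₂ : M.dom q₂ = Y := Q.dom_eq.symm.trans hq₁
    have hu : M.cod u₂ = M.cod u₁ := e₂.cod_eq.symm.trans e₁.cod_eq
    have hv : M.cod v₂ = M.cod v₁ := e₄.cod_eq.symm.trans e₃.cod_eq
    have hγ₁ : M.cod γ₁ = M.cod q₁ := by rw [c₂.cod_left, e₃.cod_left]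
    have hγ₂ : M.cod γ₂ = M.cod q₂ := by rw [c₄.cod_left, e₄.cod_left]
    have hγ₃ : M.cod γ₃ = M.cod v₁ := by rw [← c₁.cod_eq, c₂.cod_eq]
    refine .pb ⟨p₁, p₂, u₁, u₂, P, hp₁, rfl, hp₂, rfl, e₁.cod_left.symm, rfl, e₂.cod_left.symm, hu,
      rfl, rfl, rfl, rfl⟩ ⟨q₁, q₂, v₁, v₂, Q, hq₁, rfl, hq₂, rfl, e₃.cod_left.symm, rfl,
      e₄.cod_left.symm, hv, rfl, rfl, rfl, rfl⟩ (o₁ c₅.cod_left.symm hγ₁) (o₂ c₆.cod_left.symm hγ₂)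
      (o₃ c₁.cod_left.symm hγ₃) ?_ ?_ ?_ ?_
    · rw [c₁.mor_comp (hX' := c₁.dom_eq.trans e₁.cod_left.symm) (hZ' := c₁.cod_eq.trans hγ₃),
        c₂.mor_comp]
    · rw [c₃.mor_comp (hX' := c₃.dom_eq.trans e₂.cod_left.symm) (hZ' := c₃.cod_eq.trans hγ₃),
        c₄.mor_comp]
    · rw [c₉.mor_comp (hX' := c₉.dom_eq.trans hX) (hZ' := c₉.cod_eq), c₅.mor_comp]
    · rw [c₁₀.mor_comp (hX' := c₁₀.dom_eq.trans hX) (hZ' := c₁₀.cod_eq), c₆.mor_comp]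
  | @po p₁ p₂ u₁ u₂ q₁ q₂ v₁ v₂ γ₁ γ₂ γ₃ γ d₁ d₂ k₁ k₂ d P Q _ _ _ c₁ c₂ c₃ c₄ c₅ c₆ c₇ c₈ c₉ c₁₀
      o₁ o₂ o₃ =>
    intro X Y hX hY
    obtain ⟨p, e₁, e₂⟩ := P.comm
    obtain ⟨q, e₃, e₄⟩ := Q.comm
    have hp₁ : M.cod p₁ = X := by rw [c₉.cod_left, hX]
    have hq₁ : M.cod q₁ = Y := by rw [← c₅.cod_eq, c₉.cod_eq, hY]
    have hp₂ : M.cod p₂ = X := P.cod_eq.symm.trans hp₁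
    have hq₂ : M.cod q₂ = Y := Q.cod_eq.symm.trans hq₁
    have hu : M.dom u₂ = M.dom u₁ := e₂.dom_eq.symm.trans e₁.dom_eq
    have hv : M.dom v₂ = M.dom v₁ := e₄.dom_eq.symm.trans e₃.dom_eq
    have hγ₁ : M.dom γ₁ = M.dom p₁ := by rw [← c₁.cod_left, e₁.cod_left]
    have hγ₂ : M.dom γ₂ = M.dom p₂ := by rw [← c₃.cod_left, e₂.cod_left]
    have hγ₃ : M.dom γ₃ = M.dom u₁ := by rw [← c₂.dom_eq, c₁.dom_eq]
    refine .po ⟨p₁, p₂, u₁, u₂, P, rfl, hp₁, rfl, hp₂, rfl, e₁.cod_left, hu, e₂.cod_left,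
      rfl, rfl, rfl, rfl⟩ ⟨q₁, q₂, v₁, v₂, Q, rfl, hq₁, rfl, hq₂, rfl, e₃.cod_left,
      hv, e₄.cod_left, rfl, rfl, rfl, rfl⟩ (o₁ hγ₁ c₅.cod_left) (o₂ hγ₂ c₆.cod_left)
      (o₃ hγ₃ c₂.cod_left) ?_ ?_ ?_ ?_
    · rw [c₁.mor_comp (hX' := c₁.dom_eq) (hZ' := c₁.cod_eq.trans c₅.cod_left), c₂.mor_comp]
    · rw [c₃.mor_comp (hX' := c₃.dom_eq.trans hu) (hZ' := c₃.cod_eq.trans c₆.cod_left),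
        c₄.mor_comp]
    · rw [c₉.mor_comp (hX' := c₉.dom_eq) (hZ' := c₉.cod_eq.trans hY), c₅.mor_comp]
    · rw [c₁₀.mor_comp (hX' := c₁₀.dom_eq) (hZ' := c₁₀.cod_eq.trans hY), c₆.mor_comp]
  | @lst p₁ p₂ ε k p₁' p₂' ε' k' γA γL γT γP b d₁ d₂ d₃ P Q _ c₁ c₂ c₃ c₄ c₅ c₆ c₇ c₈ o =>
    intro X Y hX hY
    have hp₂ : M.cod p₂ = X := c₅.cod_left.trans hX
    have hp₂' : M.cod p₂' = Y := by rw [← c₆.cod_eq, c₅.cod_eq, hY]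
    have hγP : M.dom γP = M.dom p₁ := by rw [← c₄.dom_eq, c₃.dom_eq]
    have hγT : M.dom γT = M.dom ε := by rw [← c₂.dom_eq, c₁.dom_eq]
    have hγA : M.cod γA = M.cod p₁' := by rw [← c₃.cod_eq, c₄.cod_eq]
    refine .lst (t := mor γT hγT c₂.cod_left) (p := mor γP hγP c₄.cod_left)
      ⟨p₁, p₂, ε, k, P, rfl, rfl, P.prod0.dom_eq.symm, hp₂, rfl, P.cod_nil.trans hp₂, P.dom_cons,
        P.cod_cons.trans hp₂, rfl, rfl, rfl, rfl⟩
      ⟨p₁', p₂', ε', k', Q, rfl, rfl, Q.prod0.dom_eq.symm, hp₂', rfl, Q.cod_nil.trans hp₂',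
        Q.dom_cons, Q.cod_cons.trans hp₂', rfl, rfl, rfl, rfl⟩ (o c₃.cod_left.symm hγA)
      ⟨?_, ?_, ?_, ?_⟩
    · rw [c₁.mor_comp (hX' := c₁.dom_eq) (hZ' := c₁.cod_eq.trans hY), c₂.mor_comp]
    · rw [c₄.mor_comp (hX' := c₄.dom_eq.trans hγP) (hZ' := c₄.cod_eq), c₃.mor_comp]
    · rw [c₆.mor_comp (hX' := c₆.dom_eq.trans hγP) (hZ' := c₆.cod_eq.trans hp₂'), c₅.mor_comp]
    · rw [c₇.mor_comp (hX' := c₇.dom_eq.trans P.dom_cons) (hZ' := c₇.cod_eq.trans hY), c₈.mor_comp]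

theorem IsObjEq.objEq {X Y : M.N} {a : Obj.of X ⟶ Obj.of Y} (h : IsObjEq a) :
    ∀ {γ : M.E} {hX : M.dom γ = X} {hY : M.cod γ = Y}, a = mor γ hX hY → M.ObjEq γ := by
  induction h with
  | refl X =>
    intro γ hX hY e
    refine .refl (hX.trans hY.symm) ?_
    rw [hX]
    exact (mor_eq_iff.1 ((mor_idn X).trans e)).symm
  | term a h₁ h₂ => rintro γ rfl rfl -; exact .term h₁ h₂
  | init0 a h₁ h₂ => rintro γ rfl rfl -; exact .init0 h₁ h₂
  | @pb _ _ _ _ _ _ _ _ _ _ _ _ _ _ _ _ a₁ a₂ a₃ a hp hq _ _ _ e₁ e₂ f₁ f₂ o₁ o₂ o₃ =>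
    rintro γ hX hY rfl
    obtain ⟨p₁, p₂, u₁, u₂, hp, _, _, _, _, _, _, _, _, rfl, rfl, rfl, rfl⟩ := hp
    obtain ⟨q₁, q₂, v₁, v₂, hq, _, _, _, _, _, _, _, _, rfl, rfl, rfl, rfl⟩ := hq
    obtain ⟨γ₁, _, _, rfl⟩ := exists_mor a₁
    obtain ⟨γ₂, _, _, rfl⟩ := exists_mor a₂
    obtain ⟨γ₃, _, _, rfl⟩ := exists_mor a₃
    obtain ⟨d₁, c₁, c₂⟩ := exists_comm_of_eq e₁
    obtain ⟨d₂, c₃, c₄⟩ := exists_comm_of_eq e₂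
    obtain ⟨k₁, c₅, c₆⟩ := exists_comm_of_eq f₁
    obtain ⟨k₂, c₇, c₈⟩ := exists_comm_of_eq f₂
    -- The diagonal `d` has no counterpart among the categorical data. Both of its triangles hold
    -- because `d` is also the composite of `γ` with the diagonal of the target pullback.
    obtain ⟨d, hd⟩ := exists_comm (c₅.cod_eq.trans hq.comm.choose_spec.1.cod_left)
    obtain ⟨q, r₁, r₂⟩ := hq.comm
    have hd' := comm_assocRight c₅ r₁ hd
    exact .pb hp hq (o₁ rfl) (o₂ rfl) (o₃ rfl) c₁ c₂ c₃ c₄ c₆ c₈ hd (comm_assocLeft c₇ r₂ hd') c₅ c₇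
  | @po _ _ _ _ _ _ _ _ _ _ _ _ _ _ _ _ a₁ a₂ a₃ a hp hq _ _ _ e₁ e₂ f₁ f₂ o₁ o₂ o₃ =>
    rintro γ hX hY rfl
    obtain ⟨p₁, p₂, u₁, u₂, hp, _, _, _, _, _, _, _, _, rfl, rfl, rfl, rfl⟩ := hp
    obtain ⟨q₁, q₂, v₁, v₂, hq, _, _, _, _, _, _, _, _, rfl, rfl, rfl, rfl⟩ := hq
    obtain ⟨γ₁, _, _, rfl⟩ := exists_mor a₁
    obtain ⟨γ₂, _, _, rfl⟩ := exists_mor a₂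
    obtain ⟨γ₃, _, _, rfl⟩ := exists_mor a₃
    obtain ⟨d₁, c₁, c₂⟩ := exists_comm_of_eq e₁
    obtain ⟨d₂, c₃, c₄⟩ := exists_comm_of_eq e₂
    obtain ⟨k₁, c₅, c₆⟩ := exists_comm_of_eq f₁
    obtain ⟨k₂, c₇, c₈⟩ := exists_comm_of_eq f₂
    obtain ⟨p, r₁, r₂⟩ := hp.comm
    -- Dually, `d` is the diagonal of the source pushout followed by `γ`.
    obtain ⟨d, hd⟩ := exists_comm (r₁.cod_left.trans c₅.dom_eq.symm)
    have hd' := comm_assocLeft r₁ c₅ hd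
    exact .po hp hq (o₁ rfl) (o₂ rfl) (o₃ rfl) c₁ c₂ c₃ c₄ c₆ c₈ hd (comm_assocRight r₂ c₇ hd') c₅ c₇
  | @lst _ _ _ _ _ _ _ _ _ _ _ _ _ _ _ _ a b t p hp hq _ hm o =>
    rintro γ hX hY rfl
    obtain ⟨p₁, p₂, ε, k, hp, _, _, _, _, _, _, _, _, rfl, rfl, rfl, rfl⟩ := hp
    obtain ⟨q₁, q₂, v₁, v₂, hq, _, _, _, _, _, _, _, _, rfl, rfl, rfl, rfl⟩ := hq
    obtain ⟨γA, _, _, rfl⟩ := exists_mor a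
    obtain ⟨γT, _, _, rfl⟩ := exists_mor t
    obtain ⟨γP, _, _, rfl⟩ := exists_mor p
    obtain ⟨d₁, c₁, c₂⟩ := exists_comm_of_eq hm.nil
    obtain ⟨d₂, c₃, c₄⟩ := exists_comm_of_eq hm.fst
    obtain ⟨d₃, c₅, c₆⟩ := exists_comm_of_eq hm.snd
    obtain ⟨d₄, c₇, c₈⟩ := exists_comm_of_eq hm.cons
    exact .lst hp hq (o rfl) c₁ c₂ c₄ c₃ c₆ c₅ c₇ c₈

/-- An isomorphism of cospans, of spans or of objects of entries induces one of pullbacks, pushouts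
or list objects. Its inverse is induced by the inverse data, hence it is again of the generating
form with the two universals exchanged. -/
theorem IsObjEq.exists_inv {X Y : M.N} {a : Obj.of X ⟶ Obj.of Y} (h : IsObjEq a) :
    ∃ b : Obj.of Y ⟶ Obj.of X, a ≫ b = 𝟙 _ ∧ b ≫ a = 𝟙 _ ∧ IsObjEq b := by
  induction h with
  | refl X => exact ⟨𝟙 _, Category.comp_id _, Category.comp_id _, .refl X⟩
  | @term X Y a h₁ h₂ =>
    obtain ⟨b⟩ := (isFinal h₁).exists_hom (Obj.of Y)
    exact ⟨b, (isFinal h₁).ext _ _, (isFinal h₂).ext _ _, .term b h₂ h₁⟩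
  | @init0 X Y a h₁ h₂ =>
    obtain ⟨b⟩ := exists_hom_of_init0 h₂ (Obj.of X)
    exact ⟨b, init0_hom_ext h₁ _ _, init0_hom_ext h₂ _ _, .init0 b h₂ h₁⟩
  | pb hp hq _ _ _ e₁ e₂ f₁ f₂ ih₁ ih₂ ih₃ =>
    obtain ⟨b₁, h₁, h₁', o₁⟩ := ih₁
    obtain ⟨b₂, h₂, h₂', o₂⟩ := ih₂
    obtain ⟨b₃, h₃, h₃', o₃⟩ := ih₃
    obtain ⟨k₁, k₂, b, g₁, g₂, g₃, g₄⟩ := exists_inv_of_isPullback hp.isPullback hq.isPullback h₁ h₁'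
      h₂ h₂' h₃ e₁ e₂ f₁ f₂
    exact ⟨b, g₁, g₂, .pb hq hp o₁ o₂ o₃ k₁ k₂ g₃ g₄⟩
  | po hp hq _ _ _ e₁ e₂ f₁ f₂ ih₁ ih₂ ih₃ =>
    obtain ⟨b₁, h₁, h₁', o₁⟩ := ih₁
    obtain ⟨b₂, h₂, h₂', o₂⟩ := ih₂
    obtain ⟨b₃, h₃, h₃', o₃⟩ := ih₃
    obtain ⟨k₁, k₂, b, g₁, g₂, g₃, g₄⟩ := exists_inv_of_isPushout hp.isPushout hq.isPushout h₁ h₁'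
      h₂ h₂' h₃' e₁ e₂ f₁ f₂
    exact ⟨b, g₁, g₂, .po hq hp o₁ o₂ o₃ k₁ k₂ g₃ g₄⟩
  | @lst A L P T A' L' P' T' p₁ p₂ ε k p₁' p₂' ε' k' a b t p hp hq _ hm ih =>
    obtain ⟨a', h₁, h₂, o⟩ := ih
    have : IsIso a := ⟨a', h₁, h₂⟩
    obtain ⟨b', t', p', hm', h₃, h₄⟩ := hp.isListObject.exists_inv hq.isListObject hm
    rw [IsIso.inv_eq_of_hom_inv_id h₁] at hm'
    exact ⟨b', h₃, h₄, .lst hq hp o hm'⟩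

theorem IsObjEq.isIso {X Y : M.N} {a : Obj.of X ⟶ Obj.of Y} (h : IsObjEq a) : IsIso a := by
  obtain ⟨b, h₁, h₂, -⟩ := h.exists_inv
  exact ⟨b, h₁, h₂⟩

/-! ### Uniqueness of the universal with a given subject, and composition of object equalities. -/

/-- The node `X` is the subject of a universal of the given kind, numbered in the order of
`Sketch.subject`. -/
def HasKind (M : Sketch) (X : M.N) (i : ℕ) : Prop :=
  ∃ w, M.subject w = X ∧
    Sum.elim (fun _ => 0) (Sum.elim (fun _ => 1) (Sum.elim (fun _ => 2) (Sum.elim (fun _ => 3)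
      fun _ => 4))) w = i

omit [Saturated M] in
theorem HasKind.unique (hM : Function.Injective M.subject) {X : M.N} {i j : ℕ}
    (h : M.HasKind X i) (h' : M.HasKind X j) : i = j := by
  obtain ⟨w, h₁, rfl⟩ := h
  obtain ⟨w', h₂, rfl⟩ := h'
  rw [hM (h₁.trans h₂.symm)]

omit [Saturated M] in
theorem Term.hasKind {X : M.N} (h : M.Term X) : M.HasKind X 0 := by
  obtain ⟨w, hw⟩ := h
  exact ⟨.inl w, hw, rfl⟩

omit [Saturated M] in
theorem Init0.hasKind {X : M.N} (h : M.Init0 X) : M.HasKind X 2 := by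
  obtain ⟨w, hw⟩ := h
  exact ⟨.inr (.inr (.inl w)), hw, rfl⟩

theorem PbMor.hasKind {P A B C : M.N} {f₁ : Obj.of P ⟶ Obj.of A} {f₂ : Obj.of P ⟶ Obj.of B}
    {g₁ : Obj.of A ⟶ Obj.of C} {g₂ : Obj.of B ⟶ Obj.of C} (h : PbMor f₁ f₂ g₁ g₂) :
    M.HasKind P 1 := by
  obtain ⟨_, _, _, _, ⟨w, rfl, rfl, rfl, rfl⟩, rfl, -⟩ := h
  exact ⟨.inr (.inl w), (M.dom_l _).symm, rfl⟩

theorem PoMor.hasKind {Q A B C : M.N} {f₁ : Obj.of A ⟶ Obj.of Q} {f₂ : Obj.of B ⟶ Obj.of Q}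
    {g₁ : Obj.of C ⟶ Obj.of A} {g₂ : Obj.of C ⟶ Obj.of B} (h : PoMor f₁ f₂ g₁ g₂) :
    M.HasKind Q 3 := by
  obtain ⟨_, _, _, _, ⟨w, rfl, rfl, rfl, rfl⟩, _, rfl, -⟩ := h
  exact ⟨.inr (.inr (.inr (.inl w))), (M.cod_r _).symm, rfl⟩

theorem LstMor.hasKind {A L P T : M.N} {f₁ : Obj.of P ⟶ Obj.of A} {f₂ : Obj.of P ⟶ Obj.of L}
    {e : Obj.of T ⟶ Obj.of L} {c : Obj.of P ⟶ Obj.of L} (h : LstMor f₁ f₂ e c) :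
    M.HasKind L 4 := by
  obtain ⟨_, _, _, _, ⟨w, rfl, rfl, rfl, rfl⟩, _, _, _, rfl, -⟩ := h
  exact ⟨.inr (.inr (.inr (.inr w))), M.cod_le w, rfl⟩

/-- Both pullback universals have subject `P`, so they coincide, and with them all their nodes and
edges. Heterogeneous equality appears because the types of the morphisms depend on the nodes. -/
theorem PbMor.unique (hM : Function.Injective M.subject) {P A B C A' B' C' : M.N}
    {f₁ : Obj.of P ⟶ Obj.of A} {f₂ : Obj.of P ⟶ Obj.of B} {g₁ : Obj.of A ⟶ Obj.of C}
    {g₂ : Obj.of B ⟶ Obj.of C} {f₁' : Obj.of P ⟶ Obj.of A'} {f₂' : Obj.of P ⟶ Obj.of B'}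
    {g₁' : Obj.of A' ⟶ Obj.of C'} {g₂' : Obj.of B' ⟶ Obj.of C'} (h : PbMor f₁ f₂ g₁ g₂)
    (h' : PbMor f₁' f₂' g₁' g₂') :
    A = A' ∧ B = B' ∧ C = C' ∧ HEq f₁ f₁' ∧ HEq f₂ f₂' ∧ HEq g₁ g₁' ∧ HEq g₂ g₂' := by
  obtain ⟨_, _, _, _, ⟨w, rfl, rfl, rfl, rfl⟩, rfl, rfl, _, rfl, _, rfl, _, _, rfl, rfl, rfl, rfl⟩ := h
  obtain ⟨_, _, _, _, ⟨w', rfl, rfl, rfl, rfl⟩, h, rfl, _, rfl, _, rfl, _, _, rfl, rfl, rfl, rfl⟩ := h'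
  have hw : w' = w := by
    have := @hM (.inr (.inl w')) (.inr (.inl w)) (by
      change M.dom (M.c (M.pb1 w')) = M.dom (M.c (M.pb1 w))
      rw [← M.dom_l, ← M.dom_l, h])
    simpa using this
  subst hw
  exact ⟨rfl, rfl, rfl, HEq.rfl, HEq.rfl, HEq.rfl, HEq.rfl⟩

theorem PoMor.unique (hM : Function.Injective M.subject) {P A B C A' B' C' : M.N}
    {f₁ : Obj.of A ⟶ Obj.of P} {f₂ : Obj.of B ⟶ Obj.of P} {g₁ : Obj.of C ⟶ Obj.of A}
    {g₂ : Obj.of C ⟶ Obj.of B} {f₁' : Obj.of A' ⟶ Obj.of P} {f₂' : Obj.of B' ⟶ Obj.of P}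
    {g₁' : Obj.of C' ⟶ Obj.of A'} {g₂' : Obj.of C' ⟶ Obj.of B'} (h : PoMor f₁ f₂ g₁ g₂)
    (h' : PoMor f₁' f₂' g₁' g₂') :
    A = A' ∧ B = B' ∧ C = C' ∧ HEq f₁ f₁' ∧ HEq f₂ f₂' ∧ HEq g₁ g₁' ∧ HEq g₂ g₂' := by
  obtain ⟨_, _, _, _, ⟨w, rfl, rfl, rfl, rfl⟩, rfl, rfl, rfl, _, rfl, _, _, _, rfl, rfl, rfl, rfl⟩ := h
  obtain ⟨_, _, _, _, ⟨w', rfl, rfl, rfl, rfl⟩, rfl, h, rfl, _, rfl, _, _, _, rfl, rfl, rfl, rfl⟩ := h'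
  have hw : w' = w := by
    have := @hM (.inr (.inr (.inr (.inl w')))) (.inr (.inr (.inr (.inl w)))) (by
      change M.cod (M.c (M.po1 w')) = M.cod (M.c (M.po1 w))
      rw [← M.cod_r, ← M.cod_r, h])
    simpa using this
  subst hw
  exact ⟨rfl, rfl, rfl, HEq.rfl, HEq.rfl, HEq.rfl, HEq.rfl⟩

theorem LstMor.unique (hM : Function.Injective M.subject) {L A P T A' P' T' : M.N}
    {f₁ : Obj.of P ⟶ Obj.of A} {f₂ : Obj.of P ⟶ Obj.of L} {g₁ : Obj.of T ⟶ Obj.of L}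
    {g₂ : Obj.of P ⟶ Obj.of L} {f₁' : Obj.of P' ⟶ Obj.of A'} {f₂' : Obj.of P' ⟶ Obj.of L}
    {g₁' : Obj.of T' ⟶ Obj.of L} {g₂' : Obj.of P' ⟶ Obj.of L} (h : LstMor f₁ f₂ g₁ g₂)
    (h' : LstMor f₁' f₂' g₁' g₂') :
    A = A' ∧ P = P' ∧ T = T' ∧ HEq f₁ f₁' ∧ HEq f₂ f₂' ∧ HEq g₁ g₁' ∧ HEq g₂ g₂' := by
  obtain ⟨_, _, _, _, ⟨w, rfl, rfl, rfl, rfl⟩, rfl, rfl, _, rfl, rfl, _, _, _, rfl, rfl, rfl, rfl⟩ := h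
  obtain ⟨_, _, _, _, ⟨w', rfl, rfl, rfl, rfl⟩, rfl, rfl, _, h, rfl, _, _, _, rfl, rfl, rfl, rfl⟩ := h'
  have hw : w' = w := by
    have := @hM (.inr (.inr (.inr (.inr w')))) (.inr (.inr (.inr (.inr w)))) (by
      change M.cod (M.le w') = M.cod (M.le w)
      rw [M.cod_le, M.cod_le, h])
    simpa using this
  subst hw
  exact ⟨rfl, rfl, rfl, HEq.rfl, HEq.rfl, HEq.rfl, HEq.rfl⟩

/-- Unless one factor is an identity, the middle node is the target subject of the first and the
source subject of the second. It is the subject of only one universal, so the two object equalities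
are of the same kind, share this universal, and compose componentwise. -/
theorem IsObjEq.comp (hM : Function.Injective M.subject) {X Y : M.N} {a : Obj.of X ⟶ Obj.of Y}
    (h : IsObjEq a) : ∀ {Z : M.N} {b : Obj.of Y ⟶ Obj.of Z}, IsObjEq b → IsObjEq (a ≫ b) := by
  induction h with
  | refl X => intro Z b h; rwa [Category.id_comp]
  | term a h₁ h₂ =>
    intro Z b hb
    cases hb with
    | refl => rw [Category.comp_id]; exact .term a h₁ h₂
    | term _ _ h₃ => exact .term _ h₁ h₃
    | init0 _ h₃ => exact absurd (h₂.hasKind.unique hM h₃.hasKind) (by decide)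
    | pb hp => exact absurd (h₂.hasKind.unique hM hp.hasKind) (by decide)
    | po hp => exact absurd (h₂.hasKind.unique hM hp.hasKind) (by decide)
    | lst hp => exact absurd (h₂.hasKind.unique hM hp.hasKind) (by decide)
  | init0 a h₁ h₂ =>
    intro Z b hb
    cases hb with
    | refl => rw [Category.comp_id]; exact .init0 a h₁ h₂
    | init0 _ _ h₃ => exact .init0 _ h₁ h₃
    | term _ h₃ => exact absurd (h₂.hasKind.unique hM h₃.hasKind) (by decide)
    | pb hp => exact absurd (h₂.hasKind.unique hM hp.hasKind) (by decide)
    | po hp => exact absurd (h₂.hasKind.unique hM hp.hasKind) (by decide)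
    | lst hp => exact absurd (h₂.hasKind.unique hM hp.hasKind) (by decide)
  | pb hp hq o₁ o₂ o₃ e₁ e₂ f₁ f₂ ih₁ ih₂ ih₃ =>
    intro Z b hb
    cases hb with
    | refl => rw [Category.comp_id]; exact .pb hp hq o₁ o₂ o₃ e₁ e₂ f₁ f₂
    | init0 _ h₃ => exact absurd (hq.hasKind.unique hM h₃.hasKind) (by decide)
    | term _ h₃ => exact absurd (hq.hasKind.unique hM h₃.hasKind) (by decide)
    | pb hp' hq' o₁' o₂' o₃' e₁' e₂' f₁' f₂' =>
      -- The target pullback of the first object equality is the source pullback of the second.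
      obtain ⟨rfl, rfl, rfl, i₁, i₂, i₃, i₄⟩ := hq.unique hM hp'
      obtain rfl := eq_of_heq i₁
      obtain rfl := eq_of_heq i₂
      obtain rfl := eq_of_heq i₃
      obtain rfl := eq_of_heq i₄
      refine .pb hp hq' (ih₁ o₁') (ih₂ o₂') (ih₃ o₃') ?_ ?_ ?_ ?_
      · rw [reassoc_of% e₁, e₁', Category.assoc]
      · rw [reassoc_of% e₂, e₂', Category.assoc]
      · rw [Category.assoc, f₁', reassoc_of% f₁]
      · rw [Category.assoc, f₂', reassoc_of% f₂]
    | po hp => exact absurd (hq.hasKind.unique hM hp.hasKind) (by decide)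
    | lst hp => exact absurd (hq.hasKind.unique hM hp.hasKind) (by decide)
  | po hp hq o₁ o₂ o₃ e₁ e₂ f₁ f₂ ih₁ ih₂ ih₃ =>
    intro Z b hb
    cases hb with
    | refl => rw [Category.comp_id]; exact .po hp hq o₁ o₂ o₃ e₁ e₂ f₁ f₂
    | init0 _ h₃ => exact absurd (hq.hasKind.unique hM h₃.hasKind) (by decide)
    | term _ h₃ => exact absurd (hq.hasKind.unique hM h₃.hasKind) (by decide)
    | po hp' hq' o₁' o₂' o₃' e₁' e₂' f₁' f₂' =>
      obtain ⟨rfl, rfl, rfl, i₁, i₂, i₃, i₄⟩ := hq.unique hM hp'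
      obtain rfl := eq_of_heq i₁
      obtain rfl := eq_of_heq i₂
      obtain rfl := eq_of_heq i₃
      obtain rfl := eq_of_heq i₄
      refine .po hp hq' (ih₁ o₁') (ih₂ o₂') (ih₃ o₃') ?_ ?_ ?_ ?_
      · rw [reassoc_of% e₁, e₁', Category.assoc]
      · rw [reassoc_of% e₂, e₂', Category.assoc]
      · rw [reassoc_of% f₁, f₁', Category.assoc]
      · rw [reassoc_of% f₂, f₂', Category.assoc]
    | pb hp => exact absurd (hq.hasKind.unique hM hp.hasKind) (by decide)
    | lst hp => exact absurd (hq.hasKind.unique hM hp.hasKind) (by decide)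
  | lst hp hq o hm ih =>
    intro Z b hb
    cases hb with
    | refl => rw [Category.comp_id]; exact .lst hp hq o hm
    | init0 _ h₃ => exact absurd (hq.hasKind.unique hM h₃.hasKind) (by decide)
    | term _ h₃ => exact absurd (hq.hasKind.unique hM h₃.hasKind) (by decide)
    | pb hp => exact absurd (hq.hasKind.unique hM hp.hasKind) (by decide)
    | po hp => exact absurd (hq.hasKind.unique hM hp.hasKind) (by decide)
    | lst hp' hq' o' hm' =>
      obtain ⟨rfl, rfl, rfl, i₁, i₂, i₃, i₄⟩ := hq.unique hM hp'
      obtain rfl := eq_of_heq i₁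
      obtain rfl := eq_of_heq i₂
      obtain rfl := eq_of_heq i₃
      obtain rfl := eq_of_heq i₄
      exact .lst hp hq' (ih o') (hm.comp hm')

end Sketch

end AUSketch

namespace AUSketch

/-! ### Object equalities between homomorphisms into a saturated sketch -/

theorem Sketch.ObjEq.map {U V : Sketch} (f : U ⟶ V) {γ : U.E} (h : U.ObjEq γ) :
    V.ObjEq (f.edge γ) := by
  induction h with
  | refl h₁ h₂ =>
    refine .refl (by rw [← f.map_dom, h₁, f.map_cod]) ?_
    have := h₂.map f
    rwa [f.map_idn, f.map_dom] at this
  | term h₁ h₂ => exact .term (f.map_dom _ ▸ h₁.map f) (f.map_cod _ ▸ h₂.map f)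
  | init0 h₁ h₂ => exact .init0 (f.map_dom _ ▸ h₁.map f) (f.map_cod _ ▸ h₂.map f)
  | pb P Q _ _ _ c₁ c₂ c₃ c₄ c₅ c₆ c₇ c₈ c₉ c₁₀ o₁ o₂ o₃ =>
    exact .pb (P.map f) (Q.map f) o₁ o₂ o₃ (c₁.map f) (c₂.map f) (c₃.map f) (c₄.map f) (c₅.map f)
      (c₆.map f) (c₇.map f) (c₈.map f) (c₉.map f) (c₁₀.map f)
  | po P Q _ _ _ c₁ c₂ c₃ c₄ c₅ c₆ c₇ c₈ c₉ c₁₀ o₁ o₂ o₃ =>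
    exact .po (P.map f) (Q.map f) o₁ o₂ o₃ (c₁.map f) (c₂.map f) (c₃.map f) (c₄.map f) (c₅.map f)
      (c₆.map f) (c₇.map f) (c₈.map f) (c₉.map f) (c₁₀.map f)
  | lst P Q _ c₁ c₂ c₃ c₄ c₅ c₆ c₇ c₈ o =>
    exact .lst (P.map f) (Q.map f) o (c₁.map f) (c₂.map f) (c₃.map f) (c₄.map f) (c₅.map f)
      (c₆.map f) (c₇.map f) (c₈.map f)

theorem ObjectEquality.precomp {U V W : Sketch} {f g : V ⟶ W} (h : ObjectEquality f g)
    (k : U ⟶ V) : ObjectEquality (k ≫ f) (k ≫ g) := by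
  obtain ⟨α, hα⟩ := h
  refine ⟨⟨fun X => α.carrier (k.node X), fun u => α.diag (k.edge u),
    fun X => α.dom_carrier _, fun X => α.cod_carrier _, fun u => ?_, fun u => ?_⟩, fun X => hα _⟩
  · rw [k.map_cod]; exact α.comm₀ _
  · rw [k.map_dom]; exact α.comm₁ _

theorem ObjectEquality.postcomp {U V W : Sketch} {f g : U ⟶ V} (h : ObjectEquality f g)
    (k : V ⟶ W) : ObjectEquality (f ≫ k) (g ≫ k) := by
  obtain ⟨α, hα⟩ := h
  refine ⟨⟨fun X => k.edge (α.carrier X), fun u => k.edge (α.diag u), fun X => ?_, fun X => ?_,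
    fun u => (α.comm₀ u).map k, fun u => (α.comm₁ u).map k⟩, fun X => (hα X).map k⟩
  · rw [← k.map_dom, α.dom_carrier]; rfl
  · rw [← k.map_cod, α.cod_carrier]; rfl

namespace Sketch

variable {V M : Sketch} [Saturated M]

/-- The image of an edge, as a morphism of the category presented by the codomain. -/
def Hom.mor (f : V ⟶ M) {X Y : V.N} (u : V.E) (hX : V.dom u = X) (hY : V.cod u = Y) :
    Obj.of (f.node X) ⟶ Obj.of (f.node Y) :=
  Sketch.mor (f.edge u) (by rw [← f.map_dom, hX]) (by rw [← f.map_cod, hY])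

theorem Hom.mor_comp (f : V ⟶ M) {X Y Z : V.N} {u v w : V.E} (h : V.Comm u v w)
    {hX : V.dom u = X} {hY : V.cod u = Y} {hY' : V.dom v = Y} {hZ : V.cod v = Z}
    {hX' : V.dom w = X} {hZ' : V.cod w = Z} :
    Hom.mor f u hX hY ≫ Hom.mor f v hY' hZ = Hom.mor f w hX' hZ' :=
  (h.map f).mor_comp

theorem Hom.mor_idn (f : V ⟶ M) (X : V.N) {h : V.dom (V.idn X) = X} {h' : V.cod (V.idn X) = X} :
    Hom.mor f (V.idn X) h h' = 𝟙 (Obj.of (f.node X)) :=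
  (mor_eq_iff (v := M.idn (f.node X)) (hX' := M.dom_idn _) (hY' := M.cod_idn _)).2
    (f.map_idn X ▸ UComm.refl _)

theorem Pb.pbMor (f : V ⟶ M) {p₁ p₂ u₁ u₂ : V.E} (h : V.Pb p₁ p₂ u₁ u₂) {P A B C : V.N}
    {h₁ : V.dom p₁ = P} {h₂ : V.cod p₁ = A} {h₃ : V.dom p₂ = P} {h₄ : V.cod p₂ = B}
    {h₅ : V.dom u₁ = A} {h₆ : V.cod u₁ = C} {h₇ : V.dom u₂ = B} {h₈ : V.cod u₂ = C} :
    PbMor (Hom.mor f p₁ h₁ h₂) (Hom.mor f p₂ h₃ h₄) (Hom.mor f u₁ h₅ h₆) (Hom.mor f u₂ h₇ h₈) :=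
  ⟨_, _, _, _, h.map f, _, _, _, _, _, _, _, _, rfl, rfl, rfl, rfl⟩

theorem Po.poMor (f : V ⟶ M) {q₁ q₂ u₁ u₂ : V.E} (h : V.Po q₁ q₂ u₁ u₂) {Q A B C : V.N}
    {h₁ : V.dom q₁ = A} {h₂ : V.cod q₁ = Q} {h₃ : V.dom q₂ = B} {h₄ : V.cod q₂ = Q}
    {h₅ : V.dom u₁ = C} {h₆ : V.cod u₁ = A} {h₇ : V.dom u₂ = C} {h₈ : V.cod u₂ = B} :
    PoMor (Hom.mor f q₁ h₁ h₂) (Hom.mor f q₂ h₃ h₄) (Hom.mor f u₁ h₅ h₆) (Hom.mor f u₂ h₇ h₈) :=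
  ⟨_, _, _, _, h.map f, _, _, _, _, _, _, _, _, rfl, rfl, rfl, rfl⟩

theorem Lst.lstMor (f : V ⟶ M) {p₁ p₂ ε k : V.E} (h : V.Lst p₁ p₂ ε k) {A L P T : V.N}
    {h₁ : V.dom p₁ = P} {h₂ : V.cod p₁ = A} {h₃ : V.dom p₂ = P} {h₄ : V.cod p₂ = L}
    {h₅ : V.dom ε = T} {h₆ : V.cod ε = L} {h₇ : V.dom k = P} {h₈ : V.cod k = L} :
    LstMor (Hom.mor f p₁ h₁ h₂) (Hom.mor f p₂ h₃ h₄) (Hom.mor f ε h₅ h₆) (Hom.mor f k h₇ h₈) :=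
  ⟨_, _, _, _, h.map f, _, _, _, _, _, _, _, _, rfl, rfl, rfl, rfl⟩

/-! ### Naturality of a family of morphisms at an edge. -/

variable {f g : V ⟶ M}

/-- The family `γ` is natural for the edge `u`. -/
def NaturalAt (γ : ∀ X, Obj.of (f.node X) ⟶ Obj.of (g.node X)) (u : V.E) : Prop :=
  ∀ ⦃X Y : V.N⦄ (hX : V.dom u = X) (hY : V.cod u = Y),
    Hom.mor f u hX hY ≫ γ Y = γ X ≫ Hom.mor g u hX hY

variable {γ : ∀ X, Obj.of (f.node X) ⟶ Obj.of (g.node X)}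

/-- `NaturalAt` allows every presentation of the end nodes, so that it can be applied without casts;
here one presentation is enough to prove it. -/
theorem NaturalAt.of_eq {u : V.E} {X Y : V.N} {hX : V.dom u = X} {hY : V.cod u = Y}
    (h : Hom.mor f u hX hY ≫ γ Y = γ X ≫ Hom.mor g u hX hY) : NaturalAt γ u := by
  subst hX hY
  rintro X Y rfl rfl
  exact h

theorem naturalAt_idn (X : V.N) : NaturalAt γ (V.idn X) := by
  refine .of_eq (hX := V.dom_idn X) (hY := V.cod_idn X) ?_
  rw [Hom.mor_idn, Hom.mor_idn, Category.id_comp, Category.comp_id]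

theorem naturalAt_comp {u v w : V.E} (h : V.Comm u v w) (hu : NaturalAt γ u)
    (hv : NaturalAt γ v) : NaturalAt γ w := by
  refine .of_eq (hX := h.dom_eq) (hY := h.cod_eq) ?_
  rw [← Hom.mor_comp f h (hX := rfl) (hY := h.cod_left) (hY' := rfl) (hZ := rfl),
    ← Hom.mor_comp g h (hX := rfl) (hY := h.cod_left) (hY' := rfl) (hZ := rfl), Category.assoc,
    hv rfl rfl, ← Category.assoc, hu rfl h.cod_left, Category.assoc]

theorem naturalAt_of_term {u : V.E} (h : V.Term (V.cod u)) : NaturalAt γ u :=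
  .of_eq (hX := rfl) (hY := rfl) ((isFinal (h.map g)).ext _ _)

theorem naturalAt_of_init0 {u : V.E} (h : V.Init0 (V.dom u)) : NaturalAt γ u :=
  .of_eq (hX := rfl) (hY := rfl) (init0_hom_ext (h.map f) _ _)

/-- The two sides of the naturality square agree after composition with the projections of the
pullback in the image of `g`. Dually, `naturalAt_poFill` uses the pushout in the image of `f`. -/
theorem naturalAt_pbFill {p₁ p₂ u₁ u₂ v₁ v₂ w : V.E} (h : V.Pb p₁ p₂ u₁ u₂) (h₁ : V.Comm w p₁ v₁)
    (h₂ : V.Comm w p₂ v₂) (n₁ : NaturalAt γ p₁) (n₂ : NaturalAt γ p₂) (m₁ : NaturalAt γ v₁)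
    (m₂ : NaturalAt γ v₂) : NaturalAt γ w := by
  obtain ⟨p, c₁, c₂⟩ := h.comm
  refine .of_eq (hX := rfl) (hY := h₁.cod_left) ?_
  refine (h.pbMor g (h₁ := rfl) (h₂ := c₁.cod_left) (h₃ := h.dom_eq.symm) (h₄ := c₂.cod_left)
    (h₅ := rfl) (h₆ := rfl) (h₇ := rfl)
    (h₈ := c₂.cod_eq.symm.trans c₁.cod_eq)).isPullback.hom_ext ?_ ?_
  · rw [Category.assoc, ← n₁, ← Category.assoc, Hom.mor_comp f h₁ (hX' := h₁.dom_eq)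
      (hZ' := h₁.cod_eq.trans c₁.cod_left), m₁, Category.assoc, Hom.mor_comp g h₁]
  · rw [Category.assoc, ← n₂, ← Category.assoc, Hom.mor_comp f h₂ (hX' := h₂.dom_eq)
      (hZ' := h₂.cod_eq.trans c₂.cod_left), m₂, Category.assoc, Hom.mor_comp g h₂]

theorem naturalAt_poFill {q₁ q₂ u₁ u₂ v₁ v₂ w : V.E} (h : V.Po q₁ q₂ u₁ u₂) (h₁ : V.Comm q₁ w v₁)
    (h₂ : V.Comm q₂ w v₂) (n₁ : NaturalAt γ q₁) (n₂ : NaturalAt γ q₂) (m₁ : NaturalAt γ v₁)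
    (m₂ : NaturalAt γ v₂) : NaturalAt γ w := by
  obtain ⟨p, c₁, c₂⟩ := h.comm
  refine .of_eq (hX := h₁.cod_left.symm) (hY := rfl) ?_
  refine (h.poMor f (h₁ := c₁.cod_left.symm) (h₂ := rfl) (h₃ := c₂.cod_left.symm)
    (h₄ := h.cod_eq.symm) (h₅ := rfl) (h₆ := rfl) (h₇ := c₂.dom_eq.symm.trans c₁.dom_eq)
    (h₈ := rfl)).isPushout.hom_ext ?_ ?_
  · rw [← Category.assoc, Hom.mor_comp f h₁ (hX' := h₁.dom_eq.trans c₁.cod_left.symm)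
      (hZ' := h₁.cod_eq), m₁, ← Category.assoc, n₁, Category.assoc, Hom.mor_comp g h₁]
  · rw [← Category.assoc, Hom.mor_comp f h₂ (hX' := h₂.dom_eq.trans c₂.cod_left.symm)
      (hZ' := h₂.cod_eq), m₂, ← Category.assoc, n₂, Category.assoc, Hom.mor_comp g h₂]

theorem naturalAt_inv {u u' : V.E} (h : V.Comm u u' (V.idn (V.dom u)))
    (h' : V.Comm u' u (V.idn (V.cod u))) (n : NaturalAt γ u) : NaturalAt γ u' := by
  have hd : V.dom u' = V.cod u := h.cod_left.symm
  have hc : V.cod u' = V.dom u := h'.cod_left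
  refine .of_eq (hX := hd) (hY := hc) ?_
  have e₁ := Hom.mor_comp g h (hX := rfl) (hY := rfl) (hY' := hd) (hZ := hc)
    (hX' := V.dom_idn _) (hZ' := V.cod_idn _)
  have e₂ := Hom.mor_comp f h' (hX := hd) (hY := hc) (hY' := rfl) (hZ := rfl)
    (hX' := V.dom_idn _) (hZ' := V.cod_idn _)
  rw [Hom.mor_idn] at e₁ e₂
  rw [← Category.comp_id (_ ≫ _), ← e₁, Category.assoc, ← Category.assoc (γ _), ← n,
    Category.assoc, reassoc_of% e₂]

section Conj

variable (γ) [∀ X, IsIso (γ X)]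

/-- The image of an edge under `f`, conjugated by `γ`. -/
noncomputable def conj {X Y : V.N} (u : V.E) (hX : V.dom u = X) (hY : V.cod u = Y) :
    Obj.of (g.node X) ⟶ Obj.of (g.node Y) := inv (γ X) ≫ Hom.mor f u hX hY ≫ γ Y

variable {γ}

theorem conj_comp {X Y Z : V.N} {u v w : V.E} (h : V.Comm u v w)
    {hX : V.dom u = X} {hY : V.cod u = Y} {hY' : V.dom v = Y} {hZ : V.cod v = Z}
    {hX' : V.dom w = X} {hZ' : V.cod w = Z} :
    conj γ u hX hY ≫ conj γ v hY' hZ = conj γ w hX' hZ' := by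
  simp only [conj, Category.assoc, IsIso.hom_inv_id_assoc]
  rw [← Category.assoc (Hom.mor f u _ _), Hom.mor_comp f h]

theorem naturalAt_iff_conj {X Y : V.N} {u : V.E} {hX : V.dom u = X} {hY : V.cod u = Y} :
    NaturalAt γ u ↔ conj γ u hX hY = Hom.mor g u hX hY := by
  rw [conj, IsIso.inv_comp_eq]
  exact ⟨fun h => h hX hY, fun h => .of_eq h⟩

end Conj

/-- Conjugating the image of the solution under `f` by the isomorphisms `γ` gives a solution for the
image of the data under `g`, as `γ` is natural at the data. Uniqueness of list recursion identifies
it with the image of `r` under `g`, which says that `γ` is natural at `r`. The other four edges are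
composites or a pullback fillin. -/
theorem naturalAt_recFill [∀ X, IsIso (γ X)]
    {p₁ p₂ ε k q₁ q₂ π₁ π₂ s₁ s₂ z₁ z₂ y g₀ i κ a r r' r'' g' g'' : V.E}
    (hd : V.RecData p₁ p₂ ε k q₁ q₂ π₁ π₂ s₁ s₂ z₁ z₂ y g₀ i κ a)
    (hr : V.RecSol s₁ s₂ z₁ z₂ y g₀ i κ a r r' r'' g' g'') (ns₁ : NaturalAt γ s₁)
    (ns₂ : NaturalAt γ s₂) (nz₁ : NaturalAt γ z₁) (nz₂ : NaturalAt γ z₂) (ny : NaturalAt γ y)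
    (ng : NaturalAt γ g₀) (ni : NaturalAt γ i) (nκ : NaturalAt γ κ) (na : NaturalAt γ a) :
    NaturalAt γ r ∧ NaturalAt γ r' ∧ NaturalAt γ r'' ∧ NaturalAt γ g' ∧ NaturalAt γ g'' := by
  -- `w u` represents the conjugate of the image of `u` under `f`. Where `γ` is natural, the image
  -- of `u` under `g` itself is chosen, so that the conjugated solution has literally the data of
  -- `g`.
  have key : ∀ u : V.E, ∃ (w : M.E) (hX : M.dom w = g.node (V.dom u))
      (hY : M.cod w = g.node (V.cod u)), mor w hX hY = conj γ u rfl rfl ∧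
      (NaturalAt γ u → w = g.edge u) := by
    intro u
    by_cases h : NaturalAt γ u
    · exact ⟨g.edge u, (g.map_dom u).symm, (g.map_cod u).symm, (naturalAt_iff_conj.1 h).symm,
        fun _ => rfl⟩
    · obtain ⟨w, hX, hY, hw⟩ := exists_mor (conj γ u rfl rfl)
      exact ⟨w, hX, hY, hw, fun h' => absurd h' h⟩
  choose w hX hY hw hn using key
  have hc : ∀ {u v x : V.E}, V.Comm u v x → M.Comm (w u) (w v) (w x) := by
    intro u v x h
    have hv : M.dom (w v) = g.node (V.cod u) := by rw [hX, h.cod_left]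
    have hx : M.dom (w x) = g.node (V.dom u) := by rw [hX, h.dom_eq]
    have hx' : M.cod (w x) = g.node (V.cod v) := by rw [hY, h.cod_eq]
    refine (mor_comp_eq_iff (hX := hX u) (hY := hY u) (hY' := hv) (hZ := hY v) (hX' := hx)
      (hZ' := hx')).1 ?_
    have e : ∀ {u : V.E} {X Y : V.N} (h₁ : V.dom u = X) (h₂ : V.cod u = Y)
        {h₃ : M.dom (w u) = g.node X} {h₄ : M.cod (w u) = g.node Y},
        mor (w u) h₃ h₄ = conj γ u h₁ h₂ := by
      rintro u X Y rfl rfl h₃ h₄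
      exact hw u
    rw [e rfl rfl, e h.cod_left.symm rfl, e h.dom_eq h.cod_eq]
    exact conj_comp h
  have hs : M.RecSol (g.edge s₁) (g.edge s₂) (g.edge z₁) (g.edge z₂) (g.edge y) (g.edge g₀)
      (g.edge i) (g.edge κ) (g.edge a) (w r) (w r') (w r'') (w g') (w g'') := by
    rw [← hn _ ns₁, ← hn _ ns₂, ← hn _ nz₁, ← hn _ nz₂, ← hn _ ny, ← hn _ ng, ← hn _ ni, ← hn _ nκ,
      ← hn _ na]
    exact ⟨hc hr.base, hc hr.step₁, hc hr.step₂, hc hr.step₃, hc hr.fst, hc hr.snd₁, hc hr.snd₂⟩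
  have nr : NaturalAt γ r := by
    refine (naturalAt_iff_conj (hX := rfl) (hY := rfl)).2 ((hw r).symm.trans (mor_eq_iff.2 ?_))
    exact Saturated.saturates.recUniq _ _ _ _ _ _ _ _ _ _ _ _ _ _ _ _ _ (hd.map g) _ _
      ⟨_, _, _, _, hs⟩ ⟨_, _, _, _, hr.map g⟩
  have nr'' := naturalAt_comp hr.snd₂ ns₂ nr
  obtain ⟨_, _, hz, -⟩ := hd.prodAY
  have nr' := naturalAt_pbFill hz hr.fst hr.snd₁ nz₁ nz₂ ns₁ nr''
  exact ⟨nr, nr', nr'', naturalAt_comp hr.step₃ nr' ng, naturalAt_comp hr.step₁ nκ nr⟩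

/-- The diagonals of a 2-cell are recovered from naturality, since equal composites have a common
representing edge. -/
theorem objectEquality_iff : ObjectEquality f g ↔
    ∃ γ : ∀ X, Obj.of (f.node X) ⟶ Obj.of (g.node X), (∀ X, IsObjEq (γ X)) ∧
      ∀ u, NaturalAt γ u := by
  constructor
  · rintro ⟨α, hα⟩
    refine ⟨fun X => Sketch.mor (α.carrier X) (α.dom_carrier X) (α.cod_carrier X),
      fun X => (hα X).isObjEq _ _, fun u => .of_eq (hX := rfl) (hY := rfl) ?_⟩
    have h₀ := α.comm₀ u
    have h₁ := α.comm₁ u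
    have hd : M.dom (α.diag u) = f.node (V.dom u) := by rw [h₀.dom_eq, f.map_dom]
    have hc : M.cod (α.diag u) = g.node (V.cod u) := by rw [h₁.cod_eq, g.map_cod]
    exact (h₀.mor_comp (hX' := hd) (hZ' := hc)).trans h₁.mor_comp.symm
  · rintro ⟨γ, h, n⟩
    choose c hX hY hc using fun X => exists_mor (γ X)
    have : ∀ u, ∃ d, M.Comm (f.edge u) (c (V.cod u)) d ∧ M.Comm (c (V.dom u)) (g.edge u) d := by
      intro u
      have := n u rfl rfl
      rw [← hc, ← hc] at this
      exact exists_comm_of_eq this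
    choose d h₀ h₁ using this
    exact ⟨⟨c, d, hX, hY, h₀, h₁⟩, fun X => (h X).objEq (hc X).symm⟩

end Sketch

/-! ### Object equality is an equivalence relation on homomorphisms into a saturated sketch. -/

section

variable {V M : Sketch} [Saturated M] {f g h : V ⟶ M}

open Sketch

/-- The carriers are identity edges. Even reflexivity uses saturation, which provides the unit
commutativities for the squares. -/
theorem ObjectEquality.of_same (h : Sketch.Hom.Same f g) : ObjectEquality f g := by
  refine ⟨⟨fun X => M.idn (f.node X), f.edge, fun X => M.dom_idn _, fun X => ?_, fun u => ?_,
    fun u => ?_⟩, fun X => .refl ?_ ?_⟩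
  · rw [M.cod_idn, h.1]
  · rw [f.map_cod]; exact comm_unitRight _
  · rw [← h.2, f.map_dom]; exact comm_unitLeft _
  · rw [M.dom_idn, M.cod_idn]
  · rw [M.dom_idn]; exact UComm.refl _

theorem ObjectEquality.symm (h : ObjectEquality f g) : ObjectEquality g f := by
  obtain ⟨γ, hγ, n⟩ := objectEquality_iff.1 h
  choose δ h₁ h₂ hδ using fun X => (hγ X).exists_inv
  refine objectEquality_iff.2 ⟨δ, hδ, fun u => .of_eq (hX := rfl) (hY := rfl) ?_⟩
  rw [← Category.id_comp (_ ≫ _), ← h₂, Category.assoc, ← Category.assoc (γ _), ← n u,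
    Category.assoc, h₁, Category.comp_id]

theorem ObjectEquality.trans (hM : Function.Injective M.subject) (h₁ : ObjectEquality f g)
    (h₂ : ObjectEquality g h) : ObjectEquality f h := by
  obtain ⟨γ, hγ, n⟩ := objectEquality_iff.1 h₁
  obtain ⟨δ, hδ, m⟩ := objectEquality_iff.1 h₂
  refine objectEquality_iff.2 ⟨fun X => γ X ≫ δ X, fun X => (hγ X).comp hM (hδ X), fun u =>
    .of_eq (hX := rfl) (hY := rfl) ?_⟩
  rw [← Category.assoc, n u, Category.assoc, m u, Category.assoc]

end

end AUSketch

namespace AUSketch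

/-! ### Extending object equalities along equivalence extensions -/

theorem IsCoprod.bijective {α β : Type} {e : α → β} {s : List β} (h : IsCoprod e s) :
    Function.Bijective (Sum.elim e s.get) := by
  obtain ⟨hi, hn, hm⟩ := h
  refine ⟨hi.sumElim (List.nodup_iff_injective_get.1 hn) fun a i => ?_, fun b => ?_⟩
  · rintro h
    exact (hm _).1 (List.get_mem s i) ⟨a, h⟩
  · by_cases hb : b ∈ s
    · obtain ⟨i, rfl⟩ := List.get_of_mem hb
      exact ⟨.inr i, rfl⟩
    · obtain ⟨a, rfl⟩ := not_not.1 (mt (hm b).2 hb)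
      exact ⟨.inl a, rfl⟩

/-- A dependent function on a coproduct is determined by arbitrary values on the summands. -/
theorem IsCoprod.exists_section {α β : Type} {e : α → β} {s : List β} (h : IsCoprod e s)
    {H : β → Type*} (x : ∀ a, H (e a)) (y : ∀ i, H (s.get i)) :
    ∃ γ : ∀ b, H b, (∀ a, γ (e a) = x a) ∧ ∀ i, γ (s.get i) = y i := by
  let φ := Equiv.ofBijective _ h.bijective
  refine ⟨Equiv.piCongrLeft H φ (Sum.rec x y), fun a => ?_, fun i => ?_⟩
  · exact Equiv.piCongrLeft_apply_apply H φ _ (.inl a)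
  · exact Equiv.piCongrLeft_apply_apply H φ _ (.inr i)

theorem IsCoprod.cases {α β : Type} {e : α → β} {s : List β} (h : IsCoprod e s) {Q : β → Prop}
    (h₁ : ∀ a, Q (e a)) (h₂ : ∀ b ∈ s, Q b) (b : β) : Q b := by
  by_cases hb : b ∈ s
  · exact h₂ b hb
  · obtain ⟨a, rfl⟩ := not_not.1 (mt (h.2.2 b).2 hb)
    exact h₁ a

section

variable {U V M : Sketch} [Saturated M] {e : U ⟶ V} {f g : V ⟶ M}

open Sketch

/-- A family of morphisms that is natural for the given edges is natural for all edges, when it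
is for the fresh ones. -/
theorem objectEquality_of_extension {δ : Fresh V} (h : ProtoExt e δ)
    {γ₀ : ∀ X, Obj.of ((e ≫ f).node X) ⟶ Obj.of ((e ≫ g).node X)} (h₀ : ∀ X, IsObjEq (γ₀ X))
    (n₀ : ∀ u, NaturalAt γ₀ u) (γ : ∀ X, Obj.of (f.node X) ⟶ Obj.of (g.node X))
    (hγ : ∀ X, γ (e.node X) = γ₀ X) (h₁ : ∀ X ∈ δ.node, IsObjEq (γ X))
    (n₁ : (∀ u, NaturalAt γ (e.edge u)) → (∀ X, IsObjEq (γ X)) → ∀ u ∈ δ.edge, NaturalAt γ u) :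
    ObjectEquality f g := by
  have hn : ∀ u, NaturalAt γ (e.edge u) := fun u => by
    refine .of_eq (hX := (e.map_dom u).symm) (hY := (e.map_cod u).symm) ?_
    rw [hγ, hγ]
    exact n₀ u rfl rfl
  have ho : ∀ X, IsObjEq (γ X) := h.node.cases (fun X => by rw [hγ]; exact h₀ X) h₁
  exact objectEquality_iff.2 ⟨γ, ho, h.edge.cases hn (n₁ hn ho)⟩

/-- The universal property of the image under `g` (under `f` for initial objects and pushouts)
provides the component at the fresh subject. It is an object equality by the matching constructor of
`IsObjEq`, and the equations defining it are naturality at the fresh structure edges. -/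
theorem ObjectEquality.of_addsUniversal (he : AddsUniversal e)
    (h : ObjectEquality (e ≫ f) (e ≫ g)) : ObjectEquality f g := by
  obtain ⟨γ₀, h₀, n₀⟩ := objectEquality_iff.1 h
  cases he with
  | term w he =>
    have hT : V.Term (V.tn w) := ⟨w, rfl⟩
    obtain ⟨t⟩ := (isFinal (hT.map g)).exists_hom (Obj.of (f.node (V.tn w)))
    obtain ⟨γ, hγ, hγ'⟩ := he.node.exists_section
      (H := fun X => Obj.of (f.node X) ⟶ Obj.of (g.node X)) γ₀ (Fin.cases t fun i => i.elim0)
    refine objectEquality_of_extension he h₀ n₀ γ hγ ?_ ?_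
    · simp only [List.mem_singleton, forall_eq]
      exact .term _ (hT.map f) (hT.map g)
    · intro _ _
      simp only [List.mem_singleton, forall_eq]
      exact naturalAt_idn _
  | init0 w he =>
    have hT : V.Init0 (V.in0 w) := ⟨w, rfl⟩
    obtain ⟨t⟩ := exists_hom_of_init0 (hT.map f) (Obj.of (g.node (V.in0 w)))
    obtain ⟨γ, hγ, hγ'⟩ := he.node.exists_section
      (H := fun X => Obj.of (f.node X) ⟶ Obj.of (g.node X)) γ₀ (Fin.cases t fun i => i.elim0)
    refine objectEquality_of_extension he h₀ n₀ γ hγ ?_ ?_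
    · simp only [List.mem_singleton, forall_eq]
      exact .init0 _ (hT.map f) (hT.map g)
    · intro _ _
      simp only [List.mem_singleton, forall_eq]
      exact naturalAt_idn _
  | pb u₁ u₂ w hu h₁ h₂ he =>
    have hw : V.Pb (V.l (V.pb1 w)) (V.l (V.pb2 w)) (e.edge u₁) (e.edge u₂) :=
      ⟨w, rfl, rfl, h₁, h₂⟩
    have c₁ : V.Comm (V.l (V.pb1 w)) (e.edge u₁) (V.c (V.pb1 w)) := ⟨V.pb1 w, rfl, h₁, rfl⟩
    have c₂ : V.Comm (V.l (V.pb2 w)) (e.edge u₂) (V.c (V.pb1 w)) :=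
      ⟨V.pb2 w, rfl, h₂, (V.c_pb w).symm⟩
    have a₁ : V.dom (V.l (V.pb1 w)) = V.dom (V.c (V.pb1 w)) := c₁.dom_eq.symm
    have a₂ : V.dom (V.l (V.pb2 w)) = V.dom (V.c (V.pb1 w)) := c₂.dom_eq.symm
    have b₁ : V.cod (V.l (V.pb1 w)) = e.node (U.dom u₁) := by rw [c₁.cod_left, e.map_dom]
    have b₂ : V.cod (V.l (V.pb2 w)) = e.node (U.dom u₂) := by rw [c₂.cod_left, e.map_dom]
    have d₁ := (e.map_dom u₁).symm
    have d₂ := (e.map_dom u₂).symm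
    have d₃ := (e.map_cod u₁).symm
    have d₄ : V.cod (e.edge u₂) = e.node (U.cod u₁) := by rw [hu, e.map_cod]
    have Pf := hw.pbMor f (h₁ := a₁) (h₂ := b₁) (h₃ := a₂) (h₄ := b₂) (h₅ := d₁) (h₆ := d₃)
      (h₇ := d₂) (h₈ := d₄)
    have Pg := hw.pbMor g (h₁ := a₁) (h₂ := b₁) (h₃ := a₂) (h₄ := b₂) (h₅ := d₁) (h₆ := d₃)
      (h₇ := d₂) (h₈ := d₄)
    have m₁ : Hom.mor f _ d₁ d₃ ≫ γ₀ _ = γ₀ _ ≫ Hom.mor g _ d₁ d₃ := n₀ u₁ rfl rfl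
    have m₂ : Hom.mor f _ d₂ d₄ ≫ γ₀ _ = γ₀ _ ≫ Hom.mor g _ d₂ d₄ := n₀ u₂ rfl hu.symm
    obtain ⟨t, t₁, t₂⟩ : ∃ t, t ≫ Hom.mor g _ a₁ b₁ = Hom.mor f _ a₁ b₁ ≫ γ₀ (U.dom u₁) ∧
        t ≫ Hom.mor g _ a₂ b₂ = Hom.mor f _ a₂ b₂ ≫ γ₀ (U.dom u₂) :=
      ⟨Pg.isPullback.lift (Hom.mor f _ a₁ b₁ ≫ γ₀ (U.dom u₁)) (Hom.mor f _ a₂ b₂ ≫ γ₀ (U.dom u₂))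
        (by rw [Category.assoc, Category.assoc, ← m₁, ← m₂, reassoc_of% Pf.isPullback.w]),
        Pg.isPullback.lift_fst _ _ _, Pg.isPullback.lift_snd _ _ _⟩
    obtain ⟨γ, hγ, hγ'⟩ := he.node.exists_section
      (H := fun X => Obj.of (f.node X) ⟶ Obj.of (g.node X)) γ₀ (Fin.cases t fun i => i.elim0)
    have ht : γ (V.dom (V.c (V.pb1 w))) = t := hγ' 0
    refine objectEquality_of_extension he h₀ n₀ γ hγ ?_ ?_
    · simp only [List.mem_singleton, forall_eq]
      rw [ht]
      exact .pb Pf Pg (h₀ _) (h₀ _) (h₀ _) m₁ m₂ t₁ t₂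
    · intro hn _
      have k₁ : NaturalAt γ (V.l (V.pb1 w)) := .of_eq (hX := a₁) (hY := b₁) (by rw [hγ, ht, t₁])
      have k₂ : NaturalAt γ (V.l (V.pb2 w)) := .of_eq (hX := a₂) (hY := b₂) (by rw [hγ, ht, t₂])
      simp only [List.mem_cons, List.not_mem_nil, or_false, forall_eq_or_imp, forall_eq]
      exact ⟨k₁, naturalAt_comp c₁ k₁ (hn _), k₂, naturalAt_idn _⟩
  | po u₁ u₂ w hu h₁ h₂ he =>
    have hw : V.Po (V.r (V.po1 w)) (V.r (V.po2 w)) (e.edge u₁) (e.edge u₂) :=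
      ⟨w, rfl, rfl, h₁, h₂⟩
    have c₁ : V.Comm (e.edge u₁) (V.r (V.po1 w)) (V.c (V.po1 w)) := ⟨V.po1 w, h₁, rfl, rfl⟩
    have c₂ : V.Comm (e.edge u₂) (V.r (V.po2 w)) (V.c (V.po1 w)) :=
      ⟨V.po2 w, h₂, rfl, (V.c_po w).symm⟩
    have a₁ : V.cod (V.r (V.po1 w)) = V.cod (V.c (V.po1 w)) := c₁.cod_eq.symm
    have a₂ : V.cod (V.r (V.po2 w)) = V.cod (V.c (V.po1 w)) := c₂.cod_eq.symm
    have b₁ : V.dom (V.r (V.po1 w)) = e.node (U.cod u₁) := by rw [← c₁.cod_left, e.map_cod]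
    have b₂ : V.dom (V.r (V.po2 w)) = e.node (U.cod u₂) := by rw [← c₂.cod_left, e.map_cod]
    have d₁ := (e.map_cod u₁).symm
    have d₂ := (e.map_cod u₂).symm
    have d₃ := (e.map_dom u₁).symm
    have d₄ : V.dom (e.edge u₂) = e.node (U.dom u₁) := by rw [hu, e.map_dom]
    have Pf := hw.poMor f (h₁ := b₁) (h₂ := a₁) (h₃ := b₂) (h₄ := a₂) (h₅ := d₃) (h₆ := d₁)
      (h₇ := d₄) (h₈ := d₂)
    have Pg := hw.poMor g (h₁ := b₁) (h₂ := a₁) (h₃ := b₂) (h₄ := a₂) (h₅ := d₃) (h₆ := d₁)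
      (h₇ := d₄) (h₈ := d₂)
    have m₁ : Hom.mor f _ d₃ d₁ ≫ γ₀ _ = γ₀ _ ≫ Hom.mor g _ d₃ d₁ := n₀ u₁ rfl rfl
    have m₂ : Hom.mor f _ d₄ d₂ ≫ γ₀ _ = γ₀ _ ≫ Hom.mor g _ d₄ d₂ := n₀ u₂ hu.symm rfl
    obtain ⟨t, t₁, t₂⟩ : ∃ t, Hom.mor f _ b₁ a₁ ≫ t = γ₀ (U.cod u₁) ≫ Hom.mor g _ b₁ a₁ ∧
        Hom.mor f _ b₂ a₂ ≫ t = γ₀ (U.cod u₂) ≫ Hom.mor g _ b₂ a₂ :=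
      ⟨Pf.isPushout.desc (γ₀ (U.cod u₁) ≫ Hom.mor g _ b₁ a₁) (γ₀ (U.cod u₂) ≫ Hom.mor g _ b₂ a₂)
        (by rw [reassoc_of% m₁, reassoc_of% m₂, Pg.isPushout.w]),
        Pf.isPushout.inl_desc _ _ _, Pf.isPushout.inr_desc _ _ _⟩
    obtain ⟨γ, hγ, hγ'⟩ := he.node.exists_section
      (H := fun X => Obj.of (f.node X) ⟶ Obj.of (g.node X)) γ₀ (Fin.cases t fun i => i.elim0)
    have ht : γ (V.cod (V.c (V.po1 w))) = t := hγ' 0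
    refine objectEquality_of_extension he h₀ n₀ γ hγ ?_ ?_
    · simp only [List.mem_singleton, forall_eq]
      rw [ht]
      exact .po Pf Pg (h₀ _) (h₀ _) (h₀ _) m₁ m₂ t₁ t₂
    · intro hn _
      have k₁ : NaturalAt γ (V.r (V.po1 w)) := .of_eq (hX := b₁) (hY := a₁) (by rw [hγ, ht, t₁])
      have k₂ : NaturalAt γ (V.r (V.po2 w)) := .of_eq (hX := b₂) (hY := a₂) (by rw [hγ, ht, t₂])
      simp only [List.mem_cons, List.not_mem_nil, or_false, forall_eq_or_imp, forall_eq]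
      exact ⟨k₁, naturalAt_comp c₁ (hn _) k₁, k₂, naturalAt_idn _⟩
  | lst A w hA he =>
    have hw : V.Lst (V.l (V.pb1 (V.lpb w))) (V.l (V.pb2 (V.lpb w))) (V.le w) (V.lcons w) :=
      ⟨w, rfl, rfl, rfl, rfl⟩
    have hp : V.Pb (V.l (V.pb1 (V.lpb w))) (V.l (V.pb2 (V.lpb w))) (V.r (V.pb1 (V.lpb w)))
      (V.r (V.pb2 (V.lpb w))) := ⟨V.lpb w, rfl, rfl, rfl, rfl⟩
    have c₁ : V.Comm (V.l (V.pb1 (V.lpb w))) (V.r (V.pb1 (V.lpb w))) (V.c (V.pb1 (V.lpb w))) :=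
      ⟨_, rfl, rfl, rfl⟩
    have c₂ : V.Comm (V.l (V.pb2 (V.lpb w))) (V.r (V.pb2 (V.lpb w))) (V.c (V.pb1 (V.lpb w))) :=
      ⟨_, rfl, rfl, (V.c_pb _).symm⟩
    have e₁ : V.dom (V.l (V.pb1 (V.lpb w))) = V.dom (V.lcons w) := hw.dom_cons.symm
    have e₂ : V.dom (V.l (V.pb2 (V.lpb w))) = V.dom (V.lcons w) := hp.dom_eq.symm.trans e₁
    have e₃ : V.cod (V.l (V.pb2 (V.lpb w))) = V.cod (V.le w) := hw.cod_nil.symm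
    have e₄ : V.cod (V.lcons w) = V.cod (V.le w) := hw.cod_cons.trans e₃
    have e₅ : V.dom (V.r (V.pb1 (V.lpb w))) = e.node A := c₁.cod_left.symm.trans hA
    have e₆ : V.cod (V.c (V.pb1 (V.lpb w))) = V.dom (V.le w) := by rw [V.cod_c_lpb, V.dom_le]
    have e₇ : V.cod (V.r (V.pb1 (V.lpb w))) = V.dom (V.le w) := c₁.cod_eq.symm.trans e₆
    have e₈ : V.dom (V.r (V.pb2 (V.lpb w))) = V.cod (V.le w) := c₂.cod_left.symm.trans e₃
    have e₉ : V.cod (V.r (V.pb2 (V.lpb w))) = V.dom (V.le w) := c₂.cod_eq.symm.trans e₆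
    have hT : V.Term (V.dom (V.le w)) := hw.term
    have Lf := hw.lstMor f (h₁ := e₁) (h₂ := hA) (h₃ := e₂) (h₄ := e₃) (h₅ := rfl) (h₆ := rfl)
      (h₇ := rfl) (h₈ := e₄)
    have Lg := hw.lstMor g (h₁ := e₁) (h₂ := hA) (h₃ := e₂) (h₄ := e₃) (h₅ := rfl) (h₆ := rfl)
      (h₇ := rfl) (h₈ := e₄)
    have Pf := hp.pbMor f (h₁ := e₁) (h₂ := hA) (h₃ := e₂) (h₄ := e₃) (h₅ := e₅) (h₆ := e₇)
      (h₇ := e₈) (h₈ := e₉)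
    have Pg := hp.pbMor g (h₁ := e₁) (h₂ := hA) (h₃ := e₂) (h₄ := e₃) (h₅ := e₅) (h₆ := e₇)
      (h₇ := e₈) (h₈ := e₉)
    -- The list map over the component at `A` supplies the components at all three fresh nodes,
    -- which are listed in the order `T`, `L`, `P`.
    obtain ⟨b, t, p, hm⟩ := Lf.isListObject.exists_isListMap Lg.isListObject (γ₀ A)
    obtain ⟨γ, hγ, hγ'⟩ := he.node.exists_section
      (H := fun X => Obj.of (f.node X) ⟶ Obj.of (g.node X)) γ₀
      (Fin.cases t (Fin.cases b (Fin.cases p fun i => i.elim0)))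
    have ht : γ (V.dom (V.le w)) = t := hγ' 0
    have hb : γ (V.cod (V.le w)) = b := hγ' 1
    have hp' : γ (V.dom (V.lcons w)) = p := hγ' 2
    have ot : IsObjEq t := .term _ (hT.map f) (hT.map g)
    have ob : IsObjEq b := .lst Lf Lg (h₀ A) hm
    refine objectEquality_of_extension he h₀ n₀ γ hγ ?_ ?_
    · simp only [List.mem_cons, List.not_mem_nil, or_false, forall_eq_or_imp, forall_eq]
      rw [ht, hb, hp']
      -- `P` is the subject of the pullback universal of the list universal, so its component is an
      -- object equality of pullback type, over those at `A`, `L` and `T`.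
      exact ⟨ot, ob, .pb Pf Pg (h₀ A) ob ot ((isFinal (hT.map g)).ext _ _)
        ((isFinal (hT.map g)).ext _ _) hm.fst hm.snd⟩
    · intro hn _
      simp only [List.mem_cons, List.not_mem_nil, or_false, forall_eq_or_imp, forall_eq]
      refine ⟨.of_eq (hX := rfl) (hY := rfl) ?_, .of_eq (hX := rfl) (hY := e₄) ?_,
        .of_eq (hX := e₁) (hY := hA) ?_, naturalAt_of_term (e₆ ▸ hT),
        .of_eq (hX := e₂) (hY := e₃) ?_, naturalAt_of_term (e₇ ▸ hT),
        naturalAt_of_term (e₉ ▸ hT), naturalAt_idn _, naturalAt_idn _, naturalAt_idn _⟩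
      · rw [ht, hb]; exact hm.nil
      · rw [hp', hb]; exact hm.cons
      · rw [hp', hγ]; exact hm.fst.symm
      · rw [hp', hb]; exact hm.snd.symm

/-- When no node is fresh, a family of object equalities is extended by naturality at the fresh
edges. -/
theorem ObjectEquality.of_edges {δ : Fresh V} (he : ProtoExt e δ) (hδ : δ.node = [])
    (h : ObjectEquality (e ≫ f) (e ≫ g))
    (H : ∀ γ : ∀ X, Obj.of (f.node X) ⟶ Obj.of (g.node X), (∀ X, IsIso (γ X)) →
      (∀ u, NaturalAt γ (e.edge u)) → ∀ u ∈ δ.edge, NaturalAt γ u) : ObjectEquality f g := by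
  obtain ⟨γ₀, h₀, n₀⟩ := objectEquality_iff.1 h
  obtain ⟨γ, hγ, -⟩ := he.node.exists_section
    (H := fun X => Obj.of (f.node X) ⟶ Obj.of (g.node X)) γ₀ (by rw [hδ]; exact fun i => i.elim0)
  refine objectEquality_of_extension he h₀ n₀ γ hγ (by simp [hδ]) fun hn ho => ?_
  exact H γ (fun X => (ho X).isIso) hn

theorem ObjectEquality.of_addsComm {u v w : U.E} (he : AddsComm e u v w)
    (h : ObjectEquality (e ≫ f) (e ≫ g)) : ObjectEquality f g := by
  obtain ⟨t, -, he⟩ := he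
  exact .of_edges he rfl h fun γ _ _ => by simp

theorem ObjectEquality.of_addsInverse {u : U.E} (he : AddsInverse e u)
    (h : ObjectEquality (e ≫ f) (e ≫ g)) : ObjectEquality f g := by
  obtain ⟨u', t, t', h₁, h₂, he⟩ := he
  refine .of_edges he rfl h fun γ _ hn => ?_
  simp only [List.mem_singleton, forall_eq]
  refine naturalAt_inv (u := e.edge u) ⟨t, ?_⟩ ⟨t', ?_⟩ (hn u)
  · rwa [← e.map_dom]
  · rwa [← e.map_cod]

/-- Each rule determines its fresh edges by natural ones, so naturality extends. Balance, stability
and exactness adjoin inverses, which are natural where the inverted edge is; a fresh commutativity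
between given edges imposes no condition. -/
theorem ObjectEquality.of_simpleEquivExt (he : SimpleEquivExt e)
    (h : ObjectEquality (e ≫ f) (e ≫ g)) : ObjectEquality f g := by
  cases he with
  | composite u v w t _ ht he =>
    refine .of_edges he rfl h fun γ _ hn => ?_
    simp only [List.mem_singleton, forall_eq]
    exact naturalAt_comp ⟨t, ht⟩ (hn u) (hn v)
  | unitLeft u he => exact h.of_addsComm he
  | unitRight u he => exact h.of_addsComm he
  | assocLeft u v w k l m _ _ _ he => exact h.of_addsComm he
  | assocRight u v w k l m _ _ _ he => exact h.of_addsComm he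
  | universal he => exact h.of_addsUniversal he
  | termFill X T w hT _ hc he =>
    refine .of_edges he rfl h fun γ _ hn => ?_
    simp only [List.mem_singleton, forall_eq]
    exact naturalAt_of_term (hc ▸ hT.map e)
  | termUniq w w' _ _ _ he => exact h.of_addsComm he
  | initFill X T w hT hd _ he =>
    refine .of_edges he rfl h fun γ _ hn => ?_
    simp only [List.mem_singleton, forall_eq]
    exact naturalAt_of_init0 (hd ▸ hT.map e)
  | initUniq w w' _ _ _ he => exact h.of_addsComm he
  | pbFill p₁ p₂ u₁ u₂ v₁ v₂ v w t₁ t₂ hp _ _ h₁ h₂ he =>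
    refine .of_edges he rfl h fun γ _ hn => ?_
    simp only [List.mem_singleton, forall_eq]
    exact naturalAt_pbFill (hp.map e) ⟨t₁, h₁⟩ ⟨t₂, h₂⟩ (hn _) (hn _) (hn _) (hn _)
  | pbUniq p₁ p₂ u₁ u₂ v₁ v₂ w w' _ _ _ _ _ he => exact h.of_addsComm he
  | poFill p₁ p₂ u₁ u₂ v₁ v₂ v w t₁ t₂ hp _ _ h₁ h₂ he =>
    refine .of_edges he rfl h fun γ _ hn => ?_
    simp only [List.mem_singleton, forall_eq]
    exact naturalAt_poFill (hp.map e) ⟨t₁, h₁⟩ ⟨t₂, h₂⟩ (hn _) (hn _) (hn _) (hn _)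
  | poUniq p₁ p₂ u₁ u₂ v₁ v₂ w w' _ _ _ _ _ he => exact h.of_addsComm he
  | recFill p₁ p₂ ε k q₁ q₂ π₁ π₂ s₁ s₂ z₁ z₂ y g₀ i κ a r r' r'' g' g'' t₁ t₂ t₃ t₄ t₅ t₆ t₇
      hd h₁ h₂ h₃ h₄ h₅ h₆ h₇ he =>
    refine .of_edges he rfl h fun γ _ hn => ?_
    simp only [List.mem_cons, List.not_mem_nil, or_false, forall_eq_or_imp, forall_eq]
    exact naturalAt_recFill (hd.map e)
      ⟨⟨t₁, h₁⟩, ⟨t₂, h₂⟩, ⟨t₃, h₃⟩, ⟨t₄, h₄⟩, ⟨t₅, h₅⟩, ⟨t₆, h₆⟩, ⟨t₇, h₇⟩⟩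
      (hn _) (hn _) (hn _) (hn _) (hn _) (hn _) (hn _) (hn _) (hn _)
  | recUniq _ _ _ _ _ _ _ _ _ _ _ _ _ _ _ _ _ _ _ _ _ _ _ _ _ _ _ _ _ _ he =>
    exact h.of_addsComm he
  | balance _ _ _ _ _ _ _ _ _ he => exact h.of_addsInverse he
  | initStab _ _ he => exact h.of_addsInverse he
  | poStab _ _ _ _ _ _ _ _ _ _ _ _ _ _ _ _ _ _ he => exact h.of_addsInverse he
  | exactness _ _ _ _ _ _ _ he => exact h.of_addsInverse he

end

/-- An object equality between homomorphisms into a saturated sketch extends along an equivalence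
extension. -/
theorem IsEquivExt.objectEquality {U V : Sketch} {e : U ⟶ V} (he : IsEquivExt e) :
    ∀ {M : Sketch} [Saturated M] {f g : V ⟶ M}, ObjectEquality (e ≫ f) (e ≫ g) →
      ObjectEquality f g := by
  induction he with
  | iso e he =>
    intro M _ f g h
    simpa using h.precomp (inv e)
  | simple e he => intro M _ f g h; exact h.of_simpleEquivExt he
  | comp e e' _ _ ih ih' =>
    intro M _ f g h
    rw [Category.assoc, Category.assoc] at h
    exact ih' (ih h)

end AUSketch

namespace AUSketch

/-! ### Objective equality is a congruence -/

/-- The conditions on a 2-cell involve the homomorphisms only through their values on nodes and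
edges. -/
theorem ObjectEquality.congr {U V : Sketch} {f f' g g' : U ⟶ V} (h : ObjectEquality f g)
    (hf : Sketch.Hom.Same f f') (hg : Sketch.Hom.Same g g') : ObjectEquality f' g' := by
  obtain ⟨α, hα⟩ := h
  refine ⟨⟨α.carrier, α.diag, ?_, ?_, ?_, ?_⟩, hα⟩
  · rw [← hf.1]; exact α.dom_carrier
  · rw [← hg.1]; exact α.cod_carrier
  · rw [← hf.2]; exact α.comm₀
  · rw [← hg.2]; exact α.comm₁

namespace ContextMap

variable {R S T : Context}

/-- The refining homomorphisms are corrected on the remaining sorts, so that the triangles commute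
strictly and can be pasted with pushouts. -/
theorem ObjectivelyEqual.exists_strict {m n : ContextMap S T} (h : ObjectivelyEqual m n) :
    ∃ (W : Sketch) (e : S.sk ⟶ W) (ε₀ : m.apex ⟶ W) (ε₁ : n.apex ⟶ W), IsEquivExt e ∧
      m.ext ≫ ε₀ = e ∧ n.ext ≫ ε₁ = e ∧ ObjectEquality (m.hom ≫ ε₀) (n.hom ≫ ε₁) := by
  obtain ⟨W, e, ε₀, ε₁, he, h₀, h₁, h⟩ := h
  obtain ⟨δ₀, s₀, d₀⟩ := m.isEquivExt.exists_comp_eq e ε₀ h₀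
  obtain ⟨δ₁, s₁, d₁⟩ := n.isEquivExt.exists_comp_eq e ε₁ h₁
  exact ⟨W, e, δ₀, δ₁, he, d₀, d₁, h.congr (.comp ⟨rfl, rfl⟩ ⟨s₀.1.symm, s₀.2.symm⟩)
    (.comp ⟨rfl, rfl⟩ ⟨s₁.1.symm, s₁.2.symm⟩)⟩

/-- Objective equality may be tested in saturated sketches. -/
theorem objectivelyEqual_of_saturated {m n : ContextMap S T} {W : Sketch} {e : S.sk ⟶ W}
    (he : IsEquivExt e) (ε₀ : m.apex ⟶ W) (ε₁ : n.apex ⟶ W)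
    (h₀ : Sketch.Hom.Same (m.ext ≫ ε₀) e) (h₁ : Sketch.Hom.Same (n.ext ≫ ε₁) e)
    (H : ∀ (M : Sketch) [Saturated M] (ι : W ⟶ M), Function.Injective M.subject →
      ObjectEquality (m.hom ≫ ε₀ ≫ ι) (n.hom ≫ ε₁ ≫ ι)) : ObjectivelyEqual m n := by
  obtain ⟨M, ι, _, hM, h⟩ : ∃ (M : Sketch) (ι : W ⟶ M), Saturated M ∧
      Function.Injective M.subject ∧ ∀ (T : Context) (f g : T.sk ⟶ W),
        ObjectEquality (f ≫ ι) (g ≫ ι) →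
          ∃ (W' : Sketch) (d : W ⟶ W'), IsEquivExt d ∧ ObjectEquality (f ≫ d) (g ≫ d) :=
    (Context.ofEquivExt S e he).exists_saturation
  have hs := H M ι hM
  rw [← Category.assoc, ← Category.assoc] at hs
  -- The object equality in `M` already holds in an equivalence extension `d` of `W`, and `e ≫ d` is
  -- the common refinement.
  obtain ⟨W', d, hd, hW⟩ := h T _ _ hs
  rw [Category.assoc, Category.assoc] at hW
  refine ⟨W', e ≫ d, ε₀ ≫ d, ε₁ ≫ d, .comp _ _ he hd, ?_, ?_, hW⟩
  · rw [← Category.assoc]; exact h₀.comp ⟨rfl, rfl⟩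
  · rw [← Category.assoc]; exact h₁.comp ⟨rfl, rfl⟩

theorem SameOpspan.objectivelyEqual {m n : ContextMap S T} (h : SameOpspan m n) :
    ObjectivelyEqual m n := by
  obtain ⟨φ, h₁, h₂⟩ := h
  refine objectivelyEqual_of_saturated n.isEquivExt φ.hom (𝟙 _) h₁ ⟨rfl, rfl⟩
    fun M _ ι _ => .of_same ?_
  rw [← Category.assoc, Category.id_comp]
  exact h₂.comp ⟨rfl, rfl⟩

theorem ObjectivelyEqual.symm {m n : ContextMap S T} (h : ObjectivelyEqual m n) :
    ObjectivelyEqual n m := by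
  obtain ⟨W, e, ε₀, ε₁, he, h₀, h₁, h⟩ := h
  refine objectivelyEqual_of_saturated he ε₁ ε₀ h₁ h₀ fun M _ ι _ => ?_
  simpa only [Category.assoc] using (h.postcomp ι).symm

/-- The two refinements of `S` are combined by a pushout, in which the apex of `n` then has two
images. These agree on `S`, so the key lemma `IsEquivExt.objectEquality` links them over every
saturated sketch, where object equalities compose. -/
theorem ObjectivelyEqual.trans {m n p : ContextMap S T} (h : ObjectivelyEqual m n)
    (h' : ObjectivelyEqual n p) : ObjectivelyEqual m p := by
  obtain ⟨W, e, ε₀, ε₁, he, h₀, h₁, h⟩ := h.exists_strict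
  obtain ⟨W', e', ε₀', ε₁', he', h₀', h₁', h'⟩ := h'.exists_strict
  have hc := reindex_cond e e'
  refine objectivelyEqual_of_saturated (.comp _ _ he (he'.reindex e)) (ε₀ ≫ reindexExt e e')
    (ε₁' ≫ reindexHom e e') ?_ ?_ fun M _ ι hM => ?_
  · rw [reassoc_of% h₀]; exact ⟨rfl, rfl⟩
  · rw [reassoc_of% h₁', hc]; exact ⟨rfl, rfl⟩
  -- The two routes from the apex of `n` to `M` coincide after restriction along the equivalence
  -- extension `n.ext`.
  · have k : ObjectEquality (ε₁ ≫ reindexExt e e' ≫ ι) (ε₀' ≫ reindexHom e e' ≫ ι) := by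
      refine n.isEquivExt.objectEquality (.of_same ?_)
      rw [reassoc_of% h₁, reassoc_of% h₀', reassoc_of% hc]
      exact ⟨rfl, rfl⟩
    have k₁ := h.postcomp (reindexExt e e' ≫ ι)
    have k₂ := h'.postcomp (reindexHom e e' ≫ ι)
    simp only [Category.assoc] at k₁ k₂ ⊢
    exact (k₁.trans hM (k.precomp n.hom)).trans hM k₂

/-- The refinement `d` of `n` and `n'` is reindexed along both homomorphisms from `S` into `W`, and
a further pushout merges the results into one equivalence extension of `R`. The two maps from `Z`
into it are linked by the key lemma, since along `d` they restrict to the object-equal homomorphisms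
of `m` and `m'`. -/
theorem ObjectivelyEqual.comp {m m' : ContextMap R S} {n n' : ContextMap S T}
    (h : ObjectivelyEqual m m') (h' : ObjectivelyEqual n n') :
    ObjectivelyEqual (m.comp n) (m'.comp n') := by
  obtain ⟨W, e, ε₀, ε₁, he, h₀, h₁, h⟩ := h.exists_strict
  obtain ⟨Z, d, δ₀, δ₁, hd, h₀', h₁', h'⟩ := h'.exists_strict
  have c₁ := reindex_cond (m.hom ≫ ε₀) d
  have c₂ := reindex_cond (m'.hom ≫ ε₁) d
  have E₁ := hd.reindex (m.hom ≫ ε₀)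
  have E₂ := hd.reindex (m'.hom ≫ ε₁)
  generalize reindexExt (m.hom ≫ ε₀) d = x₁, reindexHom (m.hom ≫ ε₀) d = k₁ at c₁ E₁
  generalize reindexExt (m'.hom ≫ ε₁) d = x₂, reindexHom (m'.hom ≫ ε₁) d = k₂ at c₂ E₂
  have c := reindex_cond x₁ x₂
  have E := E₂.reindex x₁
  generalize reindexExt x₁ x₂ = y₁, reindexHom x₁ x₂ = y₂ at c E
  rw [Category.assoc] at c₁ c₂
  have hm := reindex_isPushout m.hom n.ext
  have hm' := reindex_isPushout m'.hom n'.ext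
  -- By these squares, the apexes of the two composites map into the common refinement.
  have w : m.hom ≫ ε₀ ≫ x₁ ≫ y₁ = n.ext ≫ δ₀ ≫ k₁ ≫ y₁ := by
    rw [reassoc_of% c₁, reassoc_of% h₀']
  have w' : m'.hom ≫ ε₁ ≫ x₂ ≫ y₂ = n'.ext ≫ δ₁ ≫ k₂ ≫ y₂ := by
    rw [reassoc_of% c₂, reassoc_of% h₁']
  refine objectivelyEqual_of_saturated (.comp _ _ he (.comp _ _ E₁ E))
    (hm.desc _ _ w) (hm'.desc _ _ w') ?_ ?_ fun M _ ι hM => ?_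
  · change Sketch.Hom.Same ((m.ext ≫ reindexExt m.hom n.ext) ≫ _) _
    rw [Category.assoc, hm.inl_desc, reassoc_of% h₀]
    exact ⟨rfl, rfl⟩
  · change Sketch.Hom.Same ((m'.ext ≫ reindexExt m'.hom n'.ext) ≫ _) _
    rw [Category.assoc, hm'.inl_desc, reassoc_of% h₁, c]
    exact ⟨rfl, rfl⟩
  · change ObjectEquality ((n.hom ≫ reindexHom m.hom n.ext) ≫ _ ≫ _)
      ((n'.hom ≫ reindexHom m'.hom n'.ext) ≫ _ ≫ _)
    rw [Category.assoc, Category.assoc, hm.inr_desc_assoc, hm'.inr_desc_assoc]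
    -- Restricted along `d`, this is the object equality between `m.hom ≫ ε₀` and `m'.hom ≫ ε₁`,
    -- followed by the map to `M`.
    have k : ObjectEquality (k₁ ≫ y₁ ≫ ι) (k₂ ≫ y₂ ≫ ι) := by
      refine hd.objectEquality ?_
      rw [← reassoc_of% c₁, ← reassoc_of% c₂, ← reassoc_of% c]
      simpa only [Category.assoc] using h.postcomp (x₁ ≫ y₁ ≫ ι)
    have l₁ := h'.postcomp (k₁ ≫ y₁ ≫ ι)
    have l₂ := k.precomp (n'.hom ≫ δ₁)
    simp only [Category.assoc] at l₁ l₂ ⊢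
    exact l₁.trans hM l₂

theorem Congr.objectivelyEqual {m n : ContextMap S T} (h : Congr m n) : ObjectivelyEqual m n := by
  induction h with
  | same h => exact h.objectivelyEqual
  | objEq h => exact h
  | symm _ ih => exact ih.symm
  | trans _ _ ih ih' => exact ih.trans ih'
  | comp _ _ ih ih' => exact ih.comp ih'

/-- The context map inverse to an equivalence extension. -/
def ofEquivExt (S T : Context) (e : S.sk ⟶ T.sk) (he : IsEquivExt e) : ContextMap S T :=
  ⟨T.sk, e, 𝟙 _, he⟩

end ContextMap

/-! ### Equivalence extensions become invertible in `Con`. -/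

namespace Con

variable {S T : Context}

theorem cls_eq_iff {m n : ContextMap S T} : cls m = cls n ↔ ContextMap.ObjectivelyEqual m n :=
  Iff.trans Quotient.eq ⟨fun h => ContextMap.Congr.objectivelyEqual h, fun h => .objEq h⟩

theorem incl_respectsObjectEquality : RespectsObjectEquality incl := by
  intro S T f g h
  exact cls_eq_iff.2 ⟨T.sk, 𝟙 T.sk, 𝟙 T.sk, 𝟙 T.sk, (ContextMap.ofHom f).isEquivExt, ⟨rfl, rfl⟩,
    ⟨rfl, rfl⟩, h.postcomp _⟩

theorem cls_ofEquivExt_comp_incl {e : S.sk ⟶ T.sk} (he : IsEquivExt e) {R : Context}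
    (f : R.sk ⟶ T.sk) : cls (ContextMap.ofEquivExt S T e he) ≫ incl.map (Context.ofHom f).op =
      cls (T := R) ⟨T.sk, e, f, he⟩ := by
  refine Quotient.sound (.same (ContextMap.comp_sameOpspan _ _ _ (𝟙 T.sk) (𝟙 T.sk) ?_ ?_ ?_))
  · change IsPushout (𝟙 T.sk) (𝟙 T.sk) (𝟙 T.sk) (𝟙 T.sk)
    exact IsPushout.of_vert_isIso ⟨rfl⟩
  · exact Category.comp_id _
  · exact Category.comp_id _

/-- The composite consists of the two legs of the pushout of `e` along itself. They agree on `S`, so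
by the key lemma they are object-equal in every saturated sketch. -/
theorem incl_comp_cls_ofEquivExt {e : S.sk ⟶ T.sk} (he : IsEquivExt e) :
    incl.map (Context.ofHom e).op ≫ cls (ContextMap.ofEquivExt S T e he) = 𝟙 (Con.of T) := by
  refine cls_eq_iff.2 (ContextMap.objectivelyEqual_of_saturated (he.reindex e) (𝟙 _)
    (reindexExt e e) ⟨rfl, rfl⟩ ⟨rfl, rfl⟩ fun M _ ι _ => ?_)
  change ObjectEquality (reindexHom e e ≫ ι) (reindexExt e e ≫ ι)
  refine he.objectEquality (.of_same ?_)
  rw [← reassoc_of% (reindex_cond e e)]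
  exact ⟨rfl, rfl⟩

/-- The composite is the opspan `(e, e)`, and `e` refines the identity opspan to it. -/
theorem cls_ofEquivExt_comp_incl_self {e : S.sk ⟶ T.sk} (he : IsEquivExt e) :
    cls (ContextMap.ofEquivExt S T e he) ≫ incl.map (Context.ofHom e).op = 𝟙 (Con.of S) := by
  rw [cls_ofEquivExt_comp_incl]
  exact cls_eq_iff.2 (ContextMap.objectivelyEqual_of_saturated he (𝟙 _) e ⟨rfl, rfl⟩ ⟨rfl, rfl⟩
    fun M _ ι _ => .of_same ⟨rfl, rfl⟩)

theorem incl_invertsEquivExt : InvertsEquivExt incl := fun S T e he =>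
  ⟨cls (ContextMap.ofEquivExt S T e he), incl_comp_cls_ofEquivExt he,
    cls_ofEquivExt_comp_incl_self he⟩

/-! ### Context maps as fractions, and uniqueness of the extension. -/

/-- The homomorphism of a context map, with values in its apex. -/
abbrev apexHom (m : ContextMap S T) :
    T ⟶ Context.ofEquivExt S m.ext m.isEquivExt :=
  Context.ofHom (T := Context.ofEquivExt S m.ext m.isEquivExt) m.hom

/-- The equivalence extension of a context map, as a homomorphism of contexts. -/
abbrev apexExt (m : ContextMap S T) :
    S ⟶ Context.ofEquivExt S m.ext m.isEquivExt :=
  Context.ofHom (T := Context.ofEquivExt S m.ext m.isEquivExt) m.ext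

/-- As the first factor is invertible, this equation determines the class of `m` from the image of
`incl`. It is the source of uniqueness, and it dictates the definition of `liftMap`. -/
theorem incl_apexExt_comp_cls (m : ContextMap S T) :
    incl.map (apexExt m).op ≫ cls m = incl.map (apexHom m).op := by
  have h := cls_ofEquivExt_comp_incl (T := Context.ofEquivExt S m.ext m.isEquivExt)
    m.isEquivExt m.hom
  have h' := incl_comp_cls_ofEquivExt (T := Context.ofEquivExt S m.ext m.isEquivExt)
    m.isEquivExt
  exact ((congrArg (_ ≫ ·) h.symm).trans (Category.assoc _ _ _).symm).trans
    ((congrArg (· ≫ _) h').trans (Category.id_comp _))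

/-- The value of a functor at `c`, the inverse of `a` followed by `b`, is determined by its values
at `a` and `b`. The comparison is heterogeneous because the functors agree on objects only up to an
equality. -/
theorem hEq_map_of_comp_eq {D C : Type*} [Category D] [Category C] {G G' : D ⥤ C} {X Y Z : D}
    {a : X ⟶ Y} (_ : IsIso a) {b : X ⟶ Z} {c : Y ⟶ Z} (h : a ≫ c = b) (hX : G.obj X = G'.obj X)
    (hY : G.obj Y = G'.obj Y) (hZ : G.obj Z = G'.obj Z) (ha : G.map a ≍ G'.map a)
    (hb : G.map b ≍ G'.map b) : G.map c ≍ G'.map c := by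
  rw [← conj_eqToHom_iff_heq' _ _ hX hY.symm] at ha
  rw [← conj_eqToHom_iff_heq' _ _ hX hZ.symm] at hb
  rw [← conj_eqToHom_iff_heq' _ _ hY hZ.symm, ← cancel_epi (G.map a), ← G.map_comp, h, hb, ha, ← h]
  simp

theorem functor_ext {C : Type*} [Category C] {G G' : Con ⥤ C} (h : incl ⋙ G = incl ⋙ G') :
    G = G' := by
  have h_obj : ∀ X, G.obj X = G'.obj X := fun X => Functor.congr_obj h (.op X.ctx)
  refine CategoryTheory.Functor.hext h_obj ?_
  rintro ⟨S⟩ ⟨T⟩ f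
  induction f using Quotient.ind with | _ m
  exact hEq_map_of_comp_eq (incl_invertsEquivExt _ _ _ m.isEquivExt)
    (incl_apexExt_comp_cls m) (h_obj _) (h_obj _) (h_obj _)
    (Functor.hcongr_hom h (apexExt m).op) (Functor.hcongr_hom h (apexHom m).op)

/-! ### Existence of the extension. -/

section Lift

variable {C : Type*} [Category C] (F : Contextᵒᵖ ⥤ C) (h₁ : RespectsObjectEquality F)
  (h₂ : InvertsEquivExt F)

include h₂ in
theorem isIso_map_apexExt (m : ContextMap S T) : IsIso (F.map (apexExt m).op) :=
  h₂ _ _ _ m.isEquivExt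

/-- The morphism induced by a context map. -/
noncomputable def liftMap (m : ContextMap S T) : F.obj (.op S) ⟶ F.obj (.op T) :=
  have := isIso_map_apexExt F h₂ m
  inv (F.map (apexExt m).op) ≫ F.map (apexHom m).op

variable {F h₂}

theorem liftMap_eq_iff {m : ContextMap S T} {x : F.obj (.op S) ⟶ F.obj (.op T)} :
    liftMap F h₂ m = x ↔ F.map (apexHom m).op = F.map (apexExt m).op ≫ x := by
  have := isIso_map_apexExt F h₂ m
  exact IsIso.inv_comp_eq _

theorem map_apexExt_comp_liftMap (m : ContextMap S T) :
    F.map (apexExt m).op ≫ liftMap F h₂ m = F.map (apexHom m).op :=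
  (liftMap_eq_iff.1 rfl).symm

include h₁ in
-- Over a common refinement `e`, both values become images under `F` of homomorphisms into the
-- refinement, which `F` identifies. As `F` inverts `e`, it can be cancelled.
theorem liftMap_congr {m n : ContextMap S T} (h : ContextMap.ObjectivelyEqual m n) :
    liftMap F h₂ m = liftMap F h₂ n := by
  obtain ⟨W, e, ε₀, ε₁, he, k₀, k₁, h⟩ := h.exists_strict
  let B := Context.ofEquivExt S e he
  have : IsIso (F.map (Context.ofHom (T := B) e).op) := h₂ S B e he
  have key : ∀ (p : ContextMap S T) (ε : p.apex ⟶ W), p.ext ≫ ε = e →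
      F.map (Context.ofHom (T := B) e).op ≫ liftMap F h₂ p =
        F.map (Context.ofHom (T := B) (p.hom ≫ ε)).op := by
    rintro p ε rfl
    let E : Context.ofEquivExt S p.ext p.isEquivExt ⟶ B := Context.ofHom (T := B) ε
    change F.map (apexExt p ≫ E).op ≫ _ = F.map (apexHom p ≫ E).op
    rw [op_comp, op_comp, F.map_comp, F.map_comp, Category.assoc, map_apexExt_comp_liftMap]
  rw [← cancel_epi (F.map (Context.ofHom (T := B) e).op), key m ε₀ k₀, key n ε₁ k₁]
  exact h₁ T B _ _ h

theorem liftMap_ofHom (f : T.sk ⟶ S.sk) :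
    liftMap F h₂ (ContextMap.ofHom f) = F.map (Context.ofHom f).op := by
  rw [liftMap_eq_iff]
  let i : S ⟶ Context.ofEquivExt S (𝟙 S.sk) (ContextMap.ofHom f).isEquivExt :=
    Context.ofHom (T := Context.ofEquivExt S (𝟙 S.sk) (ContextMap.ofHom f).isEquivExt) (𝟙 S.sk)
  change F.map (Context.ofHom f ≫ i).op = F.map i.op ≫ F.map (Context.ofHom f).op
  rw [op_comp, F.map_comp]

/-- The image under `F` of the pushout square that defines the composite allows the inverse of the
extension of `n` to be moved past the homomorphism of `m`, as in a calculus of fractions. -/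
theorem liftMap_comp {R : Context} (m : ContextMap R S) (n : ContextMap S T) :
    liftMap F h₂ (m.comp n) = liftMap F h₂ m ≫ liftMap F h₂ n := by
  rw [liftMap_eq_iff]
  let A := Context.ofEquivExt R m.ext m.isEquivExt
  let B := Context.ofEquivExt S n.ext n.isEquivExt
  let Q := Context.ofEquivExt R (m.comp n).ext (m.comp n).isEquivExt
  let a : A ⟶ Q := Context.ofHom (S := A) (T := Q) (reindexExt m.hom n.ext)
  let b : B ⟶ Q := Context.ofHom (S := B) (T := Q) (reindexHom m.hom n.ext)
  have hw : apexHom m ≫ a = apexExt n ≫ b := congrArg (Quotient.mk _) (reindex_cond m.hom n.ext)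
  have hw' := congrArg (fun x => F.map x.op) hw
  simp only [op_comp, F.map_comp] at hw'
  change F.map (apexHom n ≫ b).op = F.map (apexExt m ≫ a).op ≫ _
  rw [op_comp, op_comp, F.map_comp, F.map_comp, Category.assoc,
    reassoc_of% (map_apexExt_comp_liftMap (h₂ := h₂) m), reassoc_of% hw', map_apexExt_comp_liftMap]

variable (F h₂)

/-- The functor induced by a functor that respects object equalities and inverts equivalence
extensions. -/
noncomputable def lift : Con ⥤ C where
  obj X := F.obj (.op X.ctx)
  map {X Y} := Quotient.lift (fun m : ContextMap X.ctx Y.ctx => liftMap F h₂ m)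
    fun _ _ h => liftMap_congr h₁ (ContextMap.Congr.objectivelyEqual h)
  map_id X := (liftMap_ofHom (𝟙 X.ctx.sk)).trans (F.map_id _)
  map_comp f g := by
    induction f using Quotient.ind with | _ m
    induction g using Quotient.ind with | _ n
    exact liftMap_comp m n

theorem incl_comp_lift : incl ⋙ lift F h₁ h₂ = F := by
  refine CategoryTheory.Functor.hext (fun _ => rfl) ?_
  rintro ⟨S⟩ ⟨T⟩ ⟨f⟩
  induction f using Quotient.ind with | _ f
  exact heq_of_eq (liftMap_ofHom (h₂ := h₂) f)

end Lift

end Con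

end AUSketch

theorem mainTheorem7 :
    (∀ (S T : AUSketch.Context) (m n : AUSketch.ContextMap S T),
      AUSketch.Con.cls m = AUSketch.Con.cls n ↔ AUSketch.ContextMap.ObjectivelyEqual m n) ∧
    AUSketch.RespectsObjectEquality AUSketch.Con.incl ∧
    AUSketch.InvertsEquivExt AUSketch.Con.incl ∧
    ∀ (C : Type*) [Category C] (F : AUSketch.Contextᵒᵖ ⥤ C),
      AUSketch.RespectsObjectEquality F → AUSketch.InvertsEquivExt F →
        ∃! G : AUSketch.Con ⥤ C, AUSketch.Con.incl ⋙ G = F := by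
  refine ⟨fun _ _ _ _ => AUSketch.Con.cls_eq_iff, AUSketch.Con.incl_respectsObjectEquality,
    AUSketch.Con.incl_invertsEquivExt, fun C _ F h₁ h₂ => ?_⟩
  exact ⟨AUSketch.Con.lift F h₁ h₂, AUSketch.Con.incl_comp_lift F h₁ h₂,
    fun G hG => AUSketch.Con.functor_ext (hG.trans (AUSketch.Con.incl_comp_lift F h₁ h₂).symm)⟩
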